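/- **Soundness of the type-and-effect system of Proto-Quipper-R.** *Circuits and effects.* A strict symmetric premonoidal category is a category with a strictly associative and unital tensor $\otimes$ (unit $I$) on objects, functors $X\rtimes-$ and $-\ltimes X$ acting as $X\otimes-$ and $-\otimes X$ on objects and compatible with the strict associativity and unit laws (interchange is not required), and a natural symmetry with central components satisfying the hexagon law. A *circuit algebra* $\mathcal E$ is a strict symmetric premonoidal category whose hom-sets carry preorders $\lesssim$ for which composition, $X\rtimes-$ and $-\ltimes X$ are monotone. Let $\mathcal M$ be a strict symmetric premonoidal category (of circuits), $W$ a set of wire types, each interpreted as an object of $\mathcal M$, and $\alpha:\mathcal M\to\mathcal E$ an *abstraction*, i.e. a strict symmetric premonoidal functor. For $T,U\in\mathcal M$ and $e:\alpha T\to\alpha U$ put $\mathcal M^{\lesssim e}(T,U)=\{C\in\mathcal M(T,U)\mid\alpha(C)\lesssim e\}$ and $\mathcal T^{e}(X)=X\times\mathcal M^{\lesssim e}(T,U)$ for a set $X$. If $e\lesssim d$, there is an inclusion $\mathcal T^{e\lesssim d}:\mathcal T^eX\to\mathcal T^dX$. For a function $f:X\to Y$ and a circuit $C:T\to U$, $J(f,C):X\to\mathcal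 T^{\alpha(C)}Y$ is $x\mapsto(f(x),C)$. *Types and terms.* Here $w\in W$, and $e$ ranges over morphisms of $\mathcal E$. - Bundle types: $T,U::=\mathbb 1\mid w\mid T\otimes U$. - Types: $A,B::=\mathbb 1\mid\mathsf{Nat}\mid w\mid A\otimes B\mid A\multimap_T^{e}B\mid\,!^{e}A\mid\mathsf{Circ}^{e}(T,U)$. Parameter types are generated by $\mathbb 1,\mathsf{Nat},\otimes,!^eA,\mathsf{Circ}^e(T,U)$. - Values: $V::=*\mid n\mid\ell\mid x\mid\lambda x^A.M\mid\mathsf{lift}\,M\mid(\bar\ell,C,\bar k)\mid\langle V,V'\rangle$, where $\bar\ell,\bar k$ are wire bundles (built from $*$, labels and pairs) and $C:Q\to L$ is a morphism of $\mathcal M$ between the interpretations of label contexts $Q,L$ (lists of distinct labels with wire types). - Computations: $M::=V\,V'\mid\mathsf{force}\,V\mid\mathsf{box}_TV\mid\mathsf{apply}(V,V')\mid\mathsf{let}\,\langle x,y\rangle=V\,\mathsf{in}\,M\mid\mathsf{ifz}\,V\,M\,M'\mid\mathsf{return}\,V\mid\mathsf{let}\,x=M\,\mathsf{in}\,N$,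 up to renaming of bound variables. A type is interpreted by a set $\flat A$ and an object $\sharp A$ of $\mathcal M$. The set $\flat$ is a singleton for $\mathbb 1$ and $w$, is $\mathbb N$ for $\mathsf{Nat}$, and is the product for $\otimes$; $\sharp w$ is the given object, $\sharp(A\otimes B)=\sharp A\otimes\sharp B$, $\sharp(A\multimap_T^eB)=\sharp T$, and $\sharp=I$ otherwise. Moreover $\flat(A\multimap_T^eB)$ is the set of functions $\flat A\to\flat B\times\mathcal M^{\lesssim e}(\sharp T\otimes\sharp A,\sharp B)$, $\flat(!^eA)=\flat A\times\mathcal M^{\lesssim e}(I,\sharp A)$ and $\flat\,\mathsf{Circ}^e(T,U)=\mathcal M^{\lesssim e}(\sharp T,\sharp U)$. Annotations in types must have the corresponding domain and codomain under $\alpha$. Contexts $\Gamma$ are lists of typed labels and variables, interpreted componentwise; $\Phi$ denotes a context of variables of parameter type. *Typing of values* $\Gamma\vdash V:A$: - $\Phi\vdash *:\mathbb 1$; $\ \Phi\vdash n:\mathsf{Nat}$; $\ \Phi,\ell:w\vdash\ell:w$; $\ \Phi,x:A\vdash x:A$. - If $\Gamma,x:A\vdash M:B;e$ then $\Gamma\vdash\lambda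 x^A.M:A\multimap_{T}^eB$, where the list of wire types of $T$ is that of $\sharp\Gamma$. - If $\Phi\vdash M:A;e$ then $\Phi\vdash\mathsf{lift}\,M:\,!^eA$. - Let $C:Q\to L$, let $Q',L'$ be permutations of $Q,L$ with $Q'\vdash\bar\ell:T$ and $L'\vdash\bar k:U$, and let $[\![(\bar\ell,C,\bar k)]\!]:\sharp T\to\sharp U$ be $C$ composed with the permutation isomorphisms $Q'\cong Q$ and $L\cong L'$. If $\alpha([\![(\bar\ell,C,\bar k)]\!])\lesssim e$ then $\Phi\vdash(\bar\ell,C,\bar k):\mathsf{Circ}^e(T,U)$. - If $\Phi,\Gamma_1\vdash V:A$ and $\Phi,\Gamma_2\vdash V':B$ then $\Phi,\Gamma_1,\Gamma_2\vdash\langle V,V'\rangle:A\otimes B$. *Typing of computations* $\Gamma\vdash M:A;e$ (so that $e:\alpha(\sharp\Gamma)\to\alpha(\sharp A)$): - If $\Phi,\Gamma_1\vdash V:A\multimap_T^eB$ and $\Phi,\Gamma_2\vdash V':A$ then $\Phi,\Gamma_1,\Gamma_2\vdash V\,V':B;e$. - If $\Phi\vdash V:\,!^eA$ then $\Phi\vdash\mathsf{force}\,V:A;e$.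 - If $\Phi\vdash V:T\multimap_{\mathbb 1}^eU$ then $\Phi\vdash\mathsf{box}_TV:\mathsf{Circ}^e(T,U);\mathrm{id}_I$. - If $\Phi,\Gamma_1\vdash V:\mathsf{Circ}^e(T,U)$ and $\Phi,\Gamma_2\vdash V':T$ then $\Phi,\Gamma_1,\Gamma_2\vdash\mathsf{apply}(V,V'):U;e$. - If $\Phi,\Gamma_1\vdash V:A\otimes B$ and $\Phi,\Gamma_2,x:A,y:B\vdash M:A';e$ then $\Phi,\Gamma_2,\Gamma_1\vdash\mathsf{let}\,\langle x,y\rangle=V\,\mathsf{in}\,M:A';e$. - If $\Phi\vdash V:\mathsf{Nat}$ and $\Phi,\Gamma\vdash M:A;e$, $\ \Phi,\Gamma\vdash M':A;e$ then $\Phi,\Gamma\vdash\mathsf{ifz}\,V\,M\,M':A;e$. - If $\Gamma\vdash V:A$ then $\Gamma\vdash\mathsf{return}\,V:A;\mathrm{id}_{\alpha(\sharp A)}$. - If $\Phi,\Gamma_1\vdash M:A;e_1$ and $\Phi,\Gamma_2,x:A\vdash N:B;e_2$ then $\Phi,\Gamma_2,\Gamma_1\vdash\mathsf{let}\,x=M\,\mathsf{in}\,N:B;(\alpha(\sharp\Gamma_2)\rtimes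 e_1);e_2$. - (subsumption) If $\Gamma\vdash M:A;e_1$ and $e_1\lesssim e_2$ then $\Gamma\vdash M:A;e_2$. - (exchange) If $\Gamma_1,a:A,b:B,\Gamma_2\vdash M:A';e$ then $\Gamma_1,b:B,a:A,\Gamma_2\vdash M:A';\alpha(\mathbf{perm});e$, where $\mathbf{perm}$ is the symmetry exchanging $\sharp B$ and $\sharp A$. *Interpretation.* By induction on derivations, $\Gamma\vdash V:A$ is interpreted as a function $\flat\Gamma\to\flat A$ (one has $\sharp\Gamma=\sharp A$), and $\Gamma\vdash M:A;e$ as a function $[\![M]\!]:\flat\Gamma\to\flat A\times\mathcal M^{\lesssim e}(\sharp\Gamma,\sharp A)$. Values are interpreted in the evident way, abstractions and $\mathsf{lift}$ by currying, and a boxed circuit by $[\![(\bar\ell,C,\bar k)]\!]$. Application and $\mathsf{force}$ are function evaluation; $\mathsf{apply}$ returns the circuit denoted by its first argument; $\mathsf{box}$ returns the circuit part of the value of $V$ at the unique element of $\flat T$, together with the identity circuit; $\mathsf{return}$ adds an identity circuit; destructuring and $\mathsf{ifz}$ are as in sets. If $M$ yields $(a,C)$ and $N$, at $a$, yields $(b,D)$,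 then $\mathsf{let}\,x=M\,\mathsf{in}\,N$ yields $(b,(\sharp\Gamma_2\rtimes C);D)$. Subsumption is the inclusion, and exchange precomposes the circuit with $\mathbf{perm}$. *Configurations and evaluation.* A configuration is a pair $(C,M)$ of a circuit $C:Q\to R$ between label contexts and a computation. Evaluation $(C,M)\Downarrow(C',V)$ is the least relation such that: - $((\lambda x^A.M)\,V)$, $\mathsf{force}(\mathsf{lift}\,M)$, $\mathsf{let}\,\langle x,y\rangle=\langle V,V'\rangle\,\mathsf{in}\,M$, $\mathsf{ifz}\,0\,M\,M'$ and $\mathsf{ifz}\,(n+1)\,M\,M'$, run with $C$, evaluate as $M[V/x]$, $M$, $M[V/x,V'/y]$, $M$ and $M'$, respectively, run with $C$; - $(C,\mathsf{return}\,V)\Downarrow(C,V)$; - if $(C,M)\Downarrow(C',U)$ and $(C',N[U/x])\Downarrow(C'',V)$ then $(C,\mathsf{let}\,x=M\,\mathsf{in}\,N)\Downarrow(C'',V)$; - if $\bar\ell$ is a bundle of distinct labels with $Q\vdash\bar\ell:T$ and $(\mathrm{id}_Q,V\,\bar\ell)\Downarrow(D,\bar k)$ then $(C,\mathsf{box}_TV)\Downarrow(C,(\bar\ell,D,\bar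 k))$; - $(C,\mathsf{apply}((\bar\ell,D,\bar k),\bar\ell'))\Downarrow(C',\bar k')$, where $\bar\ell'$ is a renaming of $\bar\ell$, $\bar k'$ is a renaming of $\bar k$ to labels distinct from the remaining outputs, and $C'$ is $C$ followed by a permutation bringing the labels of the renamed inputs of $D$ to the front, and by $D\ltimes R$, where $R$ are the remaining outputs of $C$. The judgment $Q\vdash(C,M):A;Q';e$ means that $C$ is a circuit from $Q$ to label contexts $L,Q'$ (up to a permutation of the outputs) and that $L\vdash M:A;e$. Then $[\![(C,M)]\!]$ is the element $(a,\,C;(D\ltimes Q'))$ of $\flat A\times\mathcal M^{\lesssim e'}(Q,\sharp A\otimes Q')$, where $(a,D)$ is the value of $[\![M]\!]$ and $e'=\alpha(C);(e\ltimes\alpha(Q'))$. Similarly $Q\vdash(C',V):A;Q'$ means that the outputs of $C'$ are $L',Q'$ (up to a permutation) and $L'\vdash V:A$; then $[\![(C',V)]\!]$ is the pair of the element $[\![V]\!]\in\flat A$ and the morphism $C'$ (with this permutation) from $Q$ to $\sharp A\otimes Q'$. **Theorem.** Suppose that $Q\vdash(C,M):A;Q';e$ and $(C,M)\Downarrow(C',V)$.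 Then $Q\vdash(C',V):A;Q'$ and $[\![(C,M)]\!]=J([\![(C',V)]\!])$. Explicitly: for every derivation of the judgment for $(C,M)$ there is a derivation of the judgment for $(C',V)$ such that, writing $c$ for the morphism part of $[\![(C',V)]\!]$, one has $\alpha(c)\lesssim\alpha(C);(e\ltimes\alpha(Q'))$, and $[\![(C,M)]\!]$ is the image of $J([\![(C',V)]\!])$ under the inclusion $\mathcal T^{\alpha(c)\,\lesssim\,\alpha(C);(e\ltimes\alpha(Q'))}$. -/

import Mathlib

open CategoryTheory

universe v v' u u' w

namespace ProtoQuipperR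

/-! ### Strict symmetric premonoidal categories, circuit algebras, abstractions -/

/-- A strict symmetric premonoidal category.  `lw X f` is the functor `X ⋊ -` (wires `X` are added
on the left of `f`) and `rw f X` is the functor `- ⋉ X` (wires `X` are added on the right).
Strictness means that associators and unitors are identities; naturality of the
associator and of the unitors then amounts to the equations between whiskerings below.
Interchange of `lw` and `rw` is not assumed, except for the symmetry, which is central. -/
class StrictSymPremonoidal (C : Type u) [Category.{v} C] where
  tensor : C → C → C
  unit : C
  tensor_assoc : ∀ X Y Z : C, tensor (tensor X Y) Z = tensor X (tensor Y Z)
  unit_tensor : ∀ X : C, tensor unit X = X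
  tensor_unit : ∀ X : C, tensor X unit = X
  lw : ∀ (X : C) {Y Z : C}, (Y ⟶ Z) → (tensor X Y ⟶ tensor X Z)
  rw : ∀ {Y Z : C}, (Y ⟶ Z) → ∀ X : C, (tensor Y X ⟶ tensor Z X)
  lw_id : ∀ X Y : C, lw X (𝟙 Y) = 𝟙 (tensor X Y)
  lw_comp : ∀ (X : C) {Y Z W : C} (f : Y ⟶ Z) (g : Z ⟶ W), lw X (f ≫ g) = lw X f ≫ lw X g
  rw_id : ∀ X Y : C, rw (𝟙 Y) X = 𝟙 (tensor Y X)
  rw_comp : ∀ (X : C) {Y Z W : C} (f : Y ⟶ Z) (g : Z ⟶ W), rw (f ≫ g) X = rw f X ≫ rw g X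
  lw_tensor : ∀ (X X' : C) {Y Z : C} (f : Y ⟶ Z),
    lw (tensor X X') f =
      eqToHom (tensor_assoc X X' Y) ≫ lw X (lw X' f) ≫ eqToHom (tensor_assoc X X' Z).symm
  rw_tensor : ∀ {Y Z : C} (f : Y ⟶ Z) (X X' : C),
    rw f (tensor X X') =
      eqToHom (tensor_assoc Y X X').symm ≫ rw (rw f X) X' ≫ eqToHom (tensor_assoc Z X X')
  rw_lw : ∀ (X : C) {Y Z : C} (f : Y ⟶ Z) (X' : C),
    rw (lw X f) X' =
      eqToHom (tensor_assoc X Y X') ≫ lw X (rw f X') ≫ eqToHom (tensor_assoc X Z X').symm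
  lw_unit : ∀ {Y Z : C} (f : Y ⟶ Z),
    lw unit f = eqToHom (unit_tensor Y) ≫ f ≫ eqToHom (unit_tensor Z).symm
  rw_unit : ∀ {Y Z : C} (f : Y ⟶ Z),
    rw f unit = eqToHom (tensor_unit Y) ≫ f ≫ eqToHom (tensor_unit Z).symm
  braid : ∀ X Y : C, tensor X Y ⟶ tensor Y X
  braid_braid : ∀ X Y : C, braid X Y ≫ braid Y X = 𝟙 (tensor X Y)
  braid_natural : ∀ {Y Z : C} (f : Y ⟶ Z) (X : C),
    rw f X ≫ braid Z X = braid Y X ≫ lw X f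
  braid_tensor : ∀ X Y Z : C,
    braid X (tensor Y Z) =
      eqToHom (tensor_assoc X Y Z).symm ≫ rw (braid X Y) Z ≫ eqToHom (tensor_assoc Y X Z) ≫
        lw Y (braid X Z) ≫ eqToHom (tensor_assoc Y Z X).symm
  braid_central_left : ∀ (X Y : C) {A B : C} (g : A ⟶ B),
    rw (braid X Y) A ≫ lw (tensor Y X) g = lw (tensor X Y) g ≫ rw (braid X Y) B
  braid_central_right : ∀ (X Y : C) {A B : C} (g : A ⟶ B),
    lw A (braid X Y) ≫ rw g (tensor Y X) = rw g (tensor X Y) ≫ lw B (braid X Y)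

open StrictSymPremonoidal

infixr:70 " ⊗ₚ " => StrictSymPremonoidal.tensor

/-- A circuit algebra: a preorder-enriched strict symmetric premonoidal category. -/
class CircuitAlgebra (E : Type u) [Category.{v} E] extends StrictSymPremonoidal E where
  homPreorder : ∀ X Y : E, Preorder (X ⟶ Y)
  comp_mono : ∀ {X Y Z : E} {e₁ d₁ : X ⟶ Y} {e₂ d₂ : Y ⟶ Z},
    e₁ ≤ d₁ → e₂ ≤ d₂ → e₁ ≫ e₂ ≤ d₁ ≫ d₂
  lw_mono : ∀ (X : E) {Y Z : E} {e d : Y ⟶ Z}, e ≤ d → lw X e ≤ lw X d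
  rw_mono : ∀ {Y Z : E} {e d : Y ⟶ Z} (X : E), e ≤ d → rw e X ≤ rw d X

attribute [instance, reducible] CircuitAlgebra.homPreorder

/-- An abstraction: a strict symmetric premonoidal functor from circuits to a circuit algebra. -/
structure Abstraction (M : Type u) [Category.{v} M] [StrictSymPremonoidal M]
    (E : Type u') [Category.{v'} E] [CircuitAlgebra E] extends M ⥤ E where
  obj_unit : obj (StrictSymPremonoidal.unit : M) = StrictSymPremonoidal.unit
  obj_tensor : ∀ X Y : M, obj (X ⊗ₚ Y) = obj X ⊗ₚ obj Y
  map_lw : ∀ (X : M) {Y Z : M} (f : Y ⟶ Z),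
    map (lw X f) =
      eqToHom (obj_tensor X Y) ≫ lw (obj X) (map f) ≫ eqToHom (obj_tensor X Z).symm
  map_rw : ∀ {Y Z : M} (f : Y ⟶ Z) (X : M),
    map (rw f X) =
      eqToHom (obj_tensor Y X) ≫ rw (map f) (obj X) ≫ eqToHom (obj_tensor Z X).symm
  map_braid : ∀ X Y : M,
    map (braid X Y) =
      eqToHom (obj_tensor X Y) ≫ braid (obj X) (obj Y) ≫ eqToHom (obj_tensor Y X).symm

/-! ### Tensor products of lists and permutation isomorphisms -/

section Lists

variable {C : Type u} [Category.{v} C] [StrictSymPremonoidal C] {X : Type w} (f : X → C)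

/-- The tensor product of the objects attached to the entries of a list. -/
def listObj : List X → C
  | [] => StrictSymPremonoidal.unit
  | a :: l => f a ⊗ₚ listObj l

theorem listObj_append (l l' : List X) :
    listObj f (l ++ l') = listObj f l ⊗ₚ listObj f l' := by
  induction l with
  | nil => exact (unit_tensor _).symm
  | cons a l ih =>
    change f a ⊗ₚ listObj f (l ++ l') = (f a ⊗ₚ listObj f l) ⊗ₚ listObj f l'
    rw [ih, tensor_assoc]

/-- The symmetry exchanging two adjacent entries of a list. -/
def swapHom : (l : List X) → (a b : X) → (l' : List X) →
    (listObj f (l ++ a :: b :: l') ⟶ listObj f (l ++ b :: a :: l'))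
  | [], a, b, l' =>
    eqToHom (tensor_assoc (f a) (f b) (listObj f l')).symm ≫
      rw (braid (f a) (f b)) (listObj f l') ≫ eqToHom (tensor_assoc (f b) (f a) (listObj f l'))
  | c :: l, a, b, l' => lw (f c) (swapHom l a b l')

/-- `IsPerm f l l' p`: the list `l'` is a permutation of `l`, and `p` is a permutation isomorphism
from the tensor product of `l` to that of `l'`, i.e. a composite of symmetries
exchanging adjacent entries. -/
inductive IsPerm : (l l' : List X) → (listObj f l ⟶ listObj f l') → Prop
  | refl (l : List X) : IsPerm l l (𝟙 _)
  | swap (l : List X) (a b : X) (l' : List X) :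
      IsPerm (l ++ a :: b :: l') (l ++ b :: a :: l') (swapHom f l a b l')
  | trans {l₁ l₂ l₃ : List X} {p : listObj f l₁ ⟶ listObj f l₂}
      {q : listObj f l₂ ⟶ listObj f l₃} :
      IsPerm l₁ l₂ p → IsPerm l₂ l₃ q → IsPerm l₁ l₃ (p ≫ q)

end Lists

/-! ### Effect annotations and circuits bounded by an effect annotation -/

/-- An effect annotation `e : t ⟶ u`, i.e. a morphism of the circuit algebra together with
its domain and codomain. -/
structure Eff (E : Type u) [Category.{v} E] where
  dom : E
  cod : E
  hom : dom ⟶ cod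

section Bounded

variable {M : Type u} [Category.{v} M] [StrictSymPremonoidal M]
  {E : Type u'} [Category.{v'} E] [CircuitAlgebra E] (α : Abstraction M E)

/-- `Bounded α C e` says that `e` is an annotation `α X ⟶ α Y` and that `α(C) ≲ e`. -/
def Bounded {X Y : M} (C : X ⟶ Y) (e : Eff E) : Prop :=
  ∃ (h : α.obj X = e.dom) (h' : e.cod = α.obj Y), α.map C ≤ eqToHom h ≫ e.hom ≫ eqToHom h'

/-- The set of circuits `C : X ⟶ Y` with `α(C) ≲ e`. -/
def Circs (e : Eff E) (X Y : M) : Type v := {C : X ⟶ Y // Bounded α C e}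

/-- The action on objects of the category-graded circuit monad. -/
abbrev CircMonad (e : Eff E) (X Y : M) (S : Type v) : Type v := S × Circs α e X Y

/-- The preorder on effect annotations. -/
def Eff.Le (e d : Eff E) : Prop :=
  ∃ (h : e.dom = d.dom) (h' : d.cod = e.cod), e.hom ≤ eqToHom h ≫ d.hom ≫ eqToHom h'

variable {α}

/-- A circuit, bounded by its own abstraction. -/
def Circs.pure {X Y : M} (C : X ⟶ Y) : Circs α ⟨α.obj X, α.obj Y, α.map C⟩ X Y :=
  ⟨C, rfl, rfl, by simp⟩

/-- Transport of a bounded circuit along equalities of objects. -/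
def Circs.cast {e : Eff E} {X X' Y Y' : M} (hX : X' = X) (hY : Y = Y') (C : Circs α e X Y) :
    Circs α e X' Y' :=
  ⟨eqToHom hX ≫ C.1 ≫ eqToHom hY, by subst hX hY; simpa using C.2⟩

/-- The identity circuit. -/
def Circs.id (X : M) : Circs α ⟨α.obj X, α.obj X, 𝟙 _⟩ X X := ⟨𝟙 X, rfl, rfl, by simp⟩

/-- The identity circuit of the monoidal unit, bounded by the null effect. -/
def Circs.idUnit : Circs α ⟨StrictSymPremonoidal.unit, StrictSymPremonoidal.unit, 𝟙 _⟩
    StrictSymPremonoidal.unit StrictSymPremonoidal.unit :=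
  ⟨𝟙 _, α.obj_unit, α.obj_unit.symm, by simp⟩

/-- Sequential composition of bounded circuits. -/
def Circs.comp {e d : Eff E} {X Y Z : M} (C : Circs α e X Y) (D : Circs α d Y Z)
    (h : e.cod = d.dom) : Circs α ⟨e.dom, d.cod, e.hom ≫ eqToHom h ≫ d.hom⟩ X Z :=
  ⟨C.1 ≫ D.1, by
    obtain ⟨C, hX, hY, hC⟩ := C
    obtain ⟨D, hY', hZ, hD⟩ := D
    obtain ⟨a, b, e⟩ := e
    obtain ⟨a', b', d⟩ := d
    dsimp only at hX hY hC hY' hZ hD h ⊢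
    subst hX hY hZ h
    refine ⟨rfl, rfl, ?_⟩
    rw [α.map_comp]
    simpa using CircuitAlgebra.comp_mono hC hD⟩

/-- Adding wires on the left of a bounded circuit. -/
def Circs.lwhisk {e : Eff E} {X Y : M} (Z : M) (C : Circs α e X Y) :
    Circs α ⟨α.obj Z ⊗ₚ e.dom, α.obj Z ⊗ₚ e.cod, lw (α.obj Z) e.hom⟩ (Z ⊗ₚ X) (Z ⊗ₚ Y) :=
  ⟨lw Z C.1, by
    obtain ⟨C, hX, hY, hC⟩ := C
    obtain ⟨a, b, e⟩ := e
    dsimp only at hX hY hC ⊢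
    subst hX hY
    refine ⟨α.obj_tensor _ _, (α.obj_tensor _ _).symm, ?_⟩
    rw [α.map_lw]
    refine CircuitAlgebra.comp_mono le_rfl (CircuitAlgebra.comp_mono ?_ le_rfl)
    exact CircuitAlgebra.lw_mono _ (by simpa using hC)⟩

/-- Adding wires on the right of a bounded circuit. -/
def Circs.rwhisk {e : Eff E} {X Y : M} (C : Circs α e X Y) (Z : M) :
    Circs α ⟨e.dom ⊗ₚ α.obj Z, e.cod ⊗ₚ α.obj Z, rw e.hom (α.obj Z)⟩ (X ⊗ₚ Z) (Y ⊗ₚ Z) :=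
  ⟨rw C.1 Z, by
    obtain ⟨C, hX, hY, hC⟩ := C
    obtain ⟨a, b, e⟩ := e
    dsimp only at hX hY hC ⊢
    subst hX hY
    refine ⟨α.obj_tensor _ _, (α.obj_tensor _ _).symm, ?_⟩
    rw [α.map_rw]
    refine CircuitAlgebra.comp_mono le_rfl (CircuitAlgebra.comp_mono ?_ le_rfl)
    exact CircuitAlgebra.rw_mono _ (by simpa using hC)⟩

/-- The inclusion of the circuits bounded by `e` into those bounded by `d`, where `e ≲ d`. -/
def Circs.incl {e d : Eff E} {X Y : M} (h : e.Le d) (C : Circs α e X Y) : Circs α d X Y :=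
  ⟨C.1, by
    obtain ⟨C, hX, hY, hC⟩ := C
    obtain ⟨a, b, e⟩ := e
    obtain ⟨a', b', d⟩ := d
    obtain ⟨h, h', hed⟩ := h
    dsimp only at hX hY hC h h' hed ⊢
    subst h h'
    exact ⟨hX, hY, hC.trans (CircuitAlgebra.comp_mono le_rfl
      (CircuitAlgebra.comp_mono (by simpa using hed) le_rfl))⟩⟩

/-- The map `T^{e ≲ d}` of the category-graded circuit monad. -/
def CircMonad.incl {e d : Eff E} {X Y : M} {S : Type v} (h : e.Le d)
    (r : CircMonad α e X Y S) : CircMonad α d X Y S := (r.1, r.2.incl h)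

/-- The map `J`, sending a function and a circuit to a computation that builds this circuit. -/
def J {S S' : Type v} {X Y : M} (f : S → S') (C : X ⟶ Y) :
    S → CircMonad α ⟨α.obj X, α.obj Y, α.map C⟩ X Y S' := fun x => (f x, Circs.pure C)

end Bounded

/-! ### Types -/

/-- Bundle types. -/
inductive Bundle (W : Type w) : Type w
  | unit : Bundle W
  | wire : W → Bundle W
  | tensor : Bundle W → Bundle W → Bundle W

/-- The list of wire types of a bundle type; two bundle types have the same list iff they are
equal up to the strict associativity and unit laws. -/
def Bundle.wires {W : Type w} : Bundle W → List W
  | .unit => []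
  | .wire a => [a]
  | .tensor T U => T.wires ++ U.wires

/-- Types.  The type `arrow A B T e` is the type of closures from `A` to `B` that capture wires
of bundle type `T` and build a circuit of effect `e`; `bang A e` is the type of thunks,
and `circ T U e` that of boxed circuits. -/
inductive Ty (W : Type w) (E : Type u') [Category.{v'} E] : Type (max w u' v')
  | unit : Ty W E
  | nat : Ty W E
  | wire : W → Ty W E
  | tensor : Ty W E → Ty W E → Ty W E
  | arrow : Ty W E → Ty W E → Bundle W → Eff E → Ty W E
  | bang : Ty W E → Eff E → Ty W E
  | circ : Bundle W → Bundle W → Eff E → Ty W E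

section Types

variable {W : Type w} {E : Type u'} [Category.{v'} E]

/-- Every bundle type is a type. -/
def Bundle.toTy : Bundle W → Ty W E
  | .unit => .unit
  | .wire a => .wire a
  | .tensor T U => .tensor T.toTy U.toTy

/-- Parameter types. -/
def Ty.IsParam : Ty W E → Prop
  | .unit => True
  | .nat => True
  | .wire _ => False
  | .tensor A B => A.IsParam ∧ B.IsParam
  | .arrow _ _ _ _ => False
  | .bang _ _ => True
  | .circ _ _ _ => True

/-- The list of wire types of the circuit part of a type. -/
def Ty.wires : Ty W E → List W
  | .unit => []
  | .nat => []
  | .wire a => [a]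
  | .tensor A B => A.wires ++ B.wires
  | .arrow _ _ T _ => T.wires
  | .bang _ _ => []
  | .circ _ _ _ => []

variable {M : Type u} [Category.{v} M] [StrictSymPremonoidal M] (ob : W → M)

/-- The interpretation of a bundle type as an object of the category of circuits. -/
def Bundle.obj : Bundle W → M
  | .unit => StrictSymPremonoidal.unit
  | .wire a => ob a
  | .tensor T U => T.obj ⊗ₚ U.obj

/-- The circuit part `♯⟦A⟧` of the interpretation of a type. -/
def Ty.obj : Ty W E → M
  | .unit => StrictSymPremonoidal.unit
  | .nat => StrictSymPremonoidal.unit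
  | .wire a => ob a
  | .tensor A B => A.obj ⊗ₚ B.obj
  | .arrow _ _ T _ => T.obj ob
  | .bang _ _ => StrictSymPremonoidal.unit
  | .circ _ _ _ => StrictSymPremonoidal.unit

theorem Bundle.toTy_obj (T : Bundle W) : (T.toTy : Ty W E).obj ob = T.obj ob := by
  induction T with
  | unit => rfl
  | wire a => rfl
  | tensor T U ihT ihU => simp only [Bundle.toTy, Ty.obj, Bundle.obj, ihT, ihU]

theorem Bundle.obj_eq (T : Bundle W) : T.obj ob = listObj ob T.wires := by
  induction T with
  | unit => rfl
  | wire a => exact (tensor_unit _).symm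
  | tensor T U ihT ihU => simp only [Bundle.obj, Bundle.wires, listObj_append, ihT, ihU]

theorem Ty.obj_eq (A : Ty W E) : A.obj ob = listObj ob A.wires := by
  induction A with
  | wire a => exact (tensor_unit _).symm
  | tensor A B ihA ihB => simp only [Ty.obj, Ty.wires, listObj_append, ihA, ihB]
  | arrow A B T e _ _ => exact T.obj_eq ob
  | _ => rfl

theorem Ty.IsParam.obj_eq {A : Ty W E} (h : A.IsParam) :
    A.obj ob = StrictSymPremonoidal.unit := by
  induction A with
  | wire a => exact h.elim
  | tensor A B ihA ihB => simp only [Ty.obj, ihA h.1, ihB h.2, unit_tensor]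
  | arrow A B T e _ _ => exact h.elim
  | _ => rfl

end Types

section TypeSemantics

variable {W : Type w} {E : Type u'} [Category.{v'} E] [CircuitAlgebra E]
  {M : Type u} [Category.{v} M] [StrictSymPremonoidal M] (ob : W → M) (α : Abstraction M E)

/-- A type is well formed if its effect annotations go between the abstractions of the
interfaces of the circuits that they annotate. -/
def Ty.WF : Ty W E → Prop
  | .unit => True
  | .nat => True
  | .wire _ => True
  | .tensor A B => A.WF ∧ B.WF
  | .arrow A B T e =>
    A.WF ∧ B.WF ∧ e.dom = α.obj (T.obj ob ⊗ₚ A.obj ob) ∧ e.cod = α.obj (B.obj ob)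
  | .bang A e =>
    A.WF ∧ e.dom = α.obj StrictSymPremonoidal.unit ∧ e.cod = α.obj (A.obj ob)
  | .circ T U e => e.dom = α.obj (T.obj ob) ∧ e.cod = α.obj (U.obj ob)

/-- The parametric part `♭⟦A⟧` of the interpretation of a type. -/
def Ty.flat : Ty W E → Type v
  | .unit => PUnit
  | .nat => ULift ℕ
  | .wire _ => PUnit
  | .tensor A B => A.flat × B.flat
  | .arrow A B T e => A.flat → CircMonad α e (T.obj ob ⊗ₚ A.obj ob) (B.obj ob) B.flat
  | .bang A e => PUnit.{v + 1} → CircMonad α e StrictSymPremonoidal.unit (A.obj ob) A.flat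
  | .circ T U e => Circs α e (T.obj ob) (U.obj ob)

/-- The only element of the parametric part of a bundle type. -/
def Bundle.pt : (T : Bundle W) → (T.toTy : Ty W E).flat ob α
  | .unit => PUnit.unit
  | .wire _ => PUnit.unit
  | .tensor T U => (T.pt, U.pt)

end TypeSemantics

/-! ### Labelled circuits -/

/-- Label contexts: lists of labels (natural numbers) with their wire types. -/
abbrev LabCtx (W : Type w) : Type w := List (ℕ × W)

/-- The labels of a label context are pairwise distinct. -/
def LabCtx.Distinct {W : Type w} (Q : LabCtx W) : Prop := (Q.map Prod.fst).Nodup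

/-- Renaming of labels. -/
def LabCtx.relabel {W : Type w} (ρ : ℕ → ℕ) (Q : LabCtx W) : LabCtx W :=
  Q.map fun a => (ρ a.1, a.2)

section LabelledCircuits

variable {W : Type w} {M : Type u} [Category.{v} M] [StrictSymPremonoidal M] (ob : W → M)

/-- The object of the category of circuits that interprets a label context. -/
abbrev LabCtx.obj (Q : LabCtx W) : M := listObj (fun a : ℕ × W => ob a.2) Q

theorem LabCtx.relabel_obj (ρ : ℕ → ℕ) (Q : LabCtx W) : (Q.relabel ρ).obj ob = Q.obj ob := by
  induction Q with
  | nil => rfl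
  | cons a Q ih =>
    change ob a.2 ⊗ₚ LabCtx.obj ob (LabCtx.relabel ρ Q) = ob a.2 ⊗ₚ LabCtx.obj ob Q
    rw [ih]

/-- A labelled circuit `C : dom → cod` between label contexts. -/
structure LCirc where
  dom : LabCtx W
  cod : LabCtx W
  hom : dom.obj ob ⟶ cod.obj ob
  dom_distinct : dom.Distinct
  cod_distinct : cod.Distinct

/-- The identity circuit on a label context. -/
def LCirc.id (Q : LabCtx W) (hQ : Q.Distinct) : LCirc ob := ⟨Q, Q, 𝟙 _, hQ, hQ⟩

/-- The circuit obtained by appending the circuit `D`, with inputs renamed by `ρ` and outputs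
renamed by `σ`, to the outputs of `C`; the remaining outputs `R` of `C` are left alone,
and `p` brings the outputs of `C` in the required order. -/
def LCirc.append (C D : LCirc ob) (ρ σ : ℕ → ℕ) (R : LabCtx W)
    (p : C.cod.obj ob ⟶ LabCtx.obj ob (D.dom.relabel ρ ++ R))
    (h : LabCtx.Distinct (D.cod.relabel σ ++ R)) : LCirc ob where
  dom := C.dom
  cod := D.cod.relabel σ ++ R
  hom := C.hom ≫ p ≫
    eqToHom ((listObj_append _ _ _).trans
      (congrArg (· ⊗ₚ LabCtx.obj ob R) (D.dom.relabel_obj ob ρ))) ≫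
    rw D.hom (LabCtx.obj ob R) ≫
    eqToHom ((listObj_append _ _ _).trans
      (congrArg (· ⊗ₚ LabCtx.obj ob R) (D.cod.relabel_obj ob σ))).symm
  dom_distinct := C.dom_distinct
  cod_distinct := h

end LabelledCircuits

/-! ### Terms

Terms are in locally nameless style: bound variables are de Bruijn indices and free variables are
names, so that α-equivalent terms are equal. -/

/-- Wire bundles. -/
inductive WBundle : Type
  | unit : WBundle
  | lab : ℕ → WBundle
  | pair : WBundle → WBundle → WBundle

/-- Renaming of the labels of a wire bundle. -/
def WBundle.relabel (ρ : ℕ → ℕ) : WBundle → WBundle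
  | .unit => .unit
  | .lab l => .lab (ρ l)
  | .pair b c => .pair (b.relabel ρ) (c.relabel ρ)

/-- The judgment `Q ⊢ b : T` for wire bundles: the labels of `b`, in the order in which they
occur, form `Q`. -/
inductive WBundle.HasType {W : Type w} : LabCtx W → WBundle → Bundle W → Prop
  | unit : HasType [] .unit .unit
  | lab (l : ℕ) (a : W) : HasType [(l, a)] (.lab l) (.wire a)
  | pair {Q Q' : LabCtx W} {b c : WBundle} {T U : Bundle W} :
      HasType Q b T → HasType Q' c U → HasType (Q ++ Q') (.pair b c) (.tensor T U)

theorem WBundle.HasType.obj_eq {W : Type w} {M : Type u} [Category.{v} M]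
    [StrictSymPremonoidal M] (ob : W → M) {Q : LabCtx W} {b : WBundle} {T : Bundle W}
    (h : WBundle.HasType Q b T) : T.obj ob = Q.obj ob := by
  induction h with
  | unit => rfl
  | lab l a => exact (tensor_unit _).symm
  | pair _ _ ih ih' => simp only [Bundle.obj, LabCtx.obj, listObj_append, ih, ih']

section Terms

variable {W : Type w} {M : Type u} [Category.{v} M] [StrictSymPremonoidal M] (ob : W → M)
  (E : Type u') [Category.{v'} E]

mutual

/-- Values. -/
inductive Val : Type (max w u v u' v')
  | unit : Val
  | nat : ℕ → Val
  | lab : ℕ → Val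
  | bvar : ℕ → Val
  | fvar : ℕ → Val
  | lam : Ty W E → Tm → Val
  | lift : Tm → Val
  | boxed : WBundle → LCirc ob → WBundle → Val
  | pair : Val → Val → Val

/-- Computations.  `lett M N` is `let x = M in N`, binding index `0` in `N`, and `dest V M` is
`let (x, y) = V in M`, binding `x` as index `1` and `y` as index `0` in `M`. -/
inductive Tm : Type (max w u v u' v')
  | app : Val → Val → Tm
  | force : Val → Tm
  | box : Bundle W → Val → Tm
  | apply : Val → Val → Tm
  | dest : Val → Tm → Tm
  | ifz : Val → Tm → Tm → Tm
  | ret : Val → Tm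
  | lett : Tm → Tm → Tm

end

variable {ob E}

/-- Every wire bundle is a value. -/
def WBundle.toVal : WBundle → Val ob E
  | .unit => .unit
  | .lab l => .lab l
  | .pair b c => .pair b.toVal c.toVal

mutual

/-- Replacement of the bound variable with index `k` by a value without loose indices. -/
def Val.inst (k : ℕ) (U : Val ob E) : Val ob E → Val ob E
  | .unit => .unit
  | .nat n => .nat n
  | .lab l => .lab l
  | .bvar i => if i = k then U else .bvar i
  | .fvar x => .fvar x
  | .lam A N => .lam A (Tm.inst (k + 1) U N)
  | .lift N => .lift (Tm.inst k U N)
  | .boxed b C c => .boxed b C c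
  | .pair V V' => .pair (Val.inst k U V) (Val.inst k U V')

/-- Replacement of the bound variable with index `k` by a value without loose indices. -/
def Tm.inst (k : ℕ) (U : Val ob E) : Tm ob E → Tm ob E
  | .app V V' => .app (Val.inst k U V) (Val.inst k U V')
  | .force V => .force (Val.inst k U V)
  | .box T V => .box T (Val.inst k U V)
  | .apply V V' => .apply (Val.inst k U V) (Val.inst k U V')
  | .dest V N => .dest (Val.inst k U V) (Tm.inst (k + 2) U N)
  | .ifz V N N' => .ifz (Val.inst k U V) (Tm.inst k U N) (Tm.inst k U N')
  | .ret V => .ret (Val.inst k U V)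
  | .lett N N' => .lett (Tm.inst k U N) (Tm.inst (k + 1) U N')

end

mutual

/-- The free variables of a value. -/
def Val.fv : Val ob E → Set ℕ
  | .unit => ∅
  | .nat _ => ∅
  | .lab _ => ∅
  | .bvar _ => ∅
  | .fvar x => {x}
  | .lam _ N => Tm.fv N
  | .lift N => Tm.fv N
  | .boxed _ _ _ => ∅
  | .pair V V' => Val.fv V ∪ Val.fv V'

/-- The free variables of a computation. -/
def Tm.fv : Tm ob E → Set ℕ
  | .app V V' => Val.fv V ∪ Val.fv V'
  | .force V => Val.fv V
  | .box _ V => Val.fv V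
  | .apply V V' => Val.fv V ∪ Val.fv V'
  | .dest V N => Val.fv V ∪ Tm.fv N
  | .ifz V N N' => Val.fv V ∪ Tm.fv N ∪ Tm.fv N'
  | .ret V => Val.fv V
  | .lett N N' => Tm.fv N ∪ Tm.fv N'

end

/-! ### Operational semantics -/

/-- The big-step evaluation relation `(C, N) ⇓ (C', V)` on configurations. -/
inductive Eval : LCirc ob → Tm ob E → LCirc ob → Val ob E → Prop
  | app {C C' : LCirc ob} {A : Ty W E} {N : Tm ob E} {U V : Val ob E} :
      Eval C (N.inst 0 U) C' V → Eval C (.app (.lam A N) U) C' V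
  | force {C C' : LCirc ob} {N : Tm ob E} {V : Val ob E} :
      Eval C N C' V → Eval C (.force (.lift N)) C' V
  | dest {C C' : LCirc ob} {N : Tm ob E} {U U' V : Val ob E} :
      Eval C ((N.inst 1 U).inst 0 U') C' V → Eval C (.dest (.pair U U') N) C' V
  | ifz_zero {C C' : LCirc ob} {N N' : Tm ob E} {V : Val ob E} :
      Eval C N C' V → Eval C (.ifz (.nat 0) N N') C' V
  | ifz_succ {C C' : LCirc ob} {n : ℕ} {N N' : Tm ob E} {V : Val ob E} :
      Eval C N' C' V → Eval C (.ifz (.nat (n + 1)) N N') C' V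
  | ret {C : LCirc ob} {V : Val ob E} : Eval C (.ret V) C V
  | lett {C C' C'' : LCirc ob} {N N' : Tm ob E} {U V : Val ob E} :
      Eval C N C' U → Eval C' (N'.inst 0 U) C'' V → Eval C (.lett N N') C'' V
  /-- The boxed circuit is run on fresh labels. -/
  | box {C D : LCirc ob} {T : Bundle W} {V : Val ob E} {Q : LabCtx W} {b c : WBundle}
      (hQ : Q.Distinct) :
      WBundle.HasType Q b T →
      Eval (LCirc.id ob Q hQ) (.app V b.toVal) D c.toVal →
      Eval C (.box T V) C (.boxed b D c)
  /-- The inputs of the boxed circuit are renamed to the labels of the argument, and its outputs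
  are renamed to labels that are distinct from the remaining outputs of `C`. -/
  | apply {C D : LCirc ob} {b c : WBundle} (ρ σ : ℕ → ℕ) (R : LabCtx W)
      (p : C.cod.obj ob ⟶ LabCtx.obj ob (D.dom.relabel ρ ++ R))
      (h : LabCtx.Distinct (D.cod.relabel σ ++ R)) :
      IsPerm (fun a : ℕ × W => ob a.2) C.cod (D.dom.relabel ρ ++ R) p →
      Eval C (.apply (.boxed b D c) (b.relabel ρ).toVal)
        (LCirc.append ob C D ρ σ R p h) (c.relabel σ).toVal

end Terms

/-! ### Typing contexts -/

/-- The entries of typing contexts: labels with a wire type, or variables with a type. -/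
inductive Entry (W : Type w) (E : Type u') [Category.{v'} E] : Type (max w u' v')
  | lab : ℕ → W → Entry W E
  | var : ℕ → Ty W E → Entry W E

/-- Typing contexts. -/
abbrev Ctx (W : Type w) (E : Type u') [Category.{v'} E] : Type (max w u' v') := List (Entry W E)

section Contexts

variable {W : Type w} {E : Type u'} [Category.{v'} E]

/-- The type of an entry. -/
def Entry.ty : Entry W E → Ty W E
  | .lab _ a => .wire a
  | .var _ A => A

/-- A parameter context consists of variables of parameter type. -/
def Ctx.IsParam (Γ : Ctx W E) : Prop := ∀ a ∈ Γ, ∃ x A, a = Entry.var x A ∧ A.IsParam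

/-- The variable `x` is not declared in the context. -/
def Ctx.Fresh (x : ℕ) (Γ : Ctx W E) : Prop := ∀ A, Entry.var x A ∉ Γ

/-- The list of wire types of the circuit part of a context. -/
def Ctx.wires : Ctx W E → List W
  | [] => []
  | a :: Γ => a.ty.wires ++ Ctx.wires Γ

/-- A label context as a typing context. -/
def LabCtx.toCtx (Q : LabCtx W) : Ctx W E := Q.map fun a => Entry.lab a.1 a.2

variable {M : Type u} [Category.{v} M] [StrictSymPremonoidal M] (ob : W → M)

/-- The circuit part `♯⟦Γ⟧` of the interpretation of a context. -/
abbrev Ctx.obj (Γ : Ctx W E) : M := listObj (fun a : Entry W E => a.ty.obj ob) Γ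

theorem LabCtx.toCtx_obj (Q : LabCtx W) : (Q.toCtx : Ctx W E).obj ob = Q.obj ob := by
  induction Q with
  | nil => rfl
  | cons a Q ih =>
    change ob a.2 ⊗ₚ Ctx.obj ob (LabCtx.toCtx Q : Ctx W E) = ob a.2 ⊗ₚ LabCtx.obj ob Q
    rw [ih]

theorem Ctx.obj_eq (Γ : Ctx W E) : Γ.obj ob = listObj ob Γ.wires := by
  induction Γ with
  | nil => rfl
  | cons a Γ ih =>
    change a.ty.obj ob ⊗ₚ Ctx.obj ob Γ = listObj ob (a.ty.wires ++ Ctx.wires Γ)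
    rw [listObj_append, ih, Ty.obj_eq]

theorem Ctx.obj_append (Γ Δ : Ctx W E) : Ctx.obj ob (Γ ++ Δ) = Γ.obj ob ⊗ₚ Δ.obj ob :=
  listObj_append _ _ _

theorem Ctx.obj_single (a : Entry W E) : Ctx.obj ob [a] = a.ty.obj ob := tensor_unit _

theorem Ctx.IsParam.obj_eq {Φ : Ctx W E} (h : Φ.IsParam) :
    Φ.obj ob = StrictSymPremonoidal.unit := by
  induction Φ with
  | nil => rfl
  | cons a Φ ih =>
    obtain ⟨x, A, rfl, hA⟩ := h a (by simp)
    have h' := ih fun b hb => h b (by simp [hb])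
    change A.obj ob ⊗ₚ Ctx.obj ob Φ = _
    rw [h', hA.obj_eq, tensor_unit]

theorem Ctx.IsParam.append_obj {Φ : Ctx W E} (h : Φ.IsParam) (Γ : Ctx W E) :
    Ctx.obj ob (Φ ++ Γ) = Γ.obj ob := by
  rw [Ctx.obj_append, h.obj_eq, unit_tensor]

end Contexts

section Environments

variable {W : Type w} {E : Type u'} [Category.{v'} E] [CircuitAlgebra E]
  {M : Type u} [Category.{v} M] [StrictSymPremonoidal M] (ob : W → M) (α : Abstraction M E)

/-- The parametric part `♭⟦Γ⟧` of the interpretation of a context. -/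
def Ctx.flat : Ctx W E → Type v
  | [] => PUnit
  | a :: Γ => a.ty.flat ob α × Ctx.flat Γ

variable {ob α}

/-- The isomorphism `♭⟦Γ⟧ × ♭⟦Δ⟧ ≅ ♭⟦Γ, Δ⟧`. -/
def Ctx.join : {Γ Δ : Ctx W E} → Γ.flat ob α → Δ.flat ob α → Ctx.flat ob α (Γ ++ Δ)
  | [], _, _, d => d
  | _ :: _, _, g, d => (g.1, Ctx.join g.2 d)

/-- The inverse isomorphism `♭⟦Γ, Δ⟧ ≅ ♭⟦Γ⟧ × ♭⟦Δ⟧`. -/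
def Ctx.split : (Γ : Ctx W E) → {Δ : Ctx W E} → Ctx.flat ob α (Γ ++ Δ) →
    Γ.flat ob α × Δ.flat ob α
  | [], _, g => (PUnit.unit, g)
  | _ :: Γ, _, g => ((g.1, (Ctx.split Γ g.2).1), (Ctx.split Γ g.2).2)

/-- The exchange of two adjacent entries of an environment. -/
def Ctx.swapFlat : (Γ : Ctx W E) → {a b : Entry W E} → {Δ : Ctx W E} →
    Ctx.flat ob α (Γ ++ a :: b :: Δ) → Ctx.flat ob α (Γ ++ b :: a :: Δ)
  | [], _, _, _, g => (g.2.1, g.1, g.2.2)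
  | _ :: Γ, _, _, _, g => (g.1, Ctx.swapFlat Γ g.2)

/-- The only element of the parametric part of a label context. -/
def LabCtx.pt : (Q : LabCtx W) → Ctx.flat ob α (Q.toCtx : Ctx W E)
  | [] => PUnit.unit
  | _ :: Q => (PUnit.unit, LabCtx.pt Q)

end Environments

/-! ### The type-and-effect system -/

section Typing

variable {W : Type w} {E : Type u'} [Category.{v'} E] [CircuitAlgebra E]
  {M : Type u} [Category.{v} M] [StrictSymPremonoidal M] {ob : W → M} (α : Abstraction M E)

mutual

/-- Derivations of the value judgment `Γ ⊢ V : A`. -/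
inductive VTyp : Ctx W E → Val ob E → Ty W E → Type (max w u v u' v')
  | unit {Φ : Ctx W E} : Φ.IsParam → VTyp Φ .unit .unit
  | nat {Φ : Ctx W E} (n : ℕ) : Φ.IsParam → VTyp Φ (.nat n) .nat
  | lab {Φ : Ctx W E} (l : ℕ) (a : W) : Φ.IsParam → VTyp (Φ ++ [.lab l a]) (.lab l) (.wire a)
  | var {Φ : Ctx W E} (x : ℕ) (A : Ty W E) : Φ.IsParam → VTyp (Φ ++ [.var x A]) (.fvar x) A
  | abs {Γ : Ctx W E} {A B : Ty W E} {T : Bundle W} {e : Eff E} {N : Tm ob E} (x : ℕ) :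
      Γ.Fresh x → x ∉ N.fv → A.WF ob α → T.wires = Γ.wires →
      CTyp (Γ ++ [.var x A]) (N.inst 0 (.fvar x)) B e →
      VTyp Γ (.lam A N) (.arrow A B T e)
  | lift {Φ : Ctx W E} {A : Ty W E} {e : Eff E} {N : Tm ob E} :
      Φ.IsParam → CTyp Φ N A e → VTyp Φ (.lift N) (.bang A e)
  | circ {Φ : Ctx W E} {T U : Bundle W} {e : Eff E} {C : LCirc ob} {b c : WBundle}
      {Q L : LabCtx W} (p : Q.obj ob ⟶ C.dom.obj ob) (q : C.cod.obj ob ⟶ L.obj ob) :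
      Φ.IsParam →
      IsPerm (fun a : ℕ × W => ob a.2) Q C.dom p → IsPerm (fun a : ℕ × W => ob a.2) C.cod L q →
      WBundle.HasType Q b T → WBundle.HasType L c U →
      Bounded α (p ≫ C.hom ≫ q) e →
      VTyp Φ (.boxed b C c) (.circ T U e)
  | pair {Φ Γ₁ Γ₂ : Ctx W E} {V V' : Val ob E} {A B : Ty W E} :
      Φ.IsParam → VTyp (Φ ++ Γ₁) V A → VTyp (Φ ++ Γ₂) V' B →
      VTyp (Φ ++ (Γ₁ ++ Γ₂)) (.pair V V') (.tensor A B)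

/-- Derivations of the computation judgment `Γ ⊢ N : A; e`. -/
inductive CTyp : Ctx W E → Tm ob E → Ty W E → Eff E → Type (max w u v u' v')
  | app {Φ Γ₁ Γ₂ : Ctx W E} {V V' : Val ob E} {A B : Ty W E} {T : Bundle W} {e : Eff E} :
      Φ.IsParam → VTyp (Φ ++ Γ₁) V (.arrow A B T e) → VTyp (Φ ++ Γ₂) V' A →
      CTyp (Φ ++ (Γ₁ ++ Γ₂)) (.app V V') B e
  | force {Φ : Ctx W E} {V : Val ob E} {A : Ty W E} {e : Eff E} :
      Φ.IsParam → VTyp Φ V (.bang A e) → CTyp Φ (.force V) A e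
  | box {Φ : Ctx W E} {V : Val ob E} {T U : Bundle W} {e : Eff E} :
      Φ.IsParam → VTyp Φ V (.arrow T.toTy U.toTy .unit e) →
      CTyp Φ (.box T V) (.circ T U e)
        ⟨StrictSymPremonoidal.unit, StrictSymPremonoidal.unit, 𝟙 _⟩
  | apply {Φ Γ₁ Γ₂ : Ctx W E} {V V' : Val ob E} {T U : Bundle W} {e : Eff E} :
      Φ.IsParam → VTyp (Φ ++ Γ₁) V (.circ T U e) → VTyp (Φ ++ Γ₂) V' T.toTy →
      CTyp (Φ ++ (Γ₁ ++ Γ₂)) (.apply V V') U.toTy e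
  | dest {Φ Γ₁ Γ₂ : Ctx W E} {V : Val ob E} {N : Tm ob E} {A B A' : Ty W E} {e : Eff E}
      (x y : ℕ) :
      Φ.IsParam → x ≠ y → Ctx.Fresh x (Φ ++ Γ₂) → Ctx.Fresh y (Φ ++ Γ₂) →
      x ∉ N.fv → y ∉ N.fv →
      VTyp (Φ ++ Γ₁) V (.tensor A B) →
      CTyp (Φ ++ (Γ₂ ++ [.var x A, .var y B])) ((N.inst 1 (.fvar x)).inst 0 (.fvar y)) A' e →
      CTyp (Φ ++ (Γ₂ ++ Γ₁)) (.dest V N) A' e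
  | ifz {Φ Γ : Ctx W E} {V : Val ob E} {N N' : Tm ob E} {A : Ty W E} {e : Eff E} :
      Φ.IsParam → VTyp Φ V .nat → CTyp (Φ ++ Γ) N A e → CTyp (Φ ++ Γ) N' A e →
      CTyp (Φ ++ Γ) (.ifz V N N') A e
  | ret {Γ : Ctx W E} {V : Val ob E} {A : Ty W E} :
      VTyp Γ V A → CTyp Γ (.ret V) A ⟨α.obj (A.obj ob), α.obj (A.obj ob), 𝟙 _⟩
  | lett {Φ Γ₁ Γ₂ : Ctx W E} {N N' : Tm ob E} {A B : Ty W E} {e₁ e₂ : Eff E} (x : ℕ) :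
      Φ.IsParam → Ctx.Fresh x (Φ ++ Γ₂) → x ∉ N'.fv →
      CTyp (Φ ++ Γ₁) N A e₁ →
      CTyp (Φ ++ (Γ₂ ++ [.var x A])) (N'.inst 0 (.fvar x)) B e₂ →
      (h : α.obj (Γ₂.obj ob) ⊗ₚ e₁.cod = e₂.dom) →
      CTyp (Φ ++ (Γ₂ ++ Γ₁)) (.lett N N') B
        ⟨α.obj (Γ₂.obj ob) ⊗ₚ e₁.dom, e₂.cod,
          lw (α.obj (Γ₂.obj ob)) e₁.hom ≫ eqToHom h ≫ e₂.hom⟩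
  | sub {Γ : Ctx W E} {N : Tm ob E} {A : Ty W E} {t u : E} {e₁ e₂ : t ⟶ u} :
      CTyp Γ N A ⟨t, u, e₁⟩ → e₁ ≤ e₂ → CTyp Γ N A ⟨t, u, e₂⟩
  | ex {Γ₁ Γ₂ : Ctx W E} {a b : Entry W E} {N : Tm ob E} {A : Ty W E} {e : Eff E} :
      CTyp (Γ₁ ++ a :: b :: Γ₂) N A e →
      (h : α.obj (Ctx.obj ob (Γ₁ ++ a :: b :: Γ₂)) = e.dom) →
      CTyp (Γ₁ ++ b :: a :: Γ₂) N A
        ⟨α.obj (Ctx.obj ob (Γ₁ ++ b :: a :: Γ₂)), e.cod,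
          α.map (swapHom (fun c : Entry W E => c.ty.obj ob) Γ₁ b a Γ₂) ≫ eqToHom h ≫ e.hom⟩

end

variable {α}

/-- The circuit part of a value judgment is an identity: both sides have the same object. -/
theorem VTyp.obj_eq : {Γ : Ctx W E} → {V : Val ob E} → {A : Ty W E} → VTyp α Γ V A →
    Γ.obj ob = A.obj ob
  | _, _, _, .unit h => h.obj_eq ob
  | _, _, _, .nat _ h => h.obj_eq ob
  | _, _, _, .lab _ _ h => (h.append_obj ob _).trans (Ctx.obj_single ob _)
  | _, _, _, .var _ _ h => (h.append_obj ob _).trans (Ctx.obj_single ob _)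
  | Γ, _, _, .abs (T := T) _ _ _ _ h _ => by
    rw [Ctx.obj_eq, ← h, ← Bundle.obj_eq]
    rfl
  | _, _, _, .lift h _ => h.obj_eq ob
  | _, _, _, .circ _ _ h _ _ _ _ _ => h.obj_eq ob
  | _, _, _, .pair h d d' => by
    have h₁ := (h.append_obj ob _).symm.trans d.obj_eq
    have h₂ := (h.append_obj ob _).symm.trans d'.obj_eq
    rw [h.append_obj, Ctx.obj_append, h₁, h₂]
    rfl

/-- All types of a context are well formed. -/
def Ctx.WF (α : Abstraction M E) (Γ : Ctx W E) : Prop := ∀ a ∈ Γ, a.ty.WF ob α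

theorem Bundle.toTy_wf (T : Bundle W) : (T.toTy : Ty W E).WF ob α := by
  induction T with
  | unit => trivial
  | wire a => trivial
  | tensor T U ihT ihU => exact ⟨ihT, ihU⟩

theorem Ctx.WF.swap {Γ Δ : Ctx W E} {a b : Entry W E}
    (h : Ctx.WF (ob := ob) α (Γ ++ b :: a :: Δ)) : Ctx.WF (ob := ob) α (Γ ++ a :: b :: Δ) := by
  intro c hc
  refine h c ?_
  simp only [List.mem_append, List.mem_cons] at hc ⊢
  tauto

theorem Ctx.WF.left {Φ Γ₁ Γ₂ : Ctx W E}
    (h : Ctx.WF (ob := ob) α (Φ ++ (Γ₁ ++ Γ₂))) : Ctx.WF (ob := ob) α (Φ ++ Γ₁) := by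
  intro c hc
  refine h c ?_
  simp only [List.mem_append] at hc ⊢
  tauto

theorem Ctx.WF.right {Φ Γ₁ Γ₂ : Ctx W E}
    (h : Ctx.WF (ob := ob) α (Φ ++ (Γ₁ ++ Γ₂))) : Ctx.WF (ob := ob) α (Φ ++ Γ₂) := by
  intro c hc
  refine h c ?_
  simp only [List.mem_append] at hc ⊢
  tauto

theorem Ctx.WF.snoc {Γ : Ctx W E} {x : ℕ} {A : Ty W E} (h : Ctx.WF (ob := ob) α Γ)
    (hA : A.WF ob α) : Ctx.WF (ob := ob) α (Γ ++ [.var x A]) := by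
  intro c hc
  rcases List.mem_append.1 hc with hc | hc
  · exact h c hc
  · obtain rfl := List.mem_singleton.1 hc
    exact hA

theorem LabCtx.toCtx_wf (Q : LabCtx W) : Ctx.WF (ob := ob) α Q.toCtx := by
  intro c hc
  obtain ⟨a, _, rfl⟩ := List.mem_map.1 hc
  trivial

mutual

theorem VTyp.wf : {Γ : Ctx W E} → {V : Val ob E} → {A : Ty W E} → VTyp α Γ V A →
    Ctx.WF (ob := ob) α Γ → A.WF ob α
  | _, _, _, .unit _, _ => trivial
  | _, _, _, .nat _ _, _ => trivial
  | _, _, _, .lab _ _ _, _ => trivial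
  | _, _, _, .var x A _, hΓ => hΓ (.var x A) (by simp)
  | Γ, _, _, .abs (A := A) (T := T) x _ _ hA hT d, hΓ => by
    obtain ⟨hB, h₁, h₂⟩ := d.wf (hΓ.snoc hA)
    refine ⟨hA, hB, h₁.trans ?_, h₂⟩
    rw [Ctx.obj_append, Ctx.obj_single, Ctx.obj_eq, Bundle.obj_eq, hT]
    rfl
  | _, _, _, .lift hΦ d, hΓ => by
    obtain ⟨hA, h₁, h₂⟩ := d.wf hΓ
    exact ⟨hA, by rw [h₁, hΦ.obj_eq], h₂⟩
  | _, _, _, .circ _ _ _ _ _ hb hc ⟨h₁, h₂, _⟩, _ =>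
    ⟨by rw [hb.obj_eq ob, h₁], by rw [hc.obj_eq ob, h₂]⟩
  | _, _, _, .pair _ d d', hΓ => ⟨d.wf hΓ.left, d'.wf hΓ.right⟩

/-- The domain and codomain of the effect of a computation are the abstractions of the circuit
parts of its context and of its type. -/
theorem CTyp.wf : {Γ : Ctx W E} → {N : Tm ob E} → {A : Ty W E} → {e : Eff E} →
    CTyp α Γ N A e → Ctx.WF (ob := ob) α Γ →
    A.WF ob α ∧ e.dom = α.obj (Γ.obj ob) ∧ e.cod = α.obj (A.obj ob)
  | _, _, _, _, .app hΦ d d', hΓ => by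
    obtain ⟨_, hB, h₁, h₂⟩ := d.wf hΓ.left
    refine ⟨hB, h₁.trans ?_, h₂⟩
    have h₃ := (hΦ.append_obj ob _).symm.trans d.obj_eq
    have h₄ := (hΦ.append_obj ob _).symm.trans d'.obj_eq
    rw [hΦ.append_obj, Ctx.obj_append, h₃, h₄]
    rfl
  | _, _, _, _, .force hΦ d, hΓ => by
    obtain ⟨hA, h₁, h₂⟩ := d.wf hΓ
    exact ⟨hA, by rw [h₁, hΦ.obj_eq], h₂⟩
  | _, _, _, _, .box (T := T) (U := U) hΦ d, hΓ => by
    obtain ⟨_, _, h₁, h₂⟩ := d.wf hΓ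
    rw [Bundle.toTy_obj] at h₁ h₂
    refine ⟨⟨h₁.trans ?_, h₂⟩, ?_, α.obj_unit.symm⟩
    · exact congrArg α.obj (unit_tensor _)
    · rw [hΦ.obj_eq, α.obj_unit]
  | _, _, _, _, .apply hΦ d d', hΓ => by
    obtain ⟨h₁, h₂⟩ := d.wf hΓ.left
    refine ⟨Bundle.toTy_wf _, h₁.trans ?_, by rw [h₂, Bundle.toTy_obj]⟩
    have h₃ := (hΦ.append_obj ob _).symm.trans d.obj_eq
    have h₄ := (hΦ.append_obj ob _).symm.trans d'.obj_eq
    rw [hΦ.append_obj, Ctx.obj_append, h₃, h₄, Bundle.toTy_obj]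
    exact congrArg α.obj (unit_tensor _).symm
  | _, _, _, _, .dest (Γ₂ := Γ₂) x y hΦ _ _ _ _ _ d d', hΓ => by
    obtain ⟨hA, hB⟩ := d.wf hΓ.right
    obtain ⟨hA', h₁, h₂⟩ := d'.wf (by
      have := (hΓ.left.snoc hA (x := x)).snoc hB (x := y)
      simpa using this)
    refine ⟨hA', h₁.trans ?_, h₂⟩
    have h₃ := (hΦ.append_obj ob _).symm.trans d.obj_eq
    rw [hΦ.append_obj, Ctx.obj_append, hΦ.append_obj, Ctx.obj_append, h₃]
    refine congrArg (fun Y => α.obj (Ctx.obj ob Γ₂ ⊗ₚ Y)) ?_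
    change _ ⊗ₚ _ ⊗ₚ StrictSymPremonoidal.unit = _
    rw [tensor_unit]
    rfl
  | _, _, _, _, .ifz _ _ d _, hΓ => d.wf hΓ
  | _, _, _, _, .ret d, hΓ => ⟨d.wf hΓ, by rw [d.obj_eq], rfl⟩
  | _, _, _, _, .lett x hΦ _ _ d d' h, hΓ => by
    obtain ⟨hA, h₁, _⟩ := d.wf hΓ.right
    obtain ⟨hB, _, h₂⟩ := d'.wf (by simpa using hΓ.left.snoc hA (x := x))
    refine ⟨hB, ?_, h₂⟩
    rw [hΦ.append_obj, Ctx.obj_append, α.obj_tensor]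
    rw [hΦ.append_obj] at h₁
    exact congrArg (α.obj _ ⊗ₚ ·) h₁
  | _, _, _, _, .sub d _, hΓ => d.wf hΓ
  | _, _, _, _, .ex d _, hΓ => by
    obtain ⟨hA, _, h₂⟩ := d.wf hΓ.swap
    exact ⟨hA, rfl, h₂⟩

end

/-! ### Interpretation of derivations -/

/-- The map `♭⟦T ⊸ U⟧ → M^{≲ e}(⟦T⟧, ⟦U⟧)` for closures that capture no wires. -/
def boxMap (T U : Bundle W) (e : Eff E)
    (f : (Ty.arrow T.toTy U.toTy .unit e).flat ob α) : (Ty.circ T U e).flat ob α :=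
  (f (T.pt ob α)).2.cast
    ((T.toTy_obj (E := E) ob).symm.trans (unit_tensor _).symm) (U.toTy_obj ob)

mutual

/-- The interpretation of a derivation of `Γ ⊢ V : A` as a function `♭⟦Γ⟧ → ♭⟦A⟧`.  Its circuit
part is the equality `VTyp.obj_eq`. -/
def VTyp.interp : {Γ : Ctx W E} → {V : Val ob E} → {A : Ty W E} → VTyp α Γ V A →
    Γ.flat ob α → A.flat ob α
  | _, _, _, .unit _, _ => PUnit.unit
  | _, _, _, .nat n _, _ => ⟨n⟩
  | _, _, _, .lab _ _ _, _ => PUnit.unit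
  | _, _, _, .var (Φ := Φ) _ _ _, g => (Ctx.split Φ g).2.1
  | Γ, _, _, .abs (A := A) (T := T) x _ _ _ hT d, g => fun a =>
    let r := d.interp (Ctx.join g ((a, PUnit.unit) : Ctx.flat ob α [.var x A]))
    (r.1, r.2.cast (by
      rw [Ctx.obj_append, Ctx.obj_single, Ctx.obj_eq, Bundle.obj_eq, hT]
      rfl) rfl)
  | _, _, _, .lift hΦ d, g => fun _ =>
    let r := d.interp g
    (r.1, r.2.cast (hΦ.obj_eq ob).symm rfl)
  | _, _, _, .circ (C := C) p q _ _ _ hb hc h, _ =>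
    Circs.cast (hb.obj_eq ob) (hc.obj_eq ob).symm ⟨p ≫ C.hom ≫ q, h⟩
  | _, _, _, .pair (Φ := Φ) (Γ₁ := Γ₁) _ d d', g =>
    let s := Ctx.split Φ g
    let s' := Ctx.split Γ₁ s.2
    (d.interp (Ctx.join s.1 s'.1), d'.interp (Ctx.join s.1 s'.2))

/-- The interpretation of a derivation of `Γ ⊢ N : A; e` as a function
`♭⟦Γ⟧ → ♭⟦A⟧ × M^{≲ e}(♯⟦Γ⟧, ♯⟦A⟧)`. -/
def CTyp.interp : {Γ : Ctx W E} → {N : Tm ob E} → {A : Ty W E} → {e : Eff E} →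
    CTyp α Γ N A e → Γ.flat ob α → CircMonad α e (Γ.obj ob) (A.obj ob) (A.flat ob α)
  | _, _, _, _, .app (Φ := Φ) (Γ₁ := Γ₁) hΦ d d', g =>
    let s := Ctx.split Φ g
    let s' := Ctx.split Γ₁ s.2
    let r := d.interp (Ctx.join s.1 s'.1) (d'.interp (Ctx.join s.1 s'.2))
    (r.1, r.2.cast (by
      have h₃ := (hΦ.append_obj ob _).symm.trans d.obj_eq
      have h₄ := (hΦ.append_obj ob _).symm.trans d'.obj_eq
      rw [hΦ.append_obj, Ctx.obj_append, h₃, h₄]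
      rfl) rfl)
  | _, _, _, _, .force hΦ d, g =>
    let r := d.interp g PUnit.unit
    (r.1, r.2.cast (hΦ.obj_eq ob) rfl)
  | _, _, _, _, .box (T := T) (U := U) (e := e) hΦ d, g =>
    (boxMap T U e (d.interp g), Circs.idUnit.cast (hΦ.obj_eq ob) rfl)
  | _, _, _, _, .apply (Φ := Φ) (Γ₁ := Γ₁) (U := U) hΦ d d', g =>
    let s := Ctx.split Φ g
    let s' := Ctx.split Γ₁ s.2
    (U.pt ob α, Circs.cast (by
      have h₃ := (hΦ.append_obj ob _).symm.trans d.obj_eq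
      have h₄ := (hΦ.append_obj ob _).symm.trans d'.obj_eq
      rw [hΦ.append_obj, Ctx.obj_append, h₃, h₄, Bundle.toTy_obj]
      exact unit_tensor _) (U.toTy_obj ob).symm (d.interp (Ctx.join s.1 s'.1)))
  | _, _, _, _, .dest (Φ := Φ) (Γ₂ := Γ₂) (A := A) (B := B) x y hΦ _ _ _ _ _ d d', g =>
    let s := Ctx.split Φ g
    let s' := Ctx.split Γ₂ s.2
    let ab := d.interp (Ctx.join s.1 s'.2)
    let r := d'.interp (Ctx.join s.1 (Ctx.join s'.1
      ((ab.1, ab.2, PUnit.unit) : Ctx.flat ob α [.var x A, .var y B])))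
    (r.1, r.2.cast (by
      have h₃ := (hΦ.append_obj ob _).symm.trans d.obj_eq
      rw [hΦ.append_obj, Ctx.obj_append, hΦ.append_obj, Ctx.obj_append, h₃]
      refine congrArg (fun Y => Ctx.obj ob Γ₂ ⊗ₚ Y) ?_
      change _ = _ ⊗ₚ _ ⊗ₚ StrictSymPremonoidal.unit
      rw [tensor_unit]
      rfl) rfl)
  | _, _, _, _, .ifz (Φ := Φ) _ d d' d'', g =>
    match d.interp (Ctx.split Φ g).1 with
    | ⟨0⟩ => d'.interp g
    | ⟨_ + 1⟩ => d''.interp g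
  | _, _, _, _, .ret (A := A) d, g => (d.interp g, (Circs.id (A.obj ob)).cast d.obj_eq rfl)
  | _, _, _, _, .lett (Φ := Φ) (Γ₁ := Γ₁) (Γ₂ := Γ₂) (A := A) x hΦ _ _ d d' h, g =>
    let s := Ctx.split Φ g
    let s' := Ctx.split Γ₂ s.2
    let r := d.interp (Ctx.join s.1 s'.2)
    let r' := d'.interp (Ctx.join s.1 (Ctx.join s'.1
      ((r.1, PUnit.unit) : Ctx.flat ob α [.var x A])))
    (r'.1, ((r.2.lwhisk (Γ₂.obj ob)).comp (r'.2.cast (by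
      rw [hΦ.append_obj, Ctx.obj_append, Ctx.obj_single]
      rfl) rfl) h).cast (by
      rw [hΦ.append_obj, Ctx.obj_append, hΦ.append_obj]) rfl)
  | _, _, _, _, .sub (t := t) (u := u) (e₁ := e₁) (e₂ := e₂) d h, g =>
    CircMonad.incl (e := ⟨t, u, e₁⟩) (d := ⟨t, u, e₂⟩) ⟨rfl, rfl, by simpa using h⟩ (d.interp g)
  | _, _, _, _, .ex (Γ₁ := Γ₁) d h, g =>
    let r := d.interp (Ctx.swapFlat Γ₁ g)
    (r.1, (Circs.pure (swapHom _ _ _ _ _)).comp r.2 h)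

end

/-! ### Configurations -/

variable (α)

/-- Derivations of `Q ⊢ (C, N) : A; Q'; e`: the outputs of the circuit `C`, whose inputs are `Q`,
are those of a label context `L` together with the disjoint label context `Q'`, up to
a permutation, and `N` is a computation of type `A` and effect `e` in the context `L`. -/
structure ConfTyp (Q : LabCtx W) (C : LCirc ob) (N : Tm ob E) (A : Ty W E) (Q' : LabCtx W)
    (e : Eff E) where
  ctx : LabCtx W
  dom_eq : Q = C.dom
  perm : C.cod.obj ob ⟶ LabCtx.obj ob (ctx ++ Q')
  isPerm : IsPerm (fun a : ℕ × W => ob a.2) C.cod (ctx ++ Q') perm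
  typ : CTyp α ctx.toCtx N A e

/-- Derivations of `Q ⊢ (C, V) : A; Q'` for configurations consisting of a circuit and a value. -/
structure ConfVTyp (Q : LabCtx W) (C : LCirc ob) (V : Val ob E) (A : Ty W E)
    (Q' : LabCtx W) where
  ctx : LabCtx W
  dom_eq : Q = C.dom
  perm : C.cod.obj ob ⟶ LabCtx.obj ob (ctx ++ Q')
  isPerm : IsPerm (fun a : ℕ × W => ob a.2) C.cod (ctx ++ Q') perm
  typ : VTyp α ctx.toCtx V A

variable {α}

section Configurations

variable {Q : LabCtx W} {C : LCirc ob} {N : Tm ob E} {V : Val ob E} {A : Ty W E}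
  {Q' : LabCtx W} {e : Eff E}

theorem LabCtx.obj_append_toCtx (L Q' : LabCtx W) :
    LabCtx.obj ob (L ++ Q') = Ctx.obj ob (L.toCtx : Ctx W E) ⊗ₚ Q'.obj ob := by
  rw [LabCtx.toCtx_obj]
  exact listObj_append _ _ _

/-- The circuit of a configuration, as a morphism `⟦Q⟧ ⟶ ♯⟦L⟧ ⊗ ⟦Q'⟧`. -/
def ConfTyp.circuit (d : ConfTyp α Q C N A Q' e) :
    Q.obj ob ⟶ Ctx.obj ob (d.ctx.toCtx : Ctx W E) ⊗ₚ Q'.obj ob :=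
  eqToHom (congrArg (LabCtx.obj ob) d.dom_eq) ≫ C.hom ≫ d.perm ≫
    eqToHom (LabCtx.obj_append_toCtx d.ctx Q')

theorem ConfTyp.eff_dom (d : ConfTyp α Q C N A Q' e) :
    α.obj (Ctx.obj ob (d.ctx.toCtx : Ctx W E) ⊗ₚ Q'.obj ob) = e.dom ⊗ₚ α.obj (Q'.obj ob) := by
  rw [α.obj_tensor, (d.typ.wf (LabCtx.toCtx_wf d.ctx)).2.1]

/-- The effect `α(C); (e ⋉ α⟦Q'⟧)` of a configuration. -/
def ConfTyp.eff (d : ConfTyp α Q C N A Q' e) : Eff E :=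
  ⟨α.obj (Q.obj ob), e.cod ⊗ₚ α.obj (Q'.obj ob),
    α.map d.circuit ≫ eqToHom d.eff_dom ≫ rw e.hom (α.obj (Q'.obj ob))⟩

/-- The interpretation `J(id, C); (⟦N⟧ ⋉ ⟦Q'⟧)` of a configuration. -/
def ConfTyp.interp (d : ConfTyp α Q C N A Q' e) (_ : PUnit.{v + 1}) :
    CircMonad α d.eff (Q.obj ob) (A.obj ob ⊗ₚ Q'.obj ob) (A.flat ob α) :=
  let r := d.typ.interp (LabCtx.pt d.ctx)
  (r.1, (Circs.pure d.circuit).comp (r.2.rwhisk (Q'.obj ob)) d.eff_dom)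

/-- The function part of the interpretation of a configuration `(C, V)`. -/
def ConfVTyp.fn (d : ConfVTyp α Q C V A Q') (_ : PUnit.{v + 1}) : A.flat ob α :=
  d.typ.interp (LabCtx.pt d.ctx)

/-- The circuit part of the interpretation of a configuration `(C, V)`. -/
def ConfVTyp.circuit (d : ConfVTyp α Q C V A Q') :
    Q.obj ob ⟶ A.obj ob ⊗ₚ Q'.obj ob :=
  eqToHom (congrArg (LabCtx.obj ob) d.dom_eq) ≫ C.hom ≫ d.perm ≫
    eqToHom ((LabCtx.obj_append_toCtx d.ctx Q').trans
      (congrArg (· ⊗ₚ LabCtx.obj ob Q') d.typ.obj_eq))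

/-- The effect `α(C)` of a configuration `(C, V)`. -/
def ConfVTyp.eff (d : ConfVTyp α Q C V A Q') : Eff E :=
  ⟨α.obj (Q.obj ob), α.obj (A.obj ob ⊗ₚ Q'.obj ob), α.map d.circuit⟩

/-- The computation `J(⟦(C, V)⟧)`. -/
def ConfVTyp.interpJ (d : ConfVTyp α Q C V A Q') :
    PUnit.{v + 1} → CircMonad α d.eff (Q.obj ob) (A.obj ob ⊗ₚ Q'.obj ob) (A.flat ob α) :=
  J d.fn d.circuit

end Configurations

end Typing

end ProtoQuipperR

namespace ProtoQuipperR

open StrictSymPremonoidal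

/-! ### Packaged morphisms -/

section Packaged

variable {C : Type u} [Category.{v} C]

/-- A morphism packaged with its domain and codomain. -/
abbrev arr {X Y : C} (f : X ⟶ Y) : Eff C := ⟨X, Y, f⟩

theorem arr_injective {X Y : C} {f g : X ⟶ Y} (h : arr f = arr g) : f = g := by
  injection h

theorem arr_id_congr {X Y : C} (h : X = Y) : arr (𝟙 X) = arr (𝟙 Y) := by rw [h]

@[simp] theorem arr_eqToHom_comp {X Y Z : C} (h : X = Y) (f : Y ⟶ Z) :
    arr (eqToHom h ≫ f) = arr f := by
  subst h; simp

@[simp] theorem arr_comp_eqToHom {X Y Z : C} (f : X ⟶ Y) (h : Y = Z) :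
    arr (f ≫ eqToHom h) = arr f := by
  subst h; simp

open Classical in
/-- Composition of packaged morphisms; the second one is ignored if it is not composable. -/
noncomputable def Eff.comp (e d : Eff C) : Eff C :=
  if h : e.cod = d.dom then ⟨e.dom, d.cod, e.hom ≫ eqToHom h ≫ d.hom⟩ else e

infixl:80 " ⋆ " => Eff.comp

theorem Eff.comp_eq {e d : Eff C} (h : e.cod = d.dom) :
    e ⋆ d = ⟨e.dom, d.cod, e.hom ≫ eqToHom h ≫ d.hom⟩ := dif_pos h

theorem arr_comp {X Y Z : C} (f : X ⟶ Y) (g : Y ⟶ Z) : arr (f ≫ g) = arr f ⋆ arr g := by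
  rw [Eff.comp_eq rfl]; simp

@[simp] theorem Eff.comp_dom (e d : Eff C) : (e ⋆ d).dom = e.dom := by
  unfold Eff.comp; split <;> rfl

@[simp] theorem Eff.comp_cod {e d : Eff C} (h : e.cod = d.dom) : (e ⋆ d).cod = d.cod := by
  rw [Eff.comp_eq h]

theorem Eff.comp_assoc {e d c : Eff C} (h : e.cod = d.dom) :
    e ⋆ d ⋆ c = e ⋆ (d ⋆ c) := by
  by_cases h' : d.cod = c.dom
  · obtain ⟨X, Y, e⟩ := e
    obtain ⟨Y', Z, d⟩ := d
    obtain ⟨Z', T, c⟩ := c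
    dsimp only at h h'
    subst h h'
    simp only [← arr_comp, Category.assoc]
  · have h₁ : d ⋆ c = d := dif_neg h'
    rw [h₁]
    exact dif_neg (by rwa [Eff.comp_cod h])

@[simp] theorem Eff.id_comp {X : C} {e : Eff C} (h : X = e.dom) : arr (𝟙 X) ⋆ e = e := by
  subst h
  rw [Eff.comp_eq rfl]
  simp

@[simp] theorem Eff.comp_id (X : C) (e : Eff C) : e ⋆ arr (𝟙 X) = e := by
  by_cases h : e.cod = X
  · subst h
    rw [Eff.comp_eq rfl]
    simp
  · exact dif_neg h

end Packaged

section PackagedTensor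

variable {C : Type u} [Category.{v} C] [StrictSymPremonoidal C]

/-- Adding wires on the left of a packaged morphism. -/
def Eff.lwhisk (X : C) (e : Eff C) : Eff C := arr (lw X e.hom)

/-- Adding wires on the right of a packaged morphism. -/
def Eff.rwhisk (e : Eff C) (X : C) : Eff C := arr (rw e.hom X)

/-- The packaged symmetry. -/
def braidArr (X Y : C) : Eff C := arr (braid X Y)

@[simp] theorem Eff.lwhisk_dom (X : C) (e : Eff C) : (e.lwhisk X).dom = X ⊗ₚ e.dom := rfl
@[simp] theorem Eff.lwhisk_cod (X : C) (e : Eff C) : (e.lwhisk X).cod = X ⊗ₚ e.cod := rfl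
@[simp] theorem Eff.rwhisk_dom (X : C) (e : Eff C) : (e.rwhisk X).dom = e.dom ⊗ₚ X := rfl
@[simp] theorem Eff.rwhisk_cod (X : C) (e : Eff C) : (e.rwhisk X).cod = e.cod ⊗ₚ X := rfl
@[simp] theorem braidArr_dom (X Y : C) : (braidArr X Y).dom = X ⊗ₚ Y := rfl
@[simp] theorem braidArr_cod (X Y : C) : (braidArr X Y).cod = Y ⊗ₚ X := rfl

theorem arr_lw (X : C) {Y Z : C} (f : Y ⟶ Z) : arr (lw X f) = (arr f).lwhisk X := rfl

theorem arr_rw {Y Z : C} (f : Y ⟶ Z) (X : C) : arr (rw f X) = (arr f).rwhisk X := rfl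

@[simp] theorem Eff.lwhisk_id (X Y : C) : Eff.lwhisk X (arr (𝟙 Y)) = arr (𝟙 (X ⊗ₚ Y)) := by
  simp only [Eff.lwhisk, lw_id]

@[simp] theorem Eff.rwhisk_id (X Y : C) : Eff.rwhisk (arr (𝟙 Y)) X = arr (𝟙 (Y ⊗ₚ X)) := by
  simp only [Eff.rwhisk, rw_id]

theorem Eff.lwhisk_comp (X : C) {e d : Eff C} (h : e.cod = d.dom) :
    (e ⋆ d).lwhisk X = e.lwhisk X ⋆ d.lwhisk X := by
  obtain ⟨Y, Z, e⟩ := e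
  obtain ⟨Z', T, d⟩ := d
  dsimp only at h
  subst h
  rw [← arr_comp, ← arr_lw, ← arr_lw, ← arr_lw, ← arr_comp, lw_comp]

theorem Eff.rwhisk_comp (X : C) {e d : Eff C} (h : e.cod = d.dom) :
    (e ⋆ d).rwhisk X = e.rwhisk X ⋆ d.rwhisk X := by
  obtain ⟨Y, Z, e⟩ := e
  obtain ⟨Z', T, d⟩ := d
  dsimp only at h
  subst h
  rw [← arr_comp, ← arr_rw, ← arr_rw, ← arr_rw, ← arr_comp, rw_comp]

theorem Eff.lwhisk_tensor (X X' : C) (e : Eff C) :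
    e.lwhisk (X ⊗ₚ X') = (e.lwhisk X').lwhisk X := by
  simp only [Eff.lwhisk, lw_tensor, arr_eqToHom_comp, arr_comp_eqToHom]

theorem Eff.rwhisk_tensor (X X' : C) (e : Eff C) :
    e.rwhisk (X ⊗ₚ X') = (e.rwhisk X).rwhisk X' := by
  simp only [Eff.rwhisk, rw_tensor, arr_eqToHom_comp, arr_comp_eqToHom]

theorem Eff.rwhisk_lwhisk (X X' : C) (e : Eff C) :
    (e.lwhisk X).rwhisk X' = (e.rwhisk X').lwhisk X := by
  simp only [Eff.lwhisk, Eff.rwhisk, rw_lw, arr_eqToHom_comp, arr_comp_eqToHom]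

@[simp] theorem Eff.lwhisk_unit (e : Eff C) : e.lwhisk unit = e := by
  simp only [Eff.lwhisk, lw_unit, arr_eqToHom_comp, arr_comp_eqToHom]

@[simp] theorem Eff.rwhisk_unit (e : Eff C) : e.rwhisk unit = e := by
  simp only [Eff.rwhisk, rw_unit, arr_eqToHom_comp, arr_comp_eqToHom]

@[simp] theorem braidArr_braidArr (X Y : C) : braidArr X Y ⋆ braidArr Y X = arr (𝟙 (X ⊗ₚ Y)) := by
  rw [braidArr, braidArr, ← arr_comp, braid_braid]

theorem braidArr_natural (e : Eff C) (X : C) :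
    e.rwhisk X ⋆ braidArr e.cod X = braidArr e.dom X ⋆ e.lwhisk X := by
  rw [braidArr, braidArr, Eff.rwhisk, Eff.lwhisk, ← arr_comp, ← arr_comp, braid_natural]

theorem braidArr_natural' (e : Eff C) (X : C) :
    e.lwhisk X ⋆ braidArr X e.cod = braidArr X e.dom ⋆ e.rwhisk X := by
  have h := congrArg (fun a => braidArr X e.dom ⋆ (a ⋆ braidArr X e.cod)) (braidArr_natural e X)
  rw [Eff.comp_assoc (by simp), braidArr_braidArr, Eff.comp_id, Eff.comp_assoc (by simp),
    ← Eff.comp_assoc (by simp), braidArr_braidArr, Eff.id_comp (by simp)] at h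
  exact h.symm

theorem braidArr_tensor_right (X Y Z : C) :
    braidArr X (Y ⊗ₚ Z) = (braidArr X Y).rwhisk Z ⋆ (braidArr X Z).lwhisk Y := by
  rw [braidArr, braid_tensor, arr_eqToHom_comp, arr_comp, arr_eqToHom_comp, arr_comp_eqToHom]
  rfl

theorem eq_of_comp_eq_id {e d d' : Eff C} (h : e.cod = d.dom) (h' : d'.cod = e.dom)
    (h₁ : e ⋆ d = arr (𝟙 e.dom)) (h₂ : d' ⋆ e = arr (𝟙 e.cod)) : d = d' := by
  have h₃ : d' ⋆ e ⋆ d = d' ⋆ (e ⋆ d) := Eff.comp_assoc h'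
  rwa [h₁, h₂, Eff.comp_id, Eff.id_comp h] at h₃

theorem braidArr_tensor_left (X Y Z : C) :
    braidArr (X ⊗ₚ Y) Z = (braidArr Y Z).lwhisk X ⋆ (braidArr X Z).rwhisk Y := by
  refine (eq_of_comp_eq_id (e := braidArr Z (X ⊗ₚ Y)) (by simp)
    (by rw [Eff.comp_cod (by simp [tensor_assoc])]; simp [tensor_assoc]) ?_ ?_)
  · simp
  · rw [braidArr_tensor_right, Eff.comp_assoc (by simp [tensor_assoc]),
      ← Eff.comp_assoc (e := (braidArr X Z).rwhisk Y) (by simp), ← Eff.rwhisk_comp _ (by simp),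
      braidArr_braidArr, Eff.rwhisk_id, Eff.id_comp (by simp [tensor_assoc]),
      ← Eff.lwhisk_comp _ (by simp), braidArr_braidArr, Eff.lwhisk_id]
    exact arr_id_congr (by rw [Eff.comp_cod (by simp [tensor_assoc])]; simp)

@[simp] theorem braidArr_unit_right (X : C) : braidArr X unit = arr (𝟙 X) := by
  have h : braidArr X unit = braidArr X unit ⋆ braidArr X unit := by
    conv_lhs => rw [← unit_tensor (unit : C), braidArr_tensor_right]
    simp
  have h' : braidArr X unit ⋆ braidArr unit X = arr (𝟙 (X ⊗ₚ unit)) := braidArr_braidArr _ _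
  have h₃ := congrArg (· ⋆ braidArr unit X) h
  rw [Eff.comp_assoc (by simp [unit_tensor, tensor_unit]), h', Eff.comp_id] at h₃
  rw [← h₃]
  exact arr_id_congr (tensor_unit _)

@[simp] theorem braidArr_unit_left (X : C) : braidArr unit X = arr (𝟙 X) := by
  have h := braidArr_braidArr X (unit : C)
  rwa [braidArr_unit_right, Eff.id_comp (by simp [unit_tensor]), tensor_unit] at h

theorem braidArr_central_left (X Y : C) (e : Eff C) :
    (braidArr X Y).rwhisk e.dom ⋆ e.lwhisk (Y ⊗ₚ X) =
      e.lwhisk (X ⊗ₚ Y) ⋆ (braidArr X Y).rwhisk e.cod := by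
  simp only [braidArr, Eff.lwhisk, Eff.rwhisk, ← arr_comp, braid_central_left]

theorem braidArr_central_right (X Y : C) (e : Eff C) :
    (braidArr X Y).lwhisk e.dom ⋆ e.rwhisk (Y ⊗ₚ X) =
      e.rwhisk (X ⊗ₚ Y) ⋆ (braidArr X Y).lwhisk e.cod := by
  simp only [braidArr, Eff.lwhisk, Eff.rwhisk, ← arr_comp, braid_central_right]

end PackagedTensor

/-! ### Permutation isomorphisms as packaged morphisms -/

section Perm

variable {C : Type u} [Category.{v} C] [StrictSymPremonoidal C] {X : Type w} (f : X → C)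

@[simp] theorem listObj_nil : listObj f [] = unit := rfl

@[simp] theorem listObj_cons (a : X) (l : List X) : listObj f (a :: l) = f a ⊗ₚ listObj f l := rfl

theorem arr_swapHom (l : List X) (a b : X) (l' : List X) :
    arr (swapHom f l a b l') =
      ((braidArr (f a) (f b)).rwhisk (listObj f l')).lwhisk (listObj f l) := by
  induction l with
  | nil =>
    rw [listObj_nil, Eff.lwhisk_unit]
    exact (arr_eqToHom_comp _ _).trans (arr_comp_eqToHom _ _)
  | cons c l ih =>
    change arr (lw (f c) (swapHom f l a b l')) = _
    rw [listObj_cons, Eff.lwhisk_tensor, ← ih]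
    rfl

/-- The packaged permutation isomorphisms from `l` to `l'`. -/
inductive PermArr : (l l' : List X) → Eff C → Prop
  | refl (l : List X) : PermArr l l (arr (𝟙 (listObj f l)))
  | swap (l : List X) (a b : X) (l' : List X) :
      PermArr (l ++ a :: b :: l') (l ++ b :: a :: l')
        (((braidArr (f a) (f b)).rwhisk (listObj f l')).lwhisk (listObj f l))
  | trans {l₁ l₂ l₃ : List X} {P P' : Eff C} :
      PermArr l₁ l₂ P → PermArr l₂ l₃ P' → PermArr l₁ l₃ (P ⋆ P')

variable {f}

namespace PermArr

theorem dom_cod {l l' : List X} {P : Eff C} (h : PermArr f l l' P) :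
    P.dom = listObj f l ∧ P.cod = listObj f l' := by
  induction h with
  | refl l => exact ⟨rfl, rfl⟩
  | swap l a b l' => simp [listObj_append, tensor_assoc]
  | trans _ _ ih ih' => simp [ih.1, ih.2, ih'.1, ih'.2]

theorem dom {l l' : List X} {P : Eff C} (h : PermArr f l l' P) : P.dom = listObj f l :=
  h.dom_cod.1

theorem cod {l l' : List X} {P : Eff C} (h : PermArr f l l' P) : P.cod = listObj f l' :=
  h.dom_cod.2

theorem of_isPerm {l l' : List X} {p : listObj f l ⟶ listObj f l'} (h : IsPerm f l l' p) :
    PermArr f l l' (arr p) := by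
  induction h with
  | refl l => exact .refl l
  | swap l a b l' => rw [arr_swapHom]; exact .swap l a b l'
  | trans _ _ ih ih' => rw [arr_comp]; exact ih.trans ih'

theorem exists_isPerm {l l' : List X} {P : Eff C} (h : PermArr f l l' P) :
    ∃ p, IsPerm f l l' p ∧ arr p = P := by
  induction h with
  | refl l => exact ⟨_, .refl l, rfl⟩
  | swap l a b l' => exact ⟨_, .swap l a b l', arr_swapHom _ _ _ _ _⟩
  | trans _ _ ih ih' =>
    obtain ⟨p, hp, rfl⟩ := ih
    obtain ⟨p', hp', rfl⟩ := ih'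
    exact ⟨_, hp.trans hp', arr_comp _ _⟩

theorem of_eq {l l' : List X} {Y : C} (h : l = l') (hY : Y = listObj f l) :
    PermArr f l l' (arr (𝟙 Y)) := by
  subst h hY
  exact .refl _

theorem congr {l l' m m' : List X} {P P' : Eff C} (h : PermArr f l l' P) (h₁ : l = m)
    (h₂ : l' = m') (h₃ : P = P') : PermArr f m m' P' := by
  subst h₁ h₂ h₃; exact h

theorem perm {l l' : List X} {P : Eff C} (h : PermArr f l l' P) : l.Perm l' := by
  induction h with
  | refl l => exact .refl _
  | swap l a b l' => exact (List.Perm.swap _ _ _).append_left _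
  | trans _ _ ih ih' => exact ih.trans ih'

theorem append_left (m : List X) {l l' : List X} {P : Eff C} (h : PermArr f l l' P) :
    PermArr f (m ++ l) (m ++ l') (P.lwhisk (listObj f m)) := by
  induction h with
  | refl l => rw [Eff.lwhisk_id, ← listObj_append]; exact .refl _
  | swap l a b l' =>
    exact (swap (m ++ l) a b l').congr (by simp) (by simp)
      (by rw [listObj_append, Eff.lwhisk_tensor])
  | trans h h' ih ih' =>
    rw [Eff.lwhisk_comp _ (h.cod.trans h'.dom.symm)]
    exact ih.trans ih'

theorem append_right (m : List X) {l l' : List X} {P : Eff C} (h : PermArr f l l' P) :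
    PermArr f (l ++ m) (l' ++ m) (P.rwhisk (listObj f m)) := by
  induction h with
  | refl l => rw [Eff.rwhisk_id, ← listObj_append]; exact .refl _
  | swap l a b l' =>
    exact (swap l a b (l' ++ m)).congr (by simp) (by simp)
      (by rw [listObj_append, Eff.rwhisk_tensor, Eff.rwhisk_lwhisk])
  | trans h h' ih ih' =>
    rw [Eff.rwhisk_comp _ (h.cod.trans h'.dom.symm)]
    exact ih.trans ih'

theorem cons_block (a : X) (m : List X) :
    PermArr f (a :: m) (m ++ [a]) (braidArr (f a) (listObj f m)) := by
  induction m with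
  | nil => exact (refl [a]).congr rfl rfl (by simpa using arr_id_congr (tensor_unit _))
  | cons b m ih =>
    refine ((swap [] a b m).trans (ih.append_left [b])).congr rfl rfl ?_
    simp [braidArr_tensor_right, tensor_unit]

theorem block (l m : List X) :
    PermArr f (l ++ m) (m ++ l) (braidArr (listObj f l) (listObj f m)) := by
  induction l with
  | nil => exact (refl m).congr rfl (by simp) (by simp)
  | cons a l ih =>
    refine ((ih.append_left [a]).trans ((cons_block a m).append_right l)).congr rfl (by simp) ?_
    simp [braidArr_tensor_left, tensor_unit]

theorem map {Y : Type*} {f' : Y → C} {g : X → Y} (hg : ∀ a, f' (g a) = f a) {l l' : List X}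
    {P : Eff C} (h : PermArr f l l' P) : PermArr f' (l.map g) (l'.map g) P := by
  have hl : ∀ l : List X, listObj f' (l.map g) = listObj f l := by
    intro l
    induction l with
    | nil => rfl
    | cons a l ih => simp [ih, hg]
  induction h with
  | refl l => exact .of_eq rfl (hl l).symm
  | swap l a b l' =>
    exact (swap (f := f') (l.map g) (g a) (g b) (l'.map g)).congr (by simp) (by simp)
      (by simp [hl, hg])
  | trans _ _ ih ih' => exact ih.trans ih'

theorem exists_of_perm {l l' : List X} (h : l.Perm l') : ∃ P, PermArr f l l' P := by
  induction h with
  | nil => exact ⟨_, refl _⟩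
  | cons a _ ih =>
    obtain ⟨P, hP⟩ := ih
    exact ⟨_, hP.append_left [a]⟩
  | swap a b l => exact ⟨_, swap [] b a l⟩
  | trans _ _ ih ih' =>
    obtain ⟨P, hP⟩ := ih
    obtain ⟨P', hP'⟩ := ih'
    exact ⟨_, hP.trans hP'⟩

theorem central {l l' : List X} {P : Eff C} (h : PermArr f l l' P) (e : Eff C) :
    P.lwhisk e.dom ⋆ e.rwhisk (listObj f l') = e.rwhisk (listObj f l) ⋆ P.lwhisk e.cod := by
  induction h with
  | refl l => rw [Eff.lwhisk_id, Eff.lwhisk_id, Eff.comp_id, Eff.id_comp (by simp)]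
  | swap l a b l' =>
    have h := congrArg (fun P => P.rwhisk (listObj f l'))
      (braidArr_central_right (f a) (f b) (e.rwhisk (listObj f l)))
    rw [Eff.rwhisk_comp _ (by simp), Eff.rwhisk_comp _ (by simp)] at h
    simpa [listObj_append, Eff.rwhisk_tensor, Eff.lwhisk_tensor, Eff.rwhisk_lwhisk] using h
  | trans h h' ih ih' =>
    have hc := h.cod.trans h'.dom.symm
    rw [Eff.lwhisk_comp _ hc, Eff.lwhisk_comp _ hc, Eff.comp_assoc (by simp [hc]), ih',
      ← Eff.comp_assoc (by simp [h.cod]), ih, Eff.comp_assoc (by simp [h.dom])]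

end PermArr

variable (f) in
/-- The canonical permutation isomorphisms: the head of the source is moved to its place after the
tail has been permuted. -/
inductive CanonPerm : List X → List X → Eff C → Prop
  | nil : CanonPerm [] [] (arr (𝟙 unit))
  | cons (a : X) {t : List X} (l₁ l₂ : List X) {K : Eff C} : CanonPerm t (l₁ ++ l₂) K →
      CanonPerm (a :: t) (l₁ ++ a :: l₂)
        (K.lwhisk (f a) ⋆ (braidArr (f a) (listObj f l₁)).rwhisk (listObj f l₂))

namespace CanonPerm

theorem cod {l l' : List X} {K : Eff C} (h : CanonPerm f l l' K) : K.cod = listObj f l' := by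
  induction h with
  | nil => rfl
  | cons a l₁ l₂ h ih =>
    rw [Eff.comp_cod (by simp [ih, listObj_append, tensor_assoc])]
    simp [listObj_append, tensor_assoc]

theorem congr {l l' m : List X} {K K' : Eff C} (h : CanonPerm f l l' K) (h₁ : l' = m)
    (h₂ : K = K') : CanonPerm f l m K' := by
  subst h₁ h₂; exact h

theorem perm {l l' : List X} {K : Eff C} (h : CanonPerm f l l' K) : l.Perm l' := by
  induction h with
  | nil => exact .refl _
  | cons a l₁ l₂ h ih => exact (ih.cons a).trans List.perm_middle.symm

theorem refl (l : List X) : CanonPerm f l l (arr (𝟙 (listObj f l))) := by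
  induction l with
  | nil => exact .nil
  | cons a l ih =>
    have h := CanonPerm.cons (f := f) a [] l ih
    rwa [listObj_nil, braidArr_unit_right, Eff.rwhisk_id, Eff.comp_id, Eff.lwhisk_id] at h

theorem append_cons_inj {a : X} {l₁ l₂ m₁ m₂ : List X} (h : l₁ ++ a :: l₂ = m₁ ++ a :: m₂)
    (hl : a ∉ l₁) (hm : a ∉ m₁) : l₁ = m₁ ∧ l₂ = m₂ := by
  induction l₁ generalizing m₁ with
  | nil =>
    cases m₁ with
    | nil => simpa using h
    | cons b m₁ => exact absurd (by simp at h; simp [h.1]) hm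
  | cons b l₁ ih =>
    cases m₁ with
    | nil => exact absurd (by simp at h; simp [h.1]) hl
    | cons c m₁ =>
      simp only [List.cons_append, List.cons.injEq, List.mem_cons, not_or] at h hl hm
      obtain ⟨h₁, h₂⟩ := ih h.2 hl.2 hm.2
      exact ⟨by rw [h.1, h₁], h₂⟩

theorem unique {l l' : List X} {K K' : Eff C} (hl : l.Nodup) (h : CanonPerm f l l' K)
    (h' : CanonPerm f l l' K') : K = K' := by
  induction h generalizing K' with
  | nil => cases h'; rfl
  | @cons a t l₁ l₂ K h ih =>
    generalize hm : l₁ ++ a :: l₂ = m at h'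
    cases h' with
    | @cons _ _ m₁ m₂ K' h' =>
      have ha : a ∉ t := (List.nodup_cons.1 hl).1
      have h₁ : a ∉ l₁ ++ l₂ := fun hh => ha (h.perm.mem_iff.2 hh)
      have h₂ : a ∉ m₁ ++ m₂ := fun hh => ha (h'.perm.mem_iff.2 hh)
      simp only [List.mem_append, not_or] at h₁ h₂
      obtain ⟨rfl, rfl⟩ := append_cons_inj hm h₁.1 h₂.1
      rw [ih (List.nodup_cons.1 hl).2 h']

theorem swap {l l' : List X} {K : Eff C} (h : CanonPerm f l l' K) {m m' : List X} {b c : X}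
    (hl : l' = m ++ b :: c :: m') :
    CanonPerm f l (m ++ c :: b :: m')
      (K ⋆ ((braidArr (f b) (f c)).rwhisk (listObj f m')).lwhisk (listObj f m)) := by
  induction h generalizing m m' b c with
  | nil => simp at hl
  | @cons a t l₁ l₂ K h ih =>
    have hK := h.cod
    rw [Eff.comp_assoc (by simp [hK, listObj_append, tensor_assoc])]
    rcases List.append_eq_append_iff.1 hl with ⟨n, rfl, hn⟩ | ⟨n, rfl, hn⟩
    · cases n with
      | nil =>
        simp only [List.nil_append, List.cons.injEq] at hn
        obtain ⟨rfl, rfl⟩ := hn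
        refine (CanonPerm.cons a (l₁ ++ [c]) m' (K := K) (by simpa using h)).congr (by simp) ?_
        rw [listObj_append, braidArr_tensor_right, Eff.rwhisk_comp _ (by simp [tensor_assoc])]
        simp [Eff.rwhisk_tensor, Eff.rwhisk_lwhisk, tensor_unit]
      | cons a' n =>
        simp only [List.cons_append, List.cons.injEq] at hn
        obtain ⟨rfl, rfl⟩ := hn
        refine (CanonPerm.cons a l₁ (n ++ c :: b :: m')
          ((ih (m := l₁ ++ n) (m' := m') (b := b) (c := c) (by simp)).congr (by simp) rfl)).congr
            (by simp) ?_
        have hn := braidArr_central_left (f a) (listObj f l₁)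
          (((braidArr (f b) (f c)).rwhisk (listObj f m')).lwhisk (listObj f n))
        rw [Eff.lwhisk_comp _ (by simp [hK, listObj_append, tensor_assoc]),
          Eff.comp_assoc (by simp [hK, listObj_append, tensor_assoc])]
        simp only [listObj_append, listObj_cons, Eff.lwhisk_tensor, Eff.lwhisk_dom,
          Eff.lwhisk_cod, Eff.rwhisk_dom, Eff.rwhisk_cod, braidArr_dom, braidArr_cod,
          tensor_assoc] at hn ⊢
        rw [hn]
    · rcases n with _ | ⟨b', _ | ⟨c', n⟩⟩
      · simp only [List.nil_append, List.cons.injEq] at hn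
        obtain ⟨rfl, rfl⟩ := hn
        refine (CanonPerm.cons b (m ++ [c]) m' (K := K) (by simpa using h)).congr (by simp) ?_
        rw [listObj_append, braidArr_tensor_right, Eff.rwhisk_comp _ (by simp [tensor_assoc])]
        simp [Eff.rwhisk_tensor, Eff.rwhisk_lwhisk, tensor_unit]
      · simp only [List.nil_append, List.cons_append, List.cons.injEq] at hn
        obtain ⟨rfl, rfl, rfl⟩ := hn
        refine (CanonPerm.cons c m (b :: m') (K := K) (by simpa using h)).congr (by simp) ?_
        rw [listObj_append, braidArr_tensor_right, Eff.rwhisk_comp _ (by simp [tensor_assoc]),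
          ← Eff.rwhisk_lwhisk, Eff.comp_assoc (by simp [tensor_assoc, tensor_unit]),
          show listObj f [b] = f b from tensor_unit _, ← Eff.rwhisk_comp _ (by simp),
          ← Eff.lwhisk_comp _ (by simp), braidArr_braidArr]
        simp [Eff.rwhisk_tensor]
      · simp only [List.cons_append, List.cons.injEq] at hn
        obtain ⟨rfl, rfl, rfl⟩ := hn
        refine (CanonPerm.cons a (m ++ c :: b :: n) l₂
          ((ih (m := m) (m' := n ++ l₂) (b := b) (c := c) (by simp)).congr (by simp) rfl)).congr
            (by simp) ?_
        have hn := congrArg (fun P => P.rwhisk (listObj f l₂)) (braidArr_natural'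
          (((braidArr (f b) (f c)).rwhisk (listObj f n)).lwhisk (listObj f m)) (f a))
        rw [Eff.rwhisk_comp _ (by simp), Eff.rwhisk_comp _ (by simp)] at hn
        rw [Eff.lwhisk_comp _ (by simp [hK, listObj_append, tensor_assoc]),
          Eff.comp_assoc (by simp [hK, listObj_append, tensor_assoc])]
        simp only [listObj_append, listObj_cons, Eff.rwhisk_tensor, Eff.rwhisk_lwhisk,
          Eff.lwhisk_dom, Eff.lwhisk_cod, Eff.rwhisk_dom, Eff.rwhisk_cod, braidArr_dom,
          braidArr_cod, tensor_assoc] at hn ⊢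
        rw [hn]

end CanonPerm

namespace PermArr

theorem unique {l l' : List X} {P P' : Eff C} (hl : l.Nodup) (h : PermArr f l l' P)
    (h' : PermArr f l l' P') : P = P' := by
  have key : ∀ {l' l'' : List X} {P : Eff C}, PermArr f l' l'' P → ∀ {K}, CanonPerm f l l' K →
      CanonPerm f l l'' (K ⋆ P) := by
    intro l' l'' P h
    induction h with
    | refl l => intro K hK; simpa using hK
    | swap m b c m' => intro K hK; exact hK.swap rfl
    | trans h h' ih ih' =>
      intro K hK
      rw [← Eff.comp_assoc (hK.cod.trans h.dom.symm)]
      exact ih' (ih hK)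
  have h₁ := key h (.refl l)
  have h₂ := key h' (.refl l)
  rw [Eff.id_comp h.dom.symm] at h₁
  rw [Eff.id_comp h'.dom.symm] at h₂
  exact h₁.unique hl h₂

end PermArr

end Perm

/-! ### Simultaneous substitution -/

section Terms

variable {W : Type w} {M : Type u} [Category.{v} M] [StrictSymPremonoidal M] {ob : W → M}
  {E : Type u'} [Category.{v'} E]

mutual

/-- Simultaneous substitution of values for the free variables of a value. -/
def Val.msubst (σ : ℕ → Val ob E) : Val ob E → Val ob E
  | .unit => .unit
  | .nat n => .nat n
  | .lab l => .lab l
  | .bvar i => .bvar i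
  | .fvar x => σ x
  | .lam A N => .lam A (Tm.msubst σ N)
  | .lift N => .lift (Tm.msubst σ N)
  | .boxed b C c => .boxed b C c
  | .pair V V' => .pair (Val.msubst σ V) (Val.msubst σ V')

/-- Simultaneous substitution of values for the free variables of a computation. -/
def Tm.msubst (σ : ℕ → Val ob E) : Tm ob E → Tm ob E
  | .app V V' => .app (Val.msubst σ V) (Val.msubst σ V')
  | .force V => .force (Val.msubst σ V)
  | .box T V => .box T (Val.msubst σ V)
  | .apply V V' => .apply (Val.msubst σ V) (Val.msubst σ V')
  | .dest V N => .dest (Val.msubst σ V) (Tm.msubst σ N)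
  | .ifz V N N' => .ifz (Val.msubst σ V) (Tm.msubst σ N) (Tm.msubst σ N')
  | .ret V => .ret (Val.msubst σ V)
  | .lett N N' => .lett (Tm.msubst σ N) (Tm.msubst σ N')

end

/-- A value without loose indices. -/
def Val.LC (V : Val ob E) : Prop := ∀ k U, Val.inst k U V = V

/-- A computation without loose indices. -/
def Tm.LC (N : Tm ob E) : Prop := ∀ k U, N.inst k U = N

mutual

theorem Val.inst_eq_of_inst_inst {U U' : Val ob E} : ∀ (V : Val ob E) {i j : ℕ}, i ≠ j →
    Val.inst j U' (Val.inst i U V) = Val.inst i U V → Val.inst j U' V = V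
  | .unit, _, _, _, _ => rfl
  | .nat _, _, _, _, _ => rfl
  | .lab _, _, _, _, _ => rfl
  | .bvar n, i, j, hij, h => by
    by_cases hn : n = i
    · subst hn
      simp [Val.inst, hij]
    · simpa [Val.inst, hn] using h
  | .fvar _, _, _, _, _ => rfl
  | .lam A N, i, j, hij, h => by
    simp only [Val.inst, Val.lam.injEq, true_and] at h ⊢
    exact Tm.inst_eq_of_inst_inst N (by omega) h
  | .lift N, i, j, hij, h => by
    simp only [Val.inst, Val.lift.injEq] at h ⊢
    exact Tm.inst_eq_of_inst_inst N hij h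
  | .boxed _ _ _, _, _, _, _ => rfl
  | .pair V V', i, j, hij, h => by
    simp only [Val.inst, Val.pair.injEq] at h ⊢
    exact ⟨Val.inst_eq_of_inst_inst V hij h.1, Val.inst_eq_of_inst_inst V' hij h.2⟩

theorem Tm.inst_eq_of_inst_inst {U U' : Val ob E} : ∀ (N : Tm ob E) {i j : ℕ}, i ≠ j →
    (N.inst i U).inst j U' = N.inst i U → N.inst j U' = N
  | .app V V', i, j, hij, h => by
    simp only [Tm.inst, Tm.app.injEq] at h ⊢
    exact ⟨Val.inst_eq_of_inst_inst V hij h.1, Val.inst_eq_of_inst_inst V' hij h.2⟩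
  | .force V, i, j, hij, h => by
    simp only [Tm.inst, Tm.force.injEq] at h ⊢
    exact Val.inst_eq_of_inst_inst V hij h
  | .box T V, i, j, hij, h => by
    simp only [Tm.inst, Tm.box.injEq, true_and] at h ⊢
    exact Val.inst_eq_of_inst_inst V hij h
  | .apply V V', i, j, hij, h => by
    simp only [Tm.inst, Tm.apply.injEq] at h ⊢
    exact ⟨Val.inst_eq_of_inst_inst V hij h.1, Val.inst_eq_of_inst_inst V' hij h.2⟩
  | .dest V N, i, j, hij, h => by
    simp only [Tm.inst, Tm.dest.injEq] at h ⊢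
    exact ⟨Val.inst_eq_of_inst_inst V hij h.1, Tm.inst_eq_of_inst_inst N (by omega) h.2⟩
  | .ifz V N N', i, j, hij, h => by
    simp only [Tm.inst, Tm.ifz.injEq] at h ⊢
    exact ⟨Val.inst_eq_of_inst_inst V hij h.1, Tm.inst_eq_of_inst_inst N hij h.2.1,
      Tm.inst_eq_of_inst_inst N' hij h.2.2⟩
  | .ret V, i, j, hij, h => by
    simp only [Tm.inst, Tm.ret.injEq] at h ⊢
    exact Val.inst_eq_of_inst_inst V hij h
  | .lett N N', i, j, hij, h => by
    simp only [Tm.inst, Tm.lett.injEq] at h ⊢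
    exact ⟨Tm.inst_eq_of_inst_inst N hij h.1, Tm.inst_eq_of_inst_inst N' (by omega) h.2⟩

end

mutual

theorem Val.msubst_inst {σ : ℕ → Val ob E} (hσ : ∀ x, (σ x).LC) (U : Val ob E) :
    ∀ (V : Val ob E) (k : ℕ), (Val.inst k U V).msubst σ = Val.inst k (U.msubst σ) (V.msubst σ)
  | .unit, _ => rfl
  | .nat _, _ => rfl
  | .lab _, _ => rfl
  | .bvar n, k => by simp only [Val.inst, Val.msubst]; split <;> rfl
  | .fvar x, k => (hσ x k _).symm
  | .lam A N, k => by simp only [Val.inst, Val.msubst, Tm.msubst_inst hσ U N]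
  | .lift N, k => by simp only [Val.inst, Val.msubst, Tm.msubst_inst hσ U N]
  | .boxed _ _ _, _ => rfl
  | .pair V V', k => by
    simp only [Val.inst, Val.msubst, Val.msubst_inst hσ U V, Val.msubst_inst hσ U V']

theorem Tm.msubst_inst {σ : ℕ → Val ob E} (hσ : ∀ x, (σ x).LC) (U : Val ob E) :
    ∀ (N : Tm ob E) (k : ℕ), (N.inst k U).msubst σ = (N.msubst σ).inst k (U.msubst σ)
  | .app V V', k => by
    simp only [Tm.inst, Tm.msubst, Val.msubst_inst hσ U V, Val.msubst_inst hσ U V']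
  | .force V, k => by simp only [Tm.inst, Tm.msubst, Val.msubst_inst hσ U V]
  | .box T V, k => by simp only [Tm.inst, Tm.msubst, Val.msubst_inst hσ U V]
  | .apply V V', k => by
    simp only [Tm.inst, Tm.msubst, Val.msubst_inst hσ U V, Val.msubst_inst hσ U V']
  | .dest V N, k => by
    simp only [Tm.inst, Tm.msubst, Val.msubst_inst hσ U V, Tm.msubst_inst hσ U N]
  | .ifz V N N', k => by
    simp only [Tm.inst, Tm.msubst, Val.msubst_inst hσ U V, Tm.msubst_inst hσ U N,
      Tm.msubst_inst hσ U N']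
  | .ret V, k => by simp only [Tm.inst, Tm.msubst, Val.msubst_inst hσ U V]
  | .lett N N', k => by
    simp only [Tm.inst, Tm.msubst, Tm.msubst_inst hσ U N, Tm.msubst_inst hσ U N']

end

mutual

theorem Val.msubst_congr {σ σ' : ℕ → Val ob E} : ∀ V : Val ob E, (∀ x ∈ V.fv, σ x = σ' x) →
    V.msubst σ = V.msubst σ'
  | .unit, _ => rfl
  | .nat _, _ => rfl
  | .lab _, _ => rfl
  | .bvar _, _ => rfl
  | .fvar x, h => h x rfl
  | .lam A N, h => by simp only [Val.msubst, Tm.msubst_congr N h]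
  | .lift N, h => by simp only [Val.msubst, Tm.msubst_congr N h]
  | .boxed _ _ _, _ => rfl
  | .pair V V', h => by
    simp only [Val.msubst, Val.msubst_congr V fun x hx => h x (Or.inl hx),
      Val.msubst_congr V' fun x hx => h x (Or.inr hx)]

theorem Tm.msubst_congr {σ σ' : ℕ → Val ob E} : ∀ N : Tm ob E, (∀ x ∈ N.fv, σ x = σ' x) →
    N.msubst σ = N.msubst σ'
  | .app V V', h => by
    simp only [Tm.msubst, Val.msubst_congr V fun x hx => h x (Or.inl hx),
      Val.msubst_congr V' fun x hx => h x (Or.inr hx)]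
  | .force V, h => by simp only [Tm.msubst, Val.msubst_congr V h]
  | .box T V, h => by simp only [Tm.msubst, Val.msubst_congr V h]
  | .apply V V', h => by
    simp only [Tm.msubst, Val.msubst_congr V fun x hx => h x (Or.inl hx),
      Val.msubst_congr V' fun x hx => h x (Or.inr hx)]
  | .dest V N, h => by
    simp only [Tm.msubst, Val.msubst_congr V fun x hx => h x (Or.inl hx),
      Tm.msubst_congr N fun x hx => h x (Or.inr hx)]
  | .ifz V N N', h => by
    simp only [Tm.msubst, Val.msubst_congr V fun x hx => h x (Or.inl (Or.inl hx)),
      Tm.msubst_congr N fun x hx => h x (Or.inl (Or.inr hx)),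
      Tm.msubst_congr N' fun x hx => h x (Or.inr hx)]
  | .ret V, h => by simp only [Tm.msubst, Val.msubst_congr V h]
  | .lett N N', h => by
    simp only [Tm.msubst, Tm.msubst_congr N fun x hx => h x (Or.inl hx),
      Tm.msubst_congr N' fun x hx => h x (Or.inr hx)]

end

mutual

theorem Val.msubst_fvar : ∀ V : Val ob E, V.msubst .fvar = V
  | .unit => rfl
  | .nat _ => rfl
  | .lab _ => rfl
  | .bvar _ => rfl
  | .fvar x => rfl
  | .lam A N => by simp only [Val.msubst, Tm.msubst_fvar N]
  | .lift N => by simp only [Val.msubst, Tm.msubst_fvar N]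
  | .boxed _ _ _ => rfl
  | .pair V V' => by simp only [Val.msubst, Val.msubst_fvar V, Val.msubst_fvar V']

theorem Tm.msubst_fvar : ∀ N : Tm ob E, N.msubst .fvar = N
  | .app V V' => by simp only [Tm.msubst, Val.msubst_fvar V, Val.msubst_fvar V']
  | .force V => by simp only [Tm.msubst, Val.msubst_fvar V]
  | .box T V => by simp only [Tm.msubst, Val.msubst_fvar V]
  | .apply V V' => by simp only [Tm.msubst, Val.msubst_fvar V, Val.msubst_fvar V']
  | .dest V N => by simp only [Tm.msubst, Val.msubst_fvar V, Tm.msubst_fvar N]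
  | .ifz V N N' => by
    simp only [Tm.msubst, Val.msubst_fvar V, Tm.msubst_fvar N, Tm.msubst_fvar N']
  | .ret V => by simp only [Tm.msubst, Val.msubst_fvar V]
  | .lett N N' => by simp only [Tm.msubst, Tm.msubst_fvar N, Tm.msubst_fvar N']

end

mutual

theorem Val.finite_fv : ∀ V : Val ob E, V.fv.Finite
  | .unit => Set.finite_empty
  | .nat _ => Set.finite_empty
  | .lab _ => Set.finite_empty
  | .bvar _ => Set.finite_empty
  | .fvar x => Set.finite_singleton x
  | .lam _ N => Tm.finite_fv N
  | .lift N => Tm.finite_fv N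
  | .boxed _ _ _ => Set.finite_empty
  | .pair V V' => (Val.finite_fv V).union (Val.finite_fv V')

theorem Tm.finite_fv : ∀ N : Tm ob E, N.fv.Finite
  | .app V V' => (Val.finite_fv V).union (Val.finite_fv V')
  | .force V => Val.finite_fv V
  | .box _ V => Val.finite_fv V
  | .apply V V' => (Val.finite_fv V).union (Val.finite_fv V')
  | .dest V N => (Val.finite_fv V).union (Tm.finite_fv N)
  | .ifz V N N' => ((Val.finite_fv V).union (Tm.finite_fv N)).union (Tm.finite_fv N')
  | .ret V => Val.finite_fv V
  | .lett N N' => (Tm.finite_fv N).union (Tm.finite_fv N')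

end

theorem Tm.msubst_inst_update {σ : ℕ → Val ob E} (hσ : ∀ x, (σ x).LC) {N : Tm ob E} {x : ℕ}
    {U : Val ob E} (hU : U.LC) (hx : x ∉ N.fv) (k : ℕ) :
    (N.inst k (.fvar x)).msubst (Function.update σ x U) = (N.msubst σ).inst k U := by
  rw [Tm.msubst_inst, Tm.msubst_congr (σ' := σ) N]
  · simp [Val.msubst]
  · intro y hy
    rw [Function.update_of_ne]
    rintro rfl
    exact hx hy
  · intro y
    by_cases h : y = x
    · subst h; simpa using hU
    · simpa [h] using hσ y

theorem Val.fvar_LC (x : ℕ) : (Val.fvar x : Val ob E).LC := fun _ _ => rfl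

/-- There are infinitely many names. -/
theorem exists_fresh (Γ : Ctx W E) (N : Tm ob E) : ∃ y, Γ.Fresh y ∧ y ∉ N.fv := by
  have h : {y : ℕ | ∃ A, Entry.var y A ∈ Γ}.Finite := by
    induction Γ with
    | nil => simp
    | cons a Γ ih =>
      refine (ih.union (t := {y | ∃ A, Entry.var y A = a}) ?_).subset ?_
      · cases a with
        | lab l c => simp
        | var z A => exact (Set.finite_singleton z).subset (by rintro y ⟨B, hB⟩; cases hB; rfl)
      · rintro y ⟨A, hA⟩
        rcases List.mem_cons.1 hA with hA | hA
        · exact Or.inr ⟨A, hA⟩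
        · exact Or.inl ⟨A, hA⟩
  obtain ⟨y, hy⟩ := (h.union N.finite_fv).exists_notMem
  simp only [Set.mem_union, Set.mem_ofPred_eq, not_or, not_exists] at hy
  exact ⟨y, hy.1, hy.2⟩

end Terms

/-! ### Typed terms -/

section Typed

variable {W : Type w} {E : Type u'} [Category.{v'} E] [CircuitAlgebra E]
  {M : Type u} [Category.{v} M] [StrictSymPremonoidal M] {ob : W → M} {α : Abstraction M E}

mutual

theorem VTyp.lc : {Γ : Ctx W E} → {V : Val ob E} → {A : Ty W E} → VTyp α Γ V A → V.LC
  | _, _, _, .unit _ => fun _ _ => rfl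
  | _, _, _, .nat _ _ => fun _ _ => rfl
  | _, _, _, .lab _ _ _ => fun _ _ => rfl
  | _, _, _, .var _ _ _ => fun _ _ => rfl
  | _, _, _, .abs _ _ _ _ _ d => fun k U =>
    congrArg (Val.lam _) (Tm.inst_eq_of_inst_inst _ (Nat.succ_ne_zero k).symm (d.lc (k + 1) U))
  | _, _, _, .lift _ d => fun k U => congrArg Val.lift (d.lc k U)
  | _, _, _, .circ _ _ _ _ _ _ _ _ => fun _ _ => rfl
  | _, _, _, .pair _ d d' => fun k U => congrArg₂ Val.pair (d.lc k U) (d'.lc k U)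

theorem CTyp.lc : {Γ : Ctx W E} → {N : Tm ob E} → {A : Ty W E} → {e : Eff E} →
    CTyp α Γ N A e → N.LC
  | _, _, _, _, .app _ d d' => fun k U => congrArg₂ Tm.app (d.lc k U) (d'.lc k U)
  | _, _, _, _, .force _ d => fun k U => congrArg Tm.force (d.lc k U)
  | _, _, _, _, .box _ d => fun k U => congrArg (Tm.box _) (d.lc k U)
  | _, _, _, _, .apply _ d d' => fun k U => congrArg₂ Tm.apply (d.lc k U) (d'.lc k U)
  | _, _, _, _, .dest _ _ _ _ _ _ _ _ d d' => fun k U => congrArg₂ Tm.dest (d.lc k U)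
      (Tm.inst_eq_of_inst_inst _ (by omega)
        (Tm.inst_eq_of_inst_inst _ (by omega) (d'.lc (k + 2) U)))
  | _, _, _, _, .ifz _ d d' d'' => fun k U => by
    simp only [Tm.inst, d.lc k U, d'.lc k U, d''.lc k U]
  | _, _, _, _, .ret d => fun k U => congrArg Tm.ret (d.lc k U)
  | _, _, _, _, .lett _ _ _ _ d d' _ => fun k U => congrArg₂ Tm.lett (d.lc k U)
      (Tm.inst_eq_of_inst_inst _ (Nat.succ_ne_zero k).symm (d'.lc (k + 1) U))
  | _, _, _, _, .sub d _ => d.lc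
  | _, _, _, _, .ex d _ => d.lc

end

theorem Ctx.wires_append (Γ Δ : Ctx W E) : Ctx.wires (Γ ++ Δ) = Γ.wires ++ Δ.wires := by
  induction Γ with
  | nil => rfl
  | cons a Γ ih => simp only [List.cons_append, Ctx.wires, ih, List.append_assoc]

theorem Ty.IsParam.wires_eq {A : Ty W E} (h : A.IsParam) : A.wires = [] := by
  induction A with
  | wire a => exact h.elim
  | tensor A B ihA ihB => simp [Ty.wires, ihA h.1, ihB h.2]
  | arrow A B T e _ _ => exact h.elim
  | _ => rfl

theorem Ctx.IsParam.wires_eq {Φ : Ctx W E} (h : Φ.IsParam) : Φ.wires = [] := by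
  induction Φ with
  | nil => rfl
  | cons a Φ ih =>
    obtain ⟨x, A, rfl, hA⟩ := h a (by simp)
    simp [Ctx.wires, Entry.ty, hA.wires_eq, ih fun b hb => h b (by simp [hb])]

theorem Ctx.isParam_append {Φ Φ' : Ctx W E} (h : Φ.IsParam) (h' : Φ'.IsParam) :
    Ctx.IsParam (Φ ++ Φ') := by
  intro a ha
  rcases List.mem_append.1 ha with ha | ha
  exacts [h a ha, h' a ha]

theorem Ctx.obj_congr {Γ Δ : Ctx W E} (h : Γ.wires = Δ.wires) : Γ.obj ob = Δ.obj ob := by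
  rw [Ctx.obj_eq, Ctx.obj_eq, h]

theorem VTyp.wires_eq {Γ : Ctx W E} {V : Val ob E} {A : Ty W E} (d : VTyp α Γ V A) :
    Γ.wires = A.wires := by
  refine VTyp.rec (motive_1 := fun Γ V A _ => Γ.wires = A.wires)
    (motive_2 := fun _ _ _ _ _ => True) ?_ ?_ ?_ ?_ ?_ ?_ ?_ ?_ ?_ ?_ ?_ ?_ ?_ ?_ ?_ ?_ ?_ ?_ d
  case refine_1 => exact fun h => h.wires_eq
  case refine_2 => exact fun _ h => h.wires_eq
  case refine_3 => intro Φ l a h; simp [Ctx.wires_append, h.wires_eq, Ctx.wires, Entry.ty]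
  case refine_4 => intro Φ l a h; simp [Ctx.wires_append, h.wires_eq, Ctx.wires, Entry.ty]
  case refine_5 => intro _ _ _ _ _ _ _ _ _ _ h _ _; exact h.symm
  case refine_6 => exact fun h _ _ => h.wires_eq
  case refine_7 => intro _ _ _ _ _ _ _ _ _ _ _ h _ _ _ _ _; exact h.wires_eq
  case refine_8 =>
    intro Φ Γ₁ Γ₂ V V' A B h _ _ ih ih'
    simp only [Ctx.wires_append, h.wires_eq, List.nil_append, Ty.wires] at ih ih' ⊢
    rw [ih, ih']
  all_goals intros; trivial

end Typed

/-! ### Environments as lists -/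

section Environments

variable {W : Type w} {E : Type u'} [Category.{v'} E] [CircuitAlgebra E]
  {M : Type u} [Category.{v} M] [StrictSymPremonoidal M] {ob : W → M} {α : Abstraction M E}

variable (ob α) in
/-- An entry of a context together with a value for it. -/
abbrev EnvEntry : Type (max w u' v' v) := Σ a : Entry W E, a.ty.flat ob α

/-- The list of the entries of an environment. -/
def Ctx.envList : {Γ : Ctx W E} → Γ.flat ob α → List (EnvEntry ob α)
  | [], _ => []
  | a :: _, g => ⟨a, g.1⟩ :: Ctx.envList g.2

theorem Ctx.envList_fst : ∀ {Γ : Ctx W E} (g : Γ.flat ob α),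
    (Ctx.envList g).map Sigma.fst = Γ
  | [], _ => rfl
  | _ :: _, g => congrArg (List.cons _) (Ctx.envList_fst g.2)

@[simp] theorem Ctx.length_envList {Γ : Ctx W E} (g : Γ.flat ob α) :
    (Ctx.envList g).length = Γ.length := by
  conv_rhs => rw [← Ctx.envList_fst g, List.length_map]

@[simp] theorem Ctx.envList_join : ∀ {Γ Δ : Ctx W E} (g : Γ.flat ob α) (d : Δ.flat ob α),
    Ctx.envList (Ctx.join g d) = Ctx.envList g ++ Ctx.envList d
  | [], _, _, _ => rfl
  | _ :: _, _, g, d => congrArg (List.cons _) (Ctx.envList_join g.2 d)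

theorem Ctx.envList_split : ∀ {Γ Δ : Ctx W E} (g : Ctx.flat ob α (Γ ++ Δ)),
    Ctx.envList g = Ctx.envList (Ctx.split Γ g).1 ++ Ctx.envList (Ctx.split Γ g).2
  | [], _, _ => rfl
  | _ :: _, _, g => congrArg (List.cons _) (Ctx.envList_split g.2)

theorem Ctx.envList_split_eq {Γ Δ : Ctx W E} {g : Ctx.flat ob α (Γ ++ Δ)}
    {ρ ρ' : List (EnvEntry ob α)} (h : Ctx.envList g = ρ ++ ρ') (hρ : ρ.length = Γ.length) :
    Ctx.envList (Ctx.split Γ g).1 = ρ ∧ Ctx.envList (Ctx.split Γ g).2 = ρ' := by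
  rw [Ctx.envList_split] at h
  exact List.append_inj h (by simp [hρ])

theorem Ctx.envList_swapFlat : ∀ {Γ Δ : Ctx W E} {a b : Entry W E}
    {g : Ctx.flat ob α (Γ ++ a :: b :: Δ)} {ρ ρ' : List (EnvEntry ob α)} {s t : EnvEntry ob α},
    Ctx.envList g = ρ ++ s :: t :: ρ' → ρ.length = Γ.length →
    Ctx.envList (Ctx.swapFlat Γ g) = ρ ++ t :: s :: ρ'
  | [], _, _, _, g, ρ, ρ', s, t, h, hρ => by
    obtain rfl := List.eq_nil_of_length_eq_zero hρ
    injection h with h₁ h₂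
    injection h₂ with h₂ h₃
    subst h₁ h₂ h₃
    rfl
  | c :: Γ, _, _, _, g, ρ, ρ', s, t, h, hρ => by
    cases ρ with
    | nil => simp at hρ
    | cons r ρ =>
      injection h with h₁ h₂
      have := Ctx.envList_swapFlat (Γ := Γ) (g := g.2) h₂ (by simpa using hρ)
      subst h₁
      exact congrArg (List.cons _) this

end Environments

theorem Ctx.obj_cons {W : Type w} {E : Type u'} [Category.{v'} E] {M : Type u} [Category.{v} M]
    [StrictSymPremonoidal M] (ob : W → M) (a : Entry W E) (Γ : Ctx W E) :
    Ctx.obj ob (a :: Γ) = a.ty.obj ob ⊗ₚ Γ.obj ob := rfl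

/-! ### Exchange of blocks -/

section Exchange

variable {W : Type w} {E : Type u'} [Category.{v'} E] [CircuitAlgebra E]
  {M : Type u} [Category.{v} M] [StrictSymPremonoidal M] {ob : W → M} {α : Abstraction M E}

/-- The image of a packaged circuit under an abstraction. -/
def Abstraction.mapArr (α : Abstraction M E) (P : Eff M) : Eff E := arr (α.map P.hom)

@[simp] theorem Abstraction.mapArr_dom (P : Eff M) : (α.mapArr P).dom = α.obj P.dom := rfl
@[simp] theorem Abstraction.mapArr_cod (P : Eff M) : (α.mapArr P).cod = α.obj P.cod := rfl

theorem Abstraction.mapArr_comp {P P' : Eff M} (h : P.cod = P'.dom) :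
    α.mapArr (P ⋆ P') = α.mapArr P ⋆ α.mapArr P' := by
  obtain ⟨X, Y, f⟩ := P
  obtain ⟨Y', Z, g⟩ := P'
  dsimp only at h
  subst h
  rw [← arr_comp]
  simp only [Abstraction.mapArr, α.map_comp, arr_comp]

variable (α) in
/-- Derivations in the context `Γ` can be turned into derivations in the context `Γ'`, by
composing their circuits with `P`. -/
def Exchange (Γ Γ' : Ctx W E) (F : Γ'.flat ob α → Γ.flat ob α) (P : Eff M) : Prop :=
  P.dom = Γ'.obj ob ∧ P.cod = Γ.obj ob ∧
    ∀ {N : Tm ob E} {A : Ty W E} {e e' : Eff E} (d : CTyp α Γ N A e),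
      α.obj (Γ.obj ob) = e.dom → e' = α.mapArr P ⋆ e →
      ∃ d' : CTyp α Γ' N A e', ∀ g, (d'.interp g).1 = (d.interp (F g)).1 ∧
        arr (d'.interp g).2.1 = P ⋆ arr (d.interp (F g)).2.1

theorem Exchange.congr {Γ Γ' : Ctx W E} {F : Γ'.flat ob α → Γ.flat ob α} {P P' : Eff M}
    (h : Exchange α Γ Γ' F P) (hP : P = P') : Exchange α Γ Γ' F P' := hP ▸ h

theorem Exchange.refl (Γ : Ctx W E) : Exchange (ob := ob) α Γ Γ id (arr (𝟙 (Γ.obj ob))) := by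
  refine ⟨rfl, rfl, ?_⟩
  intro N A e e' d h he
  obtain rfl : e' = e := by
    rw [he, Abstraction.mapArr, α.map_id]
    exact Eff.id_comp h
  exact ⟨d, fun g => ⟨rfl, (Eff.id_comp rfl).symm⟩⟩

theorem Exchange.trans {Γ Γ' Γ'' : Ctx W E} {F : Γ'.flat ob α → Γ.flat ob α}
    {F' : Γ''.flat ob α → Γ'.flat ob α} {P P' : Eff M} (h : Exchange α Γ Γ' F P)
    (h' : Exchange α Γ' Γ'' F' P') : Exchange α Γ Γ'' (F ∘ F') (P' ⋆ P) := by
  obtain ⟨h₁, h₂, h⟩ := h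
  obtain ⟨h₁', h₂', h'⟩ := h'
  have hP : P'.cod = P.dom := h₂'.trans h₁.symm
  refine ⟨by simp [h₁'], by rw [Eff.comp_cod hP, h₂], ?_⟩
  intro N A e e' d hd he
  obtain ⟨d₁, hd₁⟩ := h d hd rfl
  have hc : (α.mapArr P).cod = e.dom := by simp [h₂, hd]
  obtain ⟨d₂, hd₂⟩ := h' (e' := e') d₁ (by simp [h₁])
    (by rw [he, Abstraction.mapArr_comp hP, Eff.comp_assoc (by simp [hP])])
  refine ⟨d₂, fun g => ⟨(hd₂ g).1.trans (hd₁ _).1, ?_⟩⟩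
  rw [(hd₂ g).2, (hd₁ _).2, Eff.comp_assoc hP]
  rfl

theorem Exchange.swap (Γ : Ctx W E) (a b : Entry W E) (Δ : Ctx W E) :
    Exchange (ob := ob) α (Γ ++ a :: b :: Δ) (Γ ++ b :: a :: Δ) (Ctx.swapFlat Γ)
      (((braidArr (b.ty.obj ob) (a.ty.obj ob)).rwhisk (Δ.obj ob)).lwhisk (Γ.obj ob)) := by
  rw [← arr_swapHom (fun c : Entry W E => c.ty.obj ob)]
  refine ⟨rfl, rfl, ?_⟩
  intro N A e e' d h he
  obtain rfl := he.trans (Eff.comp_eq h)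
  exact ⟨.ex d h, fun g => ⟨rfl, arr_comp _ _⟩⟩

theorem exists_exchange_cons (b : Entry W E) (Δ Γ₂ : Ctx W E) : ∀ (Γ₁ Γ Γ' : Ctx W E),
    Γ = Γ₁ ++ (Δ ++ b :: Γ₂) → Γ' = Γ₁ ++ (b :: (Δ ++ Γ₂)) →
    ∃ F : Γ'.flat ob α → Γ.flat ob α, Exchange α Γ Γ' F
        (((braidArr (b.ty.obj ob) (Δ.obj ob)).rwhisk (Γ₂.obj ob)).lwhisk (Γ₁.obj ob)) ∧
      ∀ g ρ₁ t δ ρ₂, Ctx.envList g = ρ₁ ++ (t :: (δ ++ ρ₂)) → ρ₁.length = Γ₁.length →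
        δ.length = Δ.length → Ctx.envList (F g) = ρ₁ ++ (δ ++ t :: ρ₂) := by
  induction Δ with
  | nil =>
    intro Γ₁ Γ Γ' hΓ hΓ'
    obtain rfl : Γ = Γ' := by rw [hΓ, hΓ']; rfl
    refine ⟨id, ?_, ?_⟩
    · convert Exchange.refl (α := α) (ob := ob) Γ using 1
      rw [hΓ]
      simp only [listObj_nil, braidArr_unit_right, Eff.rwhisk_id, Eff.lwhisk_id]
      exact arr_id_congr (by simp [listObj_append])
    · intro g ρ₁ t δ ρ₂ h _ hδ
      obtain rfl := List.eq_nil_of_length_eq_zero hδ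
      exact h
  | cons a Δ ih =>
    intro Γ₁ Γ Γ' hΓ hΓ'
    obtain ⟨F, hF, hF'⟩ := ih (Γ₁ ++ [a]) Γ (Γ₁ ++ a :: b :: (Δ ++ Γ₂)) (by simp [hΓ]) (by simp)
    subst hΓ'
    refine ⟨F ∘ Ctx.swapFlat Γ₁, ?_, ?_⟩
    · refine (hF.trans (Exchange.swap Γ₁ a b (Δ ++ Γ₂))).congr (Eq.symm ?_)
      rw [Ctx.obj_cons, braidArr_tensor_right, Eff.rwhisk_comp _ (by simp [tensor_assoc]),
        Eff.lwhisk_comp _ (by simp [tensor_assoc])]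
      simp [Ctx.obj_append, Eff.rwhisk_tensor, Eff.lwhisk_tensor, Eff.rwhisk_lwhisk]
    · intro g ρ₁ t δ ρ₂ h h₁ hδ
      cases δ with
      | nil => simp at hδ
      | cons s δ =>
        have := hF' _ (ρ₁ ++ [s]) t δ ρ₂ (by simpa using Ctx.envList_swapFlat h h₁)
          (by simp [h₁]) (by simpa using hδ)
        simpa using this

theorem exists_exchange (Δ Δ' Γ₂ : Ctx W E) : ∀ (Γ₁ Γ Γ' : Ctx W E),
    Γ = Γ₁ ++ (Δ ++ (Δ' ++ Γ₂)) → Γ' = Γ₁ ++ (Δ' ++ (Δ ++ Γ₂)) →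
    ∃ F : Γ'.flat ob α → Γ.flat ob α, Exchange α Γ Γ' F
        (((braidArr (Δ'.obj ob) (Δ.obj ob)).rwhisk (Γ₂.obj ob)).lwhisk (Γ₁.obj ob)) ∧
      ∀ g ρ₁ δ δ' ρ₂, Ctx.envList g = ρ₁ ++ (δ' ++ (δ ++ ρ₂)) → ρ₁.length = Γ₁.length →
        δ.length = Δ.length → δ'.length = Δ'.length →
        Ctx.envList (F g) = ρ₁ ++ (δ ++ (δ' ++ ρ₂)) := by
  induction Δ' with
  | nil =>
    intro Γ₁ Γ Γ' hΓ hΓ'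
    obtain rfl : Γ = Γ' := by rw [hΓ, hΓ']; rfl
    refine ⟨id, ?_, ?_⟩
    · convert Exchange.refl (α := α) (ob := ob) Γ using 1
      rw [hΓ]
      simp only [listObj_nil, braidArr_unit_left, Eff.rwhisk_id, Eff.lwhisk_id]
      exact arr_id_congr (by simp [listObj_append])
    · intro g ρ₁ δ δ' ρ₂ h _ _ hδ
      obtain rfl := List.eq_nil_of_length_eq_zero hδ
      exact h
  | cons b Δ' ih =>
    intro Γ₁ Γ Γ' hΓ hΓ'
    obtain ⟨F, hF, hF₁⟩ := exists_exchange_cons (ob := ob) (α := α) b Δ (Δ' ++ Γ₂) Γ₁ Γ _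
      (by simp [hΓ]) rfl
    obtain ⟨F', hF', hF₁'⟩ := ih (Γ₁ ++ [b]) (Γ₁ ++ (b :: (Δ ++ (Δ' ++ Γ₂)))) Γ' (by simp)
      (by simp [hΓ'])
    refine ⟨F ∘ F', ?_, ?_⟩
    · refine (hF.trans hF').congr (Eq.symm ?_)
      rw [Ctx.obj_cons, braidArr_tensor_left, Eff.rwhisk_comp _ (by simp [tensor_assoc]),
        Eff.lwhisk_comp _ (by simp [tensor_assoc])]
      simp [Ctx.obj_append, Eff.rwhisk_tensor, Eff.lwhisk_tensor, Eff.rwhisk_lwhisk]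
    · intro g ρ₁ δ δ' ρ₂ h h₁ hδ hδ'
      cases δ' with
      | nil => simp at hδ'
      | cons s δ' =>
        refine hF₁ _ ρ₁ s δ (δ' ++ ρ₂) ?_ h₁ hδ
        have := hF₁' g (ρ₁ ++ [s]) δ δ' ρ₂ (by simpa using h) (by simp [h₁]) hδ (by simpa using hδ')
        simpa using this

end Exchange

/-! ### Translations of contexts -/

section Translation

variable {W : Type w} {E : Type u'} [Category.{v'} E] [CircuitAlgebra E]
  {M : Type u} [Category.{v} M] [StrictSymPremonoidal M] (ob : W → M) (α : Abstraction M E)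

/-- A translation of contexts replaces every entry of a context by a block of entries, every
variable by a value, and every entry of an environment by a block of entries. -/
structure Translation where
  σ : ℕ → Val ob E
  blk : Entry W E → Ctx W E
  eblk : EnvEntry ob α → List (EnvEntry ob α)
  /-- The entries of environments that are translated. -/
  ok : EnvEntry ob α → Prop
  lc : ∀ x, (σ x).LC

variable {ob α}

/-- The value that translates an entry. -/
def Entry.val (σ : ℕ → Val ob E) : Entry W E → Val ob E
  | .lab l _ => .lab l
  | .var x _ => σ x

namespace Translation

/-- The translation of an entry is correct. -/
structure Good (τ : Translation ob α) (a : Entry W E) : Prop where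
  wires : (τ.blk a).wires = a.ty.wires
  param : ∀ x A, a = .var x A → A.IsParam → (τ.blk a).IsParam
  fst : ∀ v, (τ.eblk ⟨a, v⟩).map Sigma.fst = τ.blk a
  typ : ∀ Φ : Ctx W E, Φ.IsParam → ∃ t : VTyp α (Φ ++ τ.blk a) (a.val τ.σ) a.ty,
    ∀ g φ v, τ.ok ⟨a, v⟩ → Ctx.envList g = φ ++ τ.eblk ⟨a, v⟩ → φ.length = Φ.length →
      t.interp g = v

/-- The translation of environments, where the first `n` entries of the target are ignored. -/
def Rel (τ : Translation ob α) (n : ℕ) (ρ ρ' : List (EnvEntry ob α)) : Prop :=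
  (∀ s ∈ ρ, τ.ok s) ∧ ∃ ψ, ψ.length = n ∧ ρ' = ψ ++ ρ.flatMap τ.eblk

variable {τ : Translation ob α}

theorem wires_flatMap {Γ : Ctx W E} (h : ∀ a ∈ Γ, τ.Good a) :
    Ctx.wires (Γ.flatMap τ.blk) = Γ.wires := by
  induction Γ with
  | nil => rfl
  | cons a Γ ih =>
    rw [List.flatMap_cons, Ctx.wires_append, (h a (by simp)).wires,
      ih fun b hb => h b (by simp [hb])]
    rfl

theorem isParam_flatMap {Φ : Ctx W E} (h : ∀ a ∈ Φ, τ.Good a) (hΦ : Φ.IsParam) :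
    Ctx.IsParam (Φ.flatMap τ.blk) := by
  intro b hb
  obtain ⟨a, ha, hb⟩ := List.mem_flatMap.1 hb
  obtain ⟨x, A, hx, hA⟩ := hΦ a ha
  exact (h a ha).param x A hx hA b hb

theorem length_flatMap {Γ : Ctx W E} (h : ∀ a ∈ Γ, τ.Good a) {ρ : List (EnvEntry ob α)}
    (hρ : ρ.map Sigma.fst = Γ) : (ρ.flatMap τ.eblk).length = (Γ.flatMap τ.blk).length := by
  subst hρ
  induction ρ with
  | nil => rfl
  | cons s ρ ih =>
    have hs := congrArg List.length ((h s.1 (by simp)).fst s.2)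
    rw [List.length_map] at hs
    simp only [List.flatMap_cons, List.map_cons, List.length_append]
    rw [ih fun b hb => h b (by simp [hb]), hs]

theorem Rel.split {Γ Δ Γ' Δ' : Ctx W E} {n : ℕ} {g : Ctx.flat ob α (Γ ++ Δ)}
    {g' : Ctx.flat ob α (Γ' ++ Δ')} (h : τ.Rel n (Ctx.envList g) (Ctx.envList g'))
    (hΓ : ∀ a ∈ Γ, τ.Good a) (hΓ' : Γ'.length = n + (Γ.flatMap τ.blk).length) :
    τ.Rel n (Ctx.envList (Ctx.split Γ g).1) (Ctx.envList (Ctx.split Γ' g').1) ∧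
      τ.Rel 0 (Ctx.envList (Ctx.split Γ g).2) (Ctx.envList (Ctx.split Γ' g').2) := by
  obtain ⟨hok, ψ, hψ, h⟩ := h
  rw [Ctx.envList_split (Γ := Γ)] at hok h
  rw [List.flatMap_append, ← List.append_assoc] at h
  obtain ⟨h₁, h₂⟩ := Ctx.envList_split_eq h
    (by rw [List.length_append, length_flatMap hΓ (Ctx.envList_fst _), hψ, hΓ'])
  exact ⟨⟨fun s hs => hok s (List.mem_append_left _ hs), ψ, hψ, h₁⟩,
    ⟨fun s hs => hok s (List.mem_append_right _ hs), [], rfl, h₂⟩⟩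

theorem Rel.append {n : ℕ} {ρ₁ ρ₂ ρ₁' ρ₂' : List (EnvEntry ob α)} (h : τ.Rel n ρ₁ ρ₁')
    (h' : τ.Rel 0 ρ₂ ρ₂') : τ.Rel n (ρ₁ ++ ρ₂) (ρ₁' ++ ρ₂') := by
  obtain ⟨hok, ψ, hψ, rfl⟩ := h
  obtain ⟨hok', ψ', hψ', rfl⟩ := h'
  obtain rfl := List.eq_nil_of_length_eq_zero hψ'
  refine ⟨?_, ψ, hψ, by simp⟩
  intro s hs
  rcases List.mem_append.1 hs with hs | hs
  exacts [hok s hs, hok' s hs]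

open Classical in
/-- The extension of a translation to a bound variable `x`, which is renamed to `y`. -/
noncomputable def bind (τ : Translation ob α) (x y : ℕ) : Translation ob α where
  σ := Function.update τ.σ x (.fvar y)
  blk
    | .lab l c => τ.blk (.lab l c)
    | .var z A => if z = x then [.var y A] else τ.blk (.var z A)
  eblk
    | ⟨.lab l c, v⟩ => τ.eblk ⟨.lab l c, v⟩
    | ⟨.var z A, v⟩ => if z = x then [⟨.var y A, v⟩] else τ.eblk ⟨.var z A, v⟩
  ok
    | ⟨.lab l c, v⟩ => τ.ok ⟨.lab l c, v⟩
    | ⟨.var z A, v⟩ => if z = x then True else τ.ok ⟨.var z A, v⟩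
  lc z := by
    by_cases h : z = x
    · subst h; simpa using Val.fvar_LC y
    · simpa [h] using τ.lc z

theorem bind_blk_self (τ : Translation ob α) (x y : ℕ) (A : Ty W E) :
    (τ.bind x y).blk (.var x A) = [.var y A] := by simp [bind]

theorem bind_agree {x : ℕ} (y : ℕ) {a : Entry W E} (ha : ∀ A, a ≠ .var x A) :
    (τ.bind x y).blk a = τ.blk a ∧ (∀ v, (τ.bind x y).eblk ⟨a, v⟩ = τ.eblk ⟨a, v⟩) ∧
      (∀ v, (τ.bind x y).ok ⟨a, v⟩ ↔ τ.ok ⟨a, v⟩) ∧ a.val (τ.bind x y).σ = a.val τ.σ := by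
  cases a with
  | lab l c => exact ⟨rfl, fun _ => rfl, fun _ => Iff.rfl, rfl⟩
  | var z A =>
    have hz : z ≠ x := by rintro rfl; exact ha A rfl
    simp [bind, hz, Entry.val]

theorem Good.bind {x : ℕ} (y : ℕ) {a : Entry W E} (h : τ.Good a) (ha : ∀ A, a ≠ .var x A) :
    (τ.bind x y).Good a := by
  obtain ⟨h₁, h₂, h₃, h₄⟩ := bind_agree (τ := τ) y ha
  constructor
  · rw [h₁, h.wires]
  · rw [h₁]; exact h.param
  · intro v; rw [h₁, h₂, h.fst]
  · intro Φ hΦ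
    rw [h₁, h₄]
    obtain ⟨t, ht⟩ := h.typ Φ hΦ
    refine ⟨t, fun g φ v hok hg => ht g φ v ((h₃ v).1 hok) ?_⟩
    rw [hg, h₂]

theorem good_var {τ : Translation ob α} {x y : ℕ} {A : Ty W E} (h₁ : τ.σ x = .fvar y)
    (h₂ : τ.blk (.var x A) = [.var y A]) (h₃ : ∀ v, τ.eblk ⟨.var x A, v⟩ = [⟨.var y A, v⟩]) :
    τ.Good (.var x A) := by
  constructor
  · rw [h₂]; simp [Ctx.wires, Entry.ty]
  · rintro z B hz hB
    cases hz
    rw [h₂]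
    intro b hb
    obtain rfl := List.mem_singleton.1 hb
    exact ⟨y, A, rfl, hB⟩
  · intro v; rw [h₂, h₃]; rfl
  · intro Φ hΦ
    rw [h₂, Entry.val, h₁]
    refine ⟨.var y A hΦ, fun g φ v _ hg hφ => ?_⟩
    rw [h₃] at hg
    obtain ⟨_, h⟩ := Ctx.envList_split_eq hg hφ
    have h' := (List.cons.inj h).1
    injection h' with h₁ h₂

theorem good_lab {τ : Translation ob α} {l : ℕ} {c : W}
    (h₂ : τ.blk (.lab l c) = [.lab l c]) (h₃ : ∀ v, τ.eblk ⟨.lab l c, v⟩ = [⟨.lab l c, v⟩]) :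
    τ.Good (.lab l c) := by
  constructor
  · rw [h₂]; simp [Ctx.wires, Entry.ty]
  · rintro z B hz; cases hz
  · intro v; rw [h₂, h₃]; rfl
  · intro Φ hΦ
    rw [h₂]
    exact ⟨.lab l c hΦ, fun g φ v _ hg hφ => rfl⟩

theorem good_bind_self (τ : Translation ob α) (x y : ℕ) (A : Ty W E) :
    (τ.bind x y).Good (.var x A) :=
  good_var (y := y) (by simp [bind]) (by simp [bind]) (fun v => by simp [bind])

theorem good_bind_append (τ : Translation ob α) {Γ : Ctx W E} {x y : ℕ} {A : Ty W E}
    (hΓ : ∀ a ∈ Γ, τ.Good a) (hx : Γ.Fresh x) : ∀ a ∈ Γ ++ [.var x A], (τ.bind x y).Good a := by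
  intro a ha
  rcases List.mem_append.1 ha with ha | ha
  · exact (hΓ a ha).bind y (by rintro A rfl; exact hx A ha)
  · obtain rfl := List.mem_singleton.1 ha
    exact good_bind_self τ x y A

theorem flatMap_bind {Γ : Ctx W E} {x : ℕ} (y : ℕ) (hx : Γ.Fresh x) :
    Γ.flatMap (τ.bind x y).blk = Γ.flatMap τ.blk := by
  refine List.flatMap_congr fun a ha => (bind_agree y ?_).1
  rintro A rfl
  exact hx A ha

theorem Rel.bind {n : ℕ} {ρ ρ' : List (EnvEntry ob α)} {x : ℕ} (y : ℕ) (h : τ.Rel n ρ ρ')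
    (hx : Ctx.Fresh x (ρ.map Sigma.fst)) : (τ.bind x y).Rel n ρ ρ' := by
  obtain ⟨hok, ψ, hψ, rfl⟩ := h
  have hρ : ∀ s ∈ ρ, ∀ A, s.1 ≠ .var x A := fun s hs A hA =>
    hx A (List.mem_map.2 ⟨s, hs, hA⟩)
  refine ⟨fun s hs => ((bind_agree y (hρ s hs)).2.2.1 s.2).2 (hok s hs), ψ, hψ, ?_⟩
  congr 1
  exact List.flatMap_congr fun s hs => ((bind_agree y (hρ s hs)).2.1 s.2).symm

theorem Rel.join {Γ Δ Γ' Δ' : Ctx W E} {n : ℕ} {g : Γ.flat ob α} {d : Δ.flat ob α}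
    {g' : Γ'.flat ob α} {d' : Δ'.flat ob α} (h : τ.Rel n (Ctx.envList g) (Ctx.envList g'))
    (h' : τ.Rel 0 (Ctx.envList d) (Ctx.envList d')) :
    τ.Rel n (Ctx.envList (Ctx.join g d)) (Ctx.envList (Ctx.join g' d')) := by
  rw [Ctx.envList_join, Ctx.envList_join]
  exact h.append h'

theorem rel_bind_single (x y : ℕ) (A : Ty W E) (v : A.flat ob α) :
    (τ.bind x y).Rel 0 (Ctx.envList (Γ := [.var x A]) (ob := ob) (α := α) (v, PUnit.unit))
      (Ctx.envList (Γ := [.var y A]) (ob := ob) (α := α) (v, PUnit.unit)) :=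
  ⟨by simp [Translation.bind, Ctx.envList], [], rfl, by simp [Translation.bind, Ctx.envList]⟩

theorem rel_bind_pair {x y : ℕ} (x' y' : ℕ) (hxy : x ≠ y) (A B : Ty W E) (v : A.flat ob α)
    (v' : B.flat ob α) :
    ((τ.bind x x').bind y y').Rel 0
      (Ctx.envList (Γ := [.var x A, .var y B]) (ob := ob) (α := α) (v, v', PUnit.unit))
      (Ctx.envList (Γ := [.var x' A, .var y' B]) (ob := ob) (α := α) (v, v', PUnit.unit)) :=
  ⟨by simp [Translation.bind, Ctx.envList, hxy], [], rfl,
    by simp [Translation.bind, Ctx.envList, hxy]⟩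

end Translation

end Translation

/-! ### Translations of derivations -/

section BoundedArr

variable {M : Type u} [Category.{v} M] [StrictSymPremonoidal M]
  {E : Type u'} [Category.{v'} E] [CircuitAlgebra E] {α : Abstraction M E}

theorem Circs.arr_cast {e : Eff E} {X X' Y Y' : M} (hX : X' = X) (hY : Y = Y')
    (C : Circs α e X Y) : arr (C.cast hX hY).1 = arr C.1 :=
  (arr_eqToHom_comp _ _).trans (arr_comp_eqToHom _ _)

theorem Circs.arr_comp {e d : Eff E} {X Y Z : M} (C : Circs α e X Y) (D : Circs α d Y Z)
    (h : e.cod = d.dom) : arr (C.comp D h).1 = arr C.1 ⋆ arr D.1 :=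
  ProtoQuipperR.arr_comp _ _

theorem Circs.ext {e : Eff E} {X Y : M} {C D : Circs α e X Y} (h : arr C.1 = arr D.1) : C = D :=
  Subtype.ext (arr_injective h)

end BoundedArr

section Translation

variable {W : Type w} {E : Type u'} [Category.{v'} E] [CircuitAlgebra E]
  {M : Type u} [Category.{v} M] [StrictSymPremonoidal M] {ob : W → M} {α : Abstraction M E}

theorem Ctx.IsParam.append_wires {Φ : Ctx W E} (h : Φ.IsParam) (Γ : Ctx W E) :
    Ctx.wires (Φ ++ Γ) = Γ.wires := by
  rw [Ctx.wires_append, h.wires_eq, List.nil_append]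

theorem lett_eff_congr {X Y : E} (hXY : X = Y) {e₁ e₂ : Eff E} (h : X ⊗ₚ e₁.cod = e₂.dom)
    (h' : Y ⊗ₚ e₁.cod = e₂.dom) :
    (⟨X ⊗ₚ e₁.dom, e₂.cod, lw X e₁.hom ≫ eqToHom h ≫ e₂.hom⟩ : Eff E) =
      ⟨Y ⊗ₚ e₁.dom, e₂.cod, lw Y e₁.hom ≫ eqToHom h' ≫ e₂.hom⟩ := by
  subst hXY; rfl

theorem Tm.msubst_inst_update₂ {σ : ℕ → Val ob E} (hσ : ∀ x, (σ x).LC) {N : Tm ob E} {x y : ℕ}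
    {U U' : Val ob E} (hU : U.LC) (hU' : U'.LC) (hxy : x ≠ y) (hx : x ∉ N.fv) (hy : y ∉ N.fv)
    (k k' : ℕ) :
    ((N.inst k (.fvar x)).inst k' (.fvar y)).msubst
      (Function.update (Function.update σ x U) y U') = ((N.msubst σ).inst k U).inst k' U' := by
  have h : ∀ z, (Function.update (Function.update σ x U) y U' z).LC := by
    intro z
    simp only [Function.update_apply]
    split_ifs <;> simp [*]
  rw [Tm.msubst_inst h, Tm.msubst_inst h, Tm.msubst_congr (σ' := σ) N]
  · simp [Val.msubst, hxy]
  · intro z hz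
    have hzx : z ≠ x := by rintro rfl; exact hx hz
    have hzy : z ≠ y := by rintro rfl; exact hy hz
    simp [hzx, hzy]

mutual

theorem VTyp.translate : {Γ : Ctx W E} → {V : Val ob E} → {A : Ty W E} → (d : VTyp α Γ V A) →
    ∀ (τ : Translation ob α) (Ψ Γ' : Ctx W E) (V' : Val ob E), (∀ a ∈ Γ, τ.Good a) →
    Ψ.IsParam → Γ' = Ψ ++ Γ.flatMap τ.blk → V' = V.msubst τ.σ →
    ∃ d' : VTyp α Γ' V' A, ∀ g g', τ.Rel Ψ.length (Ctx.envList g) (Ctx.envList g') →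
      d'.interp g' = d.interp g
  | _, _, _, .unit hΦ, τ, Ψ, Γ', V', hτ, hΨ, hΓ, hV => by
    subst hΓ hV
    exact ⟨.unit (Ctx.isParam_append hΨ (Translation.isParam_flatMap hτ hΦ)), fun _ _ _ => rfl⟩
  | _, _, _, .nat n hΦ, τ, Ψ, Γ', V', hτ, hΨ, hΓ, hV => by
    subst hΓ hV
    exact ⟨.nat n (Ctx.isParam_append hΨ (Translation.isParam_flatMap hτ hΦ)), fun _ _ _ => rfl⟩
  | _, _, _, .lab (Φ := Φ) l c hΦ, τ, Ψ, Γ', V', hτ, hΨ, hΓ, hV => by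
    simp only [List.mem_append] at hτ
    have hΦ' := Ctx.isParam_append hΨ (Translation.isParam_flatMap (fun a ha => hτ a (.inl ha)) hΦ)
    obtain ⟨t, ht⟩ := (hτ (.lab l c) (by simp)).typ _ hΦ'
    obtain rfl : Γ' = Ψ ++ Φ.flatMap τ.blk ++ τ.blk (.lab l c) := by simp [hΓ]
    subst hV
    exact ⟨t, fun _ _ _ => rfl⟩
  | _, _, _, .var (Φ := Φ) x A hΦ, τ, Ψ, Γ', V', hτ, hΨ, hΓ, hV => by
    simp only [List.mem_append] at hτ
    have hΦ₁ : ∀ a ∈ Φ, τ.Good a := fun a ha => hτ a (.inl ha)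
    have hΦ' := Ctx.isParam_append hΨ (Translation.isParam_flatMap hΦ₁ hΦ)
    obtain ⟨t, ht⟩ := (hτ (.var x A) (by simp)).typ _ hΦ'
    obtain rfl : Γ' = Ψ ++ Φ.flatMap τ.blk ++ τ.blk (.var x A) := by simp [hΓ]
    subst hV
    refine ⟨t, fun g g' h => ?_⟩
    obtain ⟨hok, ψ, hψ, h⟩ := h
    rw [Ctx.envList_split (Γ := Φ)] at hok h
    change t.interp g' = (Ctx.split Φ g).2.1
    refine ht g' (ψ ++ (Ctx.envList (Ctx.split Φ g).1).flatMap τ.eblk) _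
      (hok ⟨.var x A, (Ctx.split Φ g).2.1⟩ (by simp [Ctx.envList])) ?_ ?_
    · rw [h]; simp [Ctx.envList]
    · rw [List.length_append, List.length_append, hψ,
        Translation.length_flatMap hΦ₁ (Ctx.envList_fst _)]
  | Γ, _, _, .abs (A := A) (N := N) x hx hxN hA hT d, τ, Ψ, Γ', V', hτ, hΨ, hΓ, hV => by
    obtain ⟨y, hy, hyN⟩ := exists_fresh Γ' (N.msubst τ.σ)
    obtain ⟨d', hd'⟩ := d.translate (τ.bind x y) Ψ (Γ' ++ [.var y A])
      ((N.msubst τ.σ).inst 0 (.fvar y)) _ (τ.good_bind_append hτ hx) hΨ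
      (by rw [List.flatMap_append, Translation.flatMap_bind y hx, hΓ]
          simp [Translation.bind_blk_self])
      (Tm.msubst_inst_update τ.lc (Val.fvar_LC y) hxN 0).symm rfl
    subst hV
    refine ⟨.abs y hy hyN hA ?_ d', fun g g' h => ?_⟩
    · rw [hT, hΓ, hΨ.append_wires, Translation.wires_flatMap hτ]
    · funext a
      obtain ⟨h₁, h₂⟩ := hd' (Ctx.join g ((a, PUnit.unit) : Ctx.flat ob α [.var x A]))
        (Ctx.join g' ((a, PUnit.unit) : Ctx.flat ob α [.var y A]))
        ((h.bind y (by rwa [Ctx.envList_fst])).join (Translation.rel_bind_single _ _ _ _))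
      refine Prod.ext h₁ (Circs.ext ?_)
      simp only [VTyp.interp, Circs.arr_cast]
      exact h₂
  | _, _, _, .lift (N := N) hΦ d, τ, Ψ, Γ', V', hτ, hΨ, hΓ, hV => by
    obtain ⟨d', hd'⟩ := d.translate τ Ψ Γ' (N.msubst τ.σ) _ hτ hΨ hΓ rfl rfl
    subst hΓ hV
    refine ⟨.lift (Ctx.isParam_append hΨ (Translation.isParam_flatMap hτ hΦ)) d', ?_⟩
    intro g g' h
    funext a
    obtain ⟨h₁, h₂⟩ := hd' g g' h
    refine Prod.ext h₁ (Circs.ext ?_)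
    simp only [VTyp.interp, Circs.arr_cast]
    exact h₂
  | _, _, _, .circ p q hΦ hp hq hb hc h, τ, Ψ, Γ', V', hτ, hΨ, hΓ, hV => by
    subst hΓ hV
    exact ⟨.circ p q (Ctx.isParam_append hΨ (Translation.isParam_flatMap hτ hΦ)) hp hq hb hc h,
      fun _ _ _ => rfl⟩
  | _, _, _, .pair (Φ := Φ) (Γ₁ := Γ₁) (Γ₂ := Γ₂) hΦ d₁ d₂, τ, Ψ, Γ', V', hτ, hΨ, hΓ, hV => by
    simp only [List.mem_append] at hτ
    have hΦ₁ : ∀ a ∈ Φ, τ.Good a := fun a ha => hτ a (.inl ha)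
    have hΦ' := Ctx.isParam_append hΨ (Translation.isParam_flatMap hΦ₁ hΦ)
    obtain ⟨d₁', h₁⟩ := d₁.translate τ Ψ (Ψ ++ Φ.flatMap τ.blk ++ Γ₁.flatMap τ.blk) _
      (by simp only [List.mem_append]; intro a ha; exact hτ a (by tauto)) hΨ (by simp) rfl
    obtain ⟨d₂', h₂⟩ := d₂.translate τ Ψ (Ψ ++ Φ.flatMap τ.blk ++ Γ₂.flatMap τ.blk) _
      (by simp only [List.mem_append]; intro a ha; exact hτ a (by tauto)) hΨ (by simp) rfl
    obtain rfl : Γ' = Ψ ++ Φ.flatMap τ.blk ++ (Γ₁.flatMap τ.blk ++ Γ₂.flatMap τ.blk) := by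
      simp [hΓ]
    subst hV
    refine ⟨.pair hΦ' d₁' d₂', fun g g' h => ?_⟩
    obtain ⟨hr, hr'⟩ := h.split hΦ₁ (by simp)
    obtain ⟨hr₁, hr₂⟩ := hr'.split (fun a ha => hτ a (by tauto)) (by simp)
    exact Prod.ext (h₁ _ _ (hr.join hr₁)) (h₂ _ _ (hr.join hr₂))

theorem CTyp.translate : {Γ : Ctx W E} → {N : Tm ob E} → {A : Ty W E} → {e : Eff E} →
    (d : CTyp α Γ N A e) → ∀ (τ : Translation ob α) (Ψ Γ' : Ctx W E) (N' : Tm ob E) (e' : Eff E),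
    (∀ a ∈ Γ, τ.Good a) → Ψ.IsParam → Γ' = Ψ ++ Γ.flatMap τ.blk → N' = N.msubst τ.σ → e' = e →
    ∃ d' : CTyp α Γ' N' A e', ∀ g g', τ.Rel Ψ.length (Ctx.envList g) (Ctx.envList g') →
      (d'.interp g').1 = (d.interp g).1 ∧ arr (d'.interp g').2.1 = arr (d.interp g).2.1
  | _, _, _, _, .app (Φ := Φ) (Γ₁ := Γ₁) (Γ₂ := Γ₂) hΦ d₁ d₂, τ, Ψ, Γ', N', _, hτ, hΨ, hΓ, hN,
      he => by
    simp only [List.mem_append] at hτ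
    have hΦ₁ : ∀ a ∈ Φ, τ.Good a := fun a ha => hτ a (.inl ha)
    have hΦ' := Ctx.isParam_append hΨ (Translation.isParam_flatMap hΦ₁ hΦ)
    obtain ⟨d₁', h₁⟩ := d₁.translate τ Ψ (Ψ ++ Φ.flatMap τ.blk ++ Γ₁.flatMap τ.blk) _
      (by simp only [List.mem_append]; intro a ha; exact hτ a (by tauto)) hΨ (by simp) rfl
    obtain ⟨d₂', h₂⟩ := d₂.translate τ Ψ (Ψ ++ Φ.flatMap τ.blk ++ Γ₂.flatMap τ.blk) _
      (by simp only [List.mem_append]; intro a ha; exact hτ a (by tauto)) hΨ (by simp) rfl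
    obtain rfl : Γ' = Ψ ++ Φ.flatMap τ.blk ++ (Γ₁.flatMap τ.blk ++ Γ₂.flatMap τ.blk) := by
      simp [hΓ]
    subst hN he
    refine ⟨.app hΦ' d₁' d₂', fun g g' h => ?_⟩
    obtain ⟨hr, hr'⟩ := h.split hΦ₁ (by simp)
    obtain ⟨hr₁, hr₂⟩ := hr'.split (fun a ha => hτ a (by tauto)) (by simp)
    have h₁ := h₁ _ _ (hr.join hr₁)
    have h₂ := h₂ _ _ (hr.join hr₂)
    simp only [CTyp.interp, Circs.arr_cast]
    rw [h₁, h₂]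
    exact ⟨rfl, rfl⟩
  | _, _, _, _, .force hΦ d, τ, Ψ, Γ', N', _, hτ, hΨ, hΓ, hN, he => by
    obtain ⟨d', hd'⟩ := d.translate τ Ψ Γ' _ hτ hΨ hΓ rfl
    subst hΓ hN he
    refine ⟨.force (Ctx.isParam_append hΨ (Translation.isParam_flatMap hτ hΦ)) d', ?_⟩
    intro g g' h
    simp only [CTyp.interp, Circs.arr_cast]
    rw [hd' g g' h]
    exact ⟨rfl, rfl⟩
  | _, _, _, _, .box hΦ d, τ, Ψ, Γ', N', _, hτ, hΨ, hΓ, hN, he => by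
    obtain ⟨d', hd'⟩ := d.translate τ Ψ Γ' _ hτ hΨ hΓ rfl
    subst hΓ hN he
    refine ⟨.box (Ctx.isParam_append hΨ (Translation.isParam_flatMap hτ hΦ)) d', ?_⟩
    intro g g' h
    simp only [CTyp.interp]
    rw [hd' g g' h]
    exact ⟨rfl, (Circs.arr_cast _ _ _).trans (Circs.arr_cast _ _ _).symm⟩
  | _, _, _, _, .apply (Φ := Φ) (Γ₁ := Γ₁) (Γ₂ := Γ₂) hΦ d₁ d₂, τ, Ψ, Γ', N', _, hτ, hΨ, hΓ, hN,
      he => by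
    simp only [List.mem_append] at hτ
    have hΦ₁ : ∀ a ∈ Φ, τ.Good a := fun a ha => hτ a (.inl ha)
    have hΦ' := Ctx.isParam_append hΨ (Translation.isParam_flatMap hΦ₁ hΦ)
    obtain ⟨d₁', h₁⟩ := d₁.translate τ Ψ (Ψ ++ Φ.flatMap τ.blk ++ Γ₁.flatMap τ.blk) _
      (by simp only [List.mem_append]; intro a ha; exact hτ a (by tauto)) hΨ (by simp) rfl
    obtain ⟨d₂', h₂⟩ := d₂.translate τ Ψ (Ψ ++ Φ.flatMap τ.blk ++ Γ₂.flatMap τ.blk) _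
      (by simp only [List.mem_append]; intro a ha; exact hτ a (by tauto)) hΨ (by simp) rfl
    obtain rfl : Γ' = Ψ ++ Φ.flatMap τ.blk ++ (Γ₁.flatMap τ.blk ++ Γ₂.flatMap τ.blk) := by
      simp [hΓ]
    subst hN he
    refine ⟨.apply hΦ' d₁' d₂', fun g g' h => ?_⟩
    obtain ⟨hr, hr'⟩ := h.split hΦ₁ (by simp)
    obtain ⟨hr₁, hr₂⟩ := hr'.split (fun a ha => hτ a (by tauto)) (by simp)
    have h₁ := h₁ _ _ (hr.join hr₁)
    simp only [CTyp.interp]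
    rw [h₁]
    exact ⟨trivial, (Circs.arr_cast _ _ _).trans (Circs.arr_cast _ _ _).symm⟩
  | _, _, _, _, .dest (Φ := Φ) (Γ₁ := Γ₁) (Γ₂ := Γ₂) (N := N) (A := A) (B := B) x y hΦ hxy hx hy
      hxN hyN d₁ d₂, τ, Ψ, Γ', N', _, hτ, hΨ, hΓ, hN, he => by
    simp only [List.mem_append] at hτ
    have hΦ₁ : ∀ a ∈ Φ, τ.Good a := fun a ha => hτ a (.inl ha)
    have hΦ' := Ctx.isParam_append hΨ (Translation.isParam_flatMap hΦ₁ hΦ)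
    have hΓ₂ : ∀ a ∈ Φ ++ Γ₂, τ.Good a := by
      simp only [List.mem_append]; intro a ha; exact hτ a (by tauto)
    obtain ⟨x', hx', hxN'⟩ := exists_fresh (Ψ ++ Φ.flatMap τ.blk ++ Γ₂.flatMap τ.blk)
      (N.msubst τ.σ)
    obtain ⟨y', hy', hyN'⟩ := exists_fresh
      (Ψ ++ Φ.flatMap τ.blk ++ Γ₂.flatMap τ.blk ++ [.var x' A]) (N.msubst τ.σ)
    have hxy' : x' ≠ y' := by
      rintro rfl
      exact hy' A (by simp)
    obtain ⟨d₁', h₁⟩ := d₁.translate τ Ψ (Ψ ++ Φ.flatMap τ.blk ++ Γ₁.flatMap τ.blk) _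
      (by simp only [List.mem_append]; intro a ha; exact hτ a (by tauto)) hΨ (by simp) rfl
    have hyx : Ctx.Fresh y (Φ ++ Γ₂ ++ [.var x A]) := by
      intro B hB
      rcases List.mem_append.1 hB with hB | hB
      · exact hy B hB
      · simp [hxy.symm] at hB
    have hgood := (τ.bind x x').good_bind_append (x := y) (y := y') (A := B)
      (τ.good_bind_append (x := x) (y := x') (A := A) hΓ₂ hx) hyx
    have hfl := Translation.flatMap_bind (τ := τ.bind x x') y' hyx
    rw [List.flatMap_append (xs := Φ ++ Γ₂), List.flatMap_append (xs := Φ ++ Γ₂),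
      Translation.flatMap_bind x' hx] at hfl
    obtain ⟨d₂', h₂⟩ := d₂.translate ((τ.bind x x').bind y y') Ψ
      (Ψ ++ Φ.flatMap τ.blk ++ (Γ₂.flatMap τ.blk ++ [.var x' A, .var y' B]))
      (((N.msubst τ.σ).inst 1 (.fvar x')).inst 0 (.fvar y')) _
      (by simpa using hgood) hΨ
      (by
        rw [show Φ ++ (Γ₂ ++ [.var x A, .var y B]) = Φ ++ Γ₂ ++ [.var x A] ++ [.var y B] by simp,
          List.flatMap_append, List.flatMap_append, hfl]
        simp [Translation.bind_blk_self])
      (Tm.msubst_inst_update₂ τ.lc (Val.fvar_LC x') (Val.fvar_LC y') hxy hxN hyN 1 0).symm rfl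
    obtain rfl : Γ' = Ψ ++ Φ.flatMap τ.blk ++ (Γ₂.flatMap τ.blk ++ Γ₁.flatMap τ.blk) := by
      simp [hΓ]
    subst hN he
    refine ⟨.dest x' y' hΦ' hxy' hx' (fun C hC => hy' C (List.mem_append_left _ hC)) hxN' hyN'
      d₁' d₂', fun g g' h => ?_⟩
    obtain ⟨hr, hr'⟩ := h.split hΦ₁ (by simp)
    obtain ⟨hr₂, hr₁⟩ := hr'.split (fun a ha => hτ a (by tauto)) (by simp)
    have h₁ := h₁ _ _ (hr.join hr₁)
    simp only [CTyp.interp, Circs.arr_cast]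
    rw [h₁]
    have hfr : ∀ {Δ : Ctx W E} (f : Δ.flat ob α) {z : ℕ}, Ctx.Fresh z Δ →
        Ctx.Fresh z ((Ctx.envList f).map Sigma.fst) := by
      intro Δ f z hz; rwa [Ctx.envList_fst]
    refine h₂ _ _ (.join ((hr.bind x' (hfr _ ?_)).bind y' (hfr _ ?_))
      (.join ((hr₂.bind x' (hfr _ ?_)).bind y' (hfr _ ?_))
        (Translation.rel_bind_pair x' y' hxy A B _ _)))
    · exact fun C hC => hx C (List.mem_append_left _ hC)
    · exact fun C hC => hy C (List.mem_append_left _ hC)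
    · exact fun C hC => hx C (List.mem_append_right _ hC)
    · exact fun C hC => hy C (List.mem_append_right _ hC)
  | _, _, _, _, .ifz (Φ := Φ) (Γ := Γ) hΦ d d₁ d₂, τ, Ψ, Γ', N', _, hτ, hΨ, hΓ, hN, he => by
    have hΦ₁ : ∀ a ∈ Φ, τ.Good a := fun a ha => hτ a (by simp [ha])
    have hΦ' := Ctx.isParam_append hΨ (Translation.isParam_flatMap hΦ₁ hΦ)
    obtain rfl : Γ' = Ψ ++ Φ.flatMap τ.blk ++ Γ.flatMap τ.blk := by simp [hΓ]
    obtain ⟨d', hd⟩ := d.translate τ Ψ (Ψ ++ Φ.flatMap τ.blk) _ hΦ₁ hΨ rfl rfl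
    obtain ⟨d₁', h₁⟩ := d₁.translate τ Ψ _ _ _ hτ hΨ hΓ rfl rfl
    obtain ⟨d₂', h₂⟩ := d₂.translate τ Ψ _ _ _ hτ hΨ hΓ rfl rfl
    subst hN he
    refine ⟨.ifz hΦ' d' d₁' d₂', fun g g' h => ?_⟩
    obtain ⟨hr, _⟩ := h.split hΦ₁ (by simp)
    simp only [CTyp.interp, hd _ _ hr]
    split
    · exact h₁ _ _ h
    · exact h₂ _ _ h
  | _, _, _, _, .ret d, τ, Ψ, Γ', N', _, hτ, hΨ, hΓ, hN, he => by
    obtain ⟨d', hd'⟩ := d.translate τ Ψ Γ' _ hτ hΨ hΓ rfl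
    subst hN he
    refine ⟨.ret d', fun g g' h => ⟨hd' g g' h, ?_⟩⟩
    simp only [CTyp.interp, Circs.arr_cast]
  | _, _, _, _, .lett (Φ := Φ) (Γ₁ := Γ₁) (Γ₂ := Γ₂) (N' := N₂) (A := A) x hΦ hx hxN d₁ d₂ he',
      τ, Ψ, Γ', N', _, hτ, hΨ, hΓ, hN, he => by
    simp only [List.mem_append] at hτ
    have hΦ₁ : ∀ a ∈ Φ, τ.Good a := fun a ha => hτ a (.inl ha)
    have hΦ' := Ctx.isParam_append hΨ (Translation.isParam_flatMap hΦ₁ hΦ)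
    have hΓ₂ : ∀ a ∈ Φ ++ Γ₂, τ.Good a := by
      simp only [List.mem_append]; intro a ha; exact hτ a (by tauto)
    obtain ⟨y, hy, hyN⟩ := exists_fresh (Ψ ++ Φ.flatMap τ.blk ++ Γ₂.flatMap τ.blk)
      (N₂.msubst τ.σ)
    obtain ⟨d₁', h₁⟩ := d₁.translate τ Ψ (Ψ ++ Φ.flatMap τ.blk ++ Γ₁.flatMap τ.blk) _ _
      (by simp only [List.mem_append]; intro a ha; exact hτ a (by tauto)) hΨ (by simp) rfl rfl
    obtain ⟨d₂', h₂⟩ := d₂.translate (τ.bind x y) Ψ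
      (Ψ ++ Φ.flatMap τ.blk ++ (Γ₂.flatMap τ.blk ++ [.var y A]))
      ((N₂.msubst τ.σ).inst 0 (.fvar y)) _
      (by simpa using τ.good_bind_append hΓ₂ hx) hΨ
      (by
        rw [← List.append_assoc Φ, List.flatMap_append, Translation.flatMap_bind y hx]
        simp [Translation.bind_blk_self])
      (Tm.msubst_inst_update τ.lc (Val.fvar_LC y) hxN 0).symm rfl
    obtain rfl : Γ' = Ψ ++ Φ.flatMap τ.blk ++ (Γ₂.flatMap τ.blk ++ Γ₁.flatMap τ.blk) := by
      simp [hΓ]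
    have hobj : Ctx.obj ob (Γ₂.flatMap τ.blk) = Ctx.obj ob Γ₂ :=
      Ctx.obj_congr (Translation.wires_flatMap fun a ha => hτ a (by tauto))
    obtain rfl := he.trans (lett_eff_congr (congrArg α.obj hobj.symm) he' (by rw [hobj, he']))
    subst hN
    refine ⟨.lett y hΦ' hy hyN d₁' d₂' _, fun g g' h => ?_⟩
    obtain ⟨hr, hr'⟩ := h.split hΦ₁ (by simp)
    obtain ⟨hr₂, hr₁⟩ := hr'.split (fun a ha => hτ a (by tauto)) (by simp)
    obtain ⟨h₁, h₁'⟩ := h₁ _ _ (hr.join hr₁)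
    have hfr : ∀ {Δ : Ctx W E} (f : Δ.flat ob α), Ctx.Fresh x Δ →
        Ctx.Fresh x ((Ctx.envList f).map Sigma.fst) := by
      intro Δ f hz; rwa [Ctx.envList_fst]
    obtain ⟨h₂, h₂'⟩ := h₂ _ _ (.join
      (hr.bind y (hfr _ fun C hC => hx C (List.mem_append_left _ hC)))
      (.join (hr₂.bind y (hfr _ fun C hC => hx C (List.mem_append_right _ hC)))
        (Translation.rel_bind_single x y A (d₁.interp (Ctx.join (Ctx.split Φ g).1
          (Ctx.split Γ₂ (Ctx.split Φ g).2).2)).1)))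
    simp only [CTyp.interp, Circs.arr_cast, Circs.arr_comp]
    rw [h₁, h₂, h₂']
    refine ⟨rfl, congrArg (· ⋆ _) ?_⟩
    change Eff.lwhisk _ (arr _) = Eff.lwhisk _ (arr _)
    rw [h₁', hobj]
  | _, _, _, _, .sub d h, τ, Ψ, Γ', N', _, hτ, hΨ, hΓ, hN, he => by
    obtain ⟨d', hd'⟩ := d.translate τ Ψ Γ' N' _ hτ hΨ hΓ hN rfl
    subst he
    exact ⟨.sub d' h, hd'⟩
  | _, _, _, _, .ex (Γ₁ := Γ₁) (Γ₂ := Γ₂) (a := a) (b := b) (e := e) d h, τ, Ψ, Γ', N', _,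
      hτ, hΨ, hΓ, hN, he => by
    obtain ⟨d', hd'⟩ := d.translate τ Ψ
      (Ψ ++ Γ₁.flatMap τ.blk ++ (τ.blk a ++ (τ.blk b ++ Γ₂.flatMap τ.blk))) N' _
      (fun c hc => hτ c (by simp only [List.mem_append, List.mem_cons] at hc ⊢; tauto)) hΨ
      (by simp) hN rfl
    simp only [List.mem_append, List.mem_cons] at hτ
    obtain ⟨F, ⟨hF₁, hF₂, hF₃⟩, hF'⟩ := exists_exchange (ob := ob) (α := α) (τ.blk a) (τ.blk b)
      (Γ₂.flatMap τ.blk) (Ψ ++ Γ₁.flatMap τ.blk) _ Γ' rfl (by simp [hΓ])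
    have hΓ₁ : ∀ c ∈ Γ₁, τ.Good c := fun c hc => hτ c (by tauto)
    have ha : τ.Good a := hτ a (by tauto)
    have hb : τ.Good b := hτ b (by tauto)
    have hblk : ∀ c, τ.Good c → Ctx.obj ob (τ.blk c) = c.ty.obj ob := fun c hc => by
      rw [Ctx.obj_eq, hc.wires, Ty.obj_eq]
    have hw₁ : Ctx.obj ob (Ψ ++ Γ₁.flatMap τ.blk) = Ctx.obj ob Γ₁ :=
      Ctx.obj_congr (by rw [hΨ.append_wires, Translation.wires_flatMap hΓ₁])
    have hw₂ : Ctx.obj ob (Γ₂.flatMap τ.blk) = Ctx.obj ob Γ₂ :=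
      Ctx.obj_congr (Translation.wires_flatMap fun c hc => hτ c (by tauto))
    rw [hw₁, hw₂, hblk a ha, hblk b hb, ← arr_swapHom (fun c : Entry W E => c.ty.obj ob)]
      at hF₁ hF₂ hF₃
    obtain ⟨d'', hd''⟩ := hF₃ d' (by rw [← hF₂]; exact h)
      (he.trans (Eff.comp_eq (e := α.mapArr (arr _)) h).symm)
    refine ⟨d'', fun g g' hr => ?_⟩
    obtain ⟨hok, ψ, hψ, hr⟩ := hr
    have hg : Ctx.envList g = Ctx.envList (Ctx.split Γ₁ g).1 ++ ⟨b, (Ctx.split Γ₁ g).2.1⟩ ::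
        ⟨a, (Ctx.split Γ₁ g).2.2.1⟩ :: Ctx.envList (Ctx.split Γ₁ g).2.2.2 := Ctx.envList_split g
    have hg₁ := Ctx.envList_swapFlat hg (Ctx.length_envList _)
    rw [hg] at hok hr
    have hlen : ∀ {c : Entry W E}, τ.Good c → ∀ v, (τ.eblk ⟨c, v⟩).length = (τ.blk c).length :=
      fun hc v => by rw [← hc.fst v, List.length_map]
    obtain ⟨h₁, h₂⟩ := hd' (Ctx.swapFlat Γ₁ g) (F g') (by
      refine ⟨fun s hs => hok s ?_, ψ, hψ, ?_⟩
      · rw [hg₁] at hs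
        simp only [List.mem_append, List.mem_cons] at hs ⊢
        tauto
      · rw [hF' g' (ψ ++ (Ctx.envList (Ctx.split Γ₁ g).1).flatMap τ.eblk) _ _ _
          (by simpa using hr) ?_ (hlen ha _) (hlen hb _), hg₁]
        · simp
        · rw [List.length_append, List.length_append, hψ,
            Translation.length_flatMap hΓ₁ (Ctx.envList_fst _)])
    rw [(hd'' g').1, (hd'' g').2, h₁, h₂]
    refine ⟨rfl, ?_⟩
    simp only [CTyp.interp, Circs.arr_comp]
    rfl

end

end Translation

/-! ### Weakening and substitution -/

section Substitution

variable {W : Type w} {E : Type u'} [Category.{v'} E] [CircuitAlgebra E]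
  {M : Type u} [Category.{v} M] [StrictSymPremonoidal M] {ob : W → M} {α : Abstraction M E}

namespace Translation

variable (ob α) in
/-- The identical translation. -/
def id : Translation ob α where
  σ := .fvar
  blk a := [a]
  eblk s := [s]
  ok _ := True
  lc := Val.fvar_LC

theorem good_id (a : Entry W E) : (id ob α).Good a := by
  cases a with
  | lab l c => exact good_lab rfl fun _ => rfl
  | var x A => exact good_var rfl rfl fun _ => rfl

theorem flatMap_id (Γ : Ctx W E) : Γ.flatMap (id ob α).blk = Γ := List.flatMap_singleton' Γ

theorem rel_id {n : ℕ} {ρ ψ : List (EnvEntry ob α)} (h : ψ.length = n) :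
    (id ob α).Rel n ρ (ψ ++ ρ) :=
  ⟨fun _ _ => trivial, ψ, h, by rw [show ρ.flatMap (id ob α).eblk = ρ from
    List.flatMap_singleton' ρ]⟩

open Classical in
/-- The extension of a translation to the variable `x`, which is replaced by a value `U`
in the context `Δ`; `l` is an environment for `Δ` and `v` is the meaning of `U`. -/
noncomputable def extend (τ : Translation ob α) (x : ℕ) (A : Ty W E) {U : Val ob E} (hU : U.LC)
    {Δ : Ctx W E} (l : Δ.flat ob α) (v : A.flat ob α) : Translation ob α where
  σ := Function.update τ.σ x U
  blk a := if a = .var x A then Δ else τ.blk a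
  eblk s := if s.1 = .var x A then Ctx.envList l else τ.eblk s
  ok s := if s.1 = .var x A then s = ⟨.var x A, v⟩ else τ.ok s
  lc z := by
    by_cases h : z = x
    · subst h; simpa using hU
    · simpa [h] using τ.lc z

variable {τ : Translation ob α} {x : ℕ} {A : Ty W E} {U : Val ob E} {hU : U.LC} {Δ : Ctx W E}
  {l : Δ.flat ob α} {v : A.flat ob α}

theorem Good.extend {a : Entry W E} (h : τ.Good a) (ha : ∀ B, a ≠ .var x B) :
    (τ.extend x A hU l v).Good a := by
  have h₁ : (τ.extend x A hU l v).blk a = τ.blk a := if_neg (ha A)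
  have h₂ : ∀ u, (τ.extend x A hU l v).eblk ⟨a, u⟩ = τ.eblk ⟨a, u⟩ := fun _ => if_neg (ha A)
  have h₃ : ∀ u, (τ.extend x A hU l v).ok ⟨a, u⟩ ↔ τ.ok ⟨a, u⟩ := fun u => by
    simp [Translation.extend, ha A]
  have h₄ : a.val (τ.extend x A hU l v).σ = a.val τ.σ := by
    cases a with
    | lab k c => rfl
    | var z B =>
      have hz : z ≠ x := by rintro rfl; exact ha B rfl
      simp [Translation.extend, Entry.val, hz]
  constructor
  · rw [h₁, h.wires]
  · rw [h₁]; exact h.param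
  · intro u; rw [h₁, h₂, h.fst]
  · intro Φ hΦ
    rw [h₁, h₄]
    obtain ⟨t, ht⟩ := h.typ Φ hΦ
    refine ⟨t, fun g φ u hok hg => ht g φ u ((h₃ u).1 hok) ?_⟩
    rw [hg, h₂]

theorem extend_blk_self : (τ.extend x A hU l v).blk (.var x A) = Δ := if_pos rfl

theorem extend_eblk_self (u : (Entry.var x A).ty.flat ob α) :
    (τ.extend x A hU l v).eblk ⟨.var x A, u⟩ = Ctx.envList l := if_pos rfl

theorem flatMap_extend {Γ : Ctx W E} (hx : Γ.Fresh x) :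
    Γ.flatMap (τ.extend x A hU l v).blk = Γ.flatMap τ.blk := by
  refine List.flatMap_congr fun a ha => if_neg ?_
  rintro rfl
  exact hx A ha

theorem Rel.extend {n : ℕ} {ρ ρ' : List (EnvEntry ob α)} (h : τ.Rel n ρ ρ')
    (hx : Ctx.Fresh x (ρ.map Sigma.fst)) : (τ.extend x A hU l v).Rel n ρ ρ' := by
  obtain ⟨hok, ψ, hψ, rfl⟩ := h
  have hρ : ∀ s ∈ ρ, s.1 ≠ .var x A := fun s hs hA => hx A (List.mem_map.2 ⟨s, hs, hA⟩)
  refine ⟨fun s hs => ?_, ψ, hψ, ?_⟩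
  · simpa [Translation.extend, hρ s hs] using hok s hs
  · congr 1
    exact List.flatMap_congr fun s hs => (if_neg (hρ s hs)).symm

theorem rel_extend_self : (τ.extend x A hU l v).Rel 0 [⟨.var x A, v⟩] (Ctx.envList l) :=
  ⟨by simp [Translation.extend], [], rfl, by
    rw [List.flatMap_singleton]; exact (extend_eblk_self (hU := hU) (v := v) v).symm⟩

end Translation

/-- Values in a context can be weakened by parameters. -/
theorem VTyp.weaken {Γ : Ctx W E} {V : Val ob E} {A : Ty W E} (d : VTyp α Γ V A) {Φ : Ctx W E}
    (hΦ : Φ.IsParam) : ∃ d' : VTyp α (Φ ++ Γ) V A, ∀ g φ l, Ctx.envList g = φ ++ Ctx.envList l →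
      φ.length = Φ.length → d'.interp g = d.interp l := by
  obtain ⟨d', hd'⟩ := d.translate (Translation.id ob α) Φ (Φ ++ Γ) V
    (fun a _ => Translation.good_id a) hΦ (by rw [Translation.flatMap_id])
    (Val.msubst_fvar V).symm
  refine ⟨d', fun g φ l hg hφ => hd' l g ?_⟩
  rw [hg]
  exact Translation.rel_id hφ

theorem Translation.good_extend_self {τ : Translation ob α} {x : ℕ} {A : Ty W E} {U : Val ob E}
    {Δ : Ctx W E} (d : VTyp α Δ U A) (l : Δ.flat ob α) (hΔ : A.IsParam → Δ.IsParam) :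
    (τ.extend x A d.lc l (d.interp l)).Good (.var x A) := by
  constructor
  · rw [extend_blk_self]
    exact d.wires_eq
  · intro z B hz hB
    cases hz
    rw [extend_blk_self]
    exact hΔ hB
  · intro u
    rw [extend_blk_self, extend_eblk_self, Ctx.envList_fst]
  · intro Φ hΦ
    obtain ⟨d', hd'⟩ := d.weaken hΦ
    have hU : (Entry.var x A).val (τ.extend x A d.lc l (d.interp l)).σ = U := by
      simp [Translation.extend, Entry.val]
    rw [extend_blk_self, hU]
    refine ⟨d', fun g φ u hok hg hφ => ?_⟩
    rw [extend_eblk_self] at hg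
    refine (hd' g φ l hg hφ).trans ?_
    have hok : (⟨.var x A, u⟩ : EnvEntry ob α) = ⟨.var x A, d.interp l⟩ := by
      simpa [Translation.extend] using hok
    injection hok with _ h
    exact h.symm

/-- Substitution of a value for the last variable of a context. -/
theorem CTyp.subst {Γ Δ : Ctx W E} {x : ℕ} {A B : Ty W E} {e : Eff E} {N : Tm ob E}
    {U : Val ob E} (d : CTyp α (Γ ++ [.var x A]) (N.inst 0 (.fvar x)) B e) (dU : VTyp α Δ U A)
    (l : Δ.flat ob α) (hΔ : A.IsParam → Δ.IsParam) (hx : Γ.Fresh x) (hxN : x ∉ N.fv) :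
    ∃ d' : CTyp α (Γ ++ Δ) (N.inst 0 U) B e, ∀ g : Γ.flat ob α,
      (d'.interp (Ctx.join g l)).1 = (d.interp
        (Ctx.join (Δ := [.var x A]) g (dU.interp l, PUnit.unit))).1 ∧
      arr (d'.interp (Ctx.join g l)).2.1 = arr (d.interp
        (Ctx.join (Δ := [.var x A]) g (dU.interp l, PUnit.unit))).2.1 := by
  obtain ⟨d', hd'⟩ := d.translate ((Translation.id ob α).extend x A dU.lc l (dU.interp l)) []
    (Γ ++ Δ) (N.inst 0 U) e
    (by
      intro a ha
      rcases List.mem_append.1 ha with ha | ha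
      · exact (Translation.good_id a).extend (by rintro B rfl; exact hx B ha)
      · obtain rfl := List.mem_singleton.1 ha
        exact Translation.good_extend_self dU l hΔ)
    (by intro a ha; cases ha)
    (by
      rw [List.flatMap_append, Translation.flatMap_extend hx, Translation.flatMap_id]
      simp [Translation.extend_blk_self])
    (by
      have h := Tm.msubst_inst_update (Translation.id ob α).lc dU.lc hxN 0
      rw [show (Translation.id ob α).σ = .fvar from rfl, Tm.msubst_fvar] at h
      exact h.symm) rfl
  refine ⟨d', fun g => hd' _ _ (.join (.extend ?_ ?_) Translation.rel_extend_self)⟩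
  · exact Translation.rel_id (ψ := []) rfl
  · rwa [Ctx.envList_fst]

/-- Simultaneous substitution of values for the last two variables of a context. -/
theorem CTyp.subst₂ {Γ Δ Δ' : Ctx W E} {x y : ℕ} {A A' B : Ty W E} {e : Eff E} {N : Tm ob E}
    {U U' : Val ob E}
    (d : CTyp α (Γ ++ [.var x A, .var y A']) ((N.inst 1 (.fvar x)).inst 0 (.fvar y)) B e)
    (dU : VTyp α Δ U A) (dU' : VTyp α Δ' U' A')
    (l : Δ.flat ob α) (l' : Δ'.flat ob α) (hΔ : A.IsParam → Δ.IsParam)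
    (hΔ' : A'.IsParam → Δ'.IsParam) (hxy : x ≠ y) (hx : Γ.Fresh x) (hy : Γ.Fresh y)
    (hxN : x ∉ N.fv) (hyN : y ∉ N.fv) :
    ∃ d' : CTyp α (Γ ++ (Δ ++ Δ')) ((N.inst 1 U).inst 0 U') B e, ∀ g : Γ.flat ob α,
      (d'.interp (Ctx.join g (Ctx.join l l'))).1 = (d.interp (Ctx.join
        (Δ := [.var x A, .var y A']) g (dU.interp l, dU'.interp l', PUnit.unit))).1 ∧
      arr (d'.interp (Ctx.join g (Ctx.join l l'))).2.1 = arr (d.interp (Ctx.join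
        (Δ := [.var x A, .var y A']) g (dU.interp l, dU'.interp l', PUnit.unit))).2.1 := by
  have hxe : ∀ B, Entry.var (E := E) x A ≠ .var y B := by
    rintro B h
    injection h with h _
    exact hxy h
  obtain ⟨d', hd'⟩ := d.translate (((Translation.id ob α).extend x A dU.lc l
      (dU.interp l)).extend y A' dU'.lc l' (dU'.interp l')) []
    (Γ ++ (Δ ++ Δ')) ((N.inst 1 U).inst 0 U') e
    (by
      intro a ha
      rcases List.mem_append.1 ha with ha | ha
      · exact ((Translation.good_id a).extend (by rintro B rfl; exact hx B ha)).extend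
          (by rintro B rfl; exact hy B ha)
      · simp only [List.mem_cons, List.not_mem_nil, or_false] at ha
        rcases ha with rfl | rfl
        · exact (Translation.good_extend_self dU l hΔ).extend hxe
        · exact Translation.good_extend_self dU' l' hΔ')
    (by intro a ha; cases ha)
    (by
      have hy' : Ctx.Fresh y [.var x A] := by
        intro B hB
        exact hxe B (List.mem_singleton.1 hB).symm
      rw [show Γ ++ [.var x A, .var y A'] = Γ ++ ([.var x A] ++ [.var y A']) from rfl,
        List.flatMap_append, List.flatMap_append, Translation.flatMap_extend hy,
        Translation.flatMap_extend hx, Translation.flatMap_id, Translation.flatMap_extend hy']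
      simp [Translation.extend_blk_self])
    (by
      have h := Tm.msubst_inst_update₂ (Translation.id ob α).lc dU.lc dU'.lc hxy hxN hyN 1 0
      rw [show (Translation.id ob α).σ = .fvar from rfl, Tm.msubst_fvar] at h
      exact h.symm) rfl
  refine ⟨d', fun g => hd' _ _ (.join (.extend (.extend ?_ ?_) ?_) ?_)⟩
  · exact Translation.rel_id (ψ := []) rfl
  · rwa [Ctx.envList_fst]
  · rwa [Ctx.envList_fst]
  · rw [Ctx.envList_join]
    refine Translation.Rel.append (ρ₁ := [⟨.var x A, dU.interp l⟩])
      (ρ₂ := [⟨.var y A', dU'.interp l'⟩]) (.extend Translation.rel_extend_self ?_)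
      Translation.rel_extend_self
    intro B hB
    exact hxe B (List.mem_singleton.1 hB).symm

end Substitution

/-! ### Label contexts and wire bundles -/

section Labels

variable {W : Type w} {E : Type u'} [Category.{v'} E] [CircuitAlgebra E]
  {M : Type u} [Category.{v} M] [StrictSymPremonoidal M] {ob : W → M} {α : Abstraction M E}

theorem LabCtx.toCtx_append (L L' : LabCtx W) :
    (LabCtx.toCtx (L ++ L') : Ctx W E) = L.toCtx ++ L'.toCtx := List.map_append

theorem LabCtx.eq_append_of_toCtx {L : LabCtx W} {Γ Δ : Ctx W E} (h : L.toCtx = Γ ++ Δ) :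
    ∃ L₁ L₂ : LabCtx W, L = L₁ ++ L₂ ∧ L₁.toCtx = Γ ∧ L₂.toCtx = Δ :=
  List.map_eq_append_iff.1 h

theorem LabCtx.toCtx_injective {L L' : LabCtx W}
    (h : (L.toCtx : Ctx W E) = L'.toCtx) : L = L' := by
  refine List.map_injective_iff.2 ?_ h
  rintro ⟨l, a⟩ ⟨l', a'⟩ h
  cases h
  rfl

theorem LabCtx.eq_nil_of_isParam {L : LabCtx W} (h : (L.toCtx : Ctx W E).IsParam) : L = [] := by
  cases L with
  | nil => rfl
  | cons a L =>
    obtain ⟨x, A, hx, _⟩ := h (.lab a.1 a.2) List.mem_cons_self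
    cases hx

theorem LabCtx.fresh (L : LabCtx W) (x : ℕ) : (L.toCtx : Ctx W E).Fresh x := by
  intro A hA
  obtain ⟨_, _, h⟩ := List.mem_map.1 hA
  cases h

theorem LabCtx.length_wires (L : LabCtx W) : (L.toCtx : Ctx W E).wires.length = L.length := by
  induction L with
  | nil => rfl
  | cons a L ih =>
    change ([a.2] ++ Ctx.wires (LabCtx.toCtx L : Ctx W E)).length = _
    simp [ih]

theorem Ctx.IsParam.toCtx_append {Φ Γ₁ Γ₂ : Ctx W E} (hΦ : Φ.IsParam) {L : LabCtx W}
    (h : L.toCtx = Φ ++ (Γ₁ ++ Γ₂)) :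
    Φ = [] ∧ ∃ L₁ L₂ : LabCtx W, L = L₁ ++ L₂ ∧ L₁.toCtx = Γ₁ ∧ L₂.toCtx = Γ₂ := by
  obtain ⟨L₀, L', rfl, rfl, h'⟩ := LabCtx.eq_append_of_toCtx h
  obtain ⟨L₁, L₂, rfl, rfl, rfl⟩ := LabCtx.eq_append_of_toCtx h'
  obtain rfl := LabCtx.eq_nil_of_isParam hΦ
  exact ⟨rfl, L₁, L₂, rfl, rfl, rfl⟩

theorem LabCtx.flat_subsingleton {Γ : Ctx W E} {L : LabCtx W} (h : Γ = L.toCtx) :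
    Subsingleton (Γ.flat ob α) := by
  subst h
  induction L with
  | nil => exact inferInstanceAs (Subsingleton PUnit)
  | cons a L ih => exact ⟨fun g g' => Prod.ext rfl (ih.elim g.2 g'.2)⟩

theorem LabCtx.eq_pt {L : LabCtx W} (g : Ctx.flat ob α (L.toCtx : Ctx W E)) : g = LabCtx.pt L :=
  (LabCtx.flat_subsingleton rfl).elim _ _

theorem Bundle.flat_subsingleton (T : Bundle W) :
    Subsingleton ((T.toTy : Ty W E).flat ob α) := by
  induction T with
  | unit => exact inferInstanceAs (Subsingleton PUnit)
  | wire a => exact inferInstanceAs (Subsingleton PUnit)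
  | tensor T U ih ih' =>
    exact ⟨fun g g' => Prod.ext (Subsingleton.elim g.1 g'.1) (Subsingleton.elim g.2 g'.2)⟩

theorem VTyp.isParam_toCtx {L : LabCtx W} {V : Val ob E} {A : Ty W E} (d : VTyp α L.toCtx V A)
    (hA : A.IsParam) : (L.toCtx : Ctx W E).IsParam := by
  have h := LabCtx.length_wires (E := E) L
  rw [d.wires_eq, hA.wires_eq] at h
  obtain rfl := List.eq_nil_of_length_eq_zero h.symm
  intro a ha
  cases ha

/-! ### Substitution of closed values -/

theorem CTyp.subst_toCtx {L Δ : LabCtx W} {x : ℕ} {A B : Ty W E} {e : Eff E} {N : Tm ob E}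
    {U : Val ob E} (d : CTyp α (L.toCtx ++ [.var x A]) (N.inst 0 (.fvar x)) B e)
    (dU : VTyp α Δ.toCtx U A) (hxN : x ∉ N.fv) :
    ∃ d' : CTyp α (LabCtx.toCtx (L ++ Δ)) (N.inst 0 U) B e,
      (d'.interp (LabCtx.pt _)).1 = (d.interp
        (Ctx.join (Δ := [.var x A]) (LabCtx.pt L) (dU.interp (LabCtx.pt Δ), PUnit.unit))).1 ∧
      arr (d'.interp (LabCtx.pt _)).2.1 = arr (d.interp
        (Ctx.join (Δ := [.var x A]) (LabCtx.pt L) (dU.interp (LabCtx.pt Δ), PUnit.unit))).2.1 := by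
  obtain ⟨d', hd'⟩ := d.subst dU (LabCtx.pt Δ) dU.isParam_toCtx (L.fresh x) hxN
  replace hd' := hd' (LabCtx.pt L)
  revert d'
  generalize Ctx.join (LabCtx.pt (ob := ob) (α := α) L) (LabCtx.pt Δ) = l
  revert l
  rw [← LabCtx.toCtx_append]
  intro l d' h
  rw [← LabCtx.eq_pt l]
  exact ⟨d', h⟩

theorem CTyp.subst₂_toCtx {L Δ Δ' : LabCtx W} {x y : ℕ} {A A' B : Ty W E} {e : Eff E}
    {N : Tm ob E} {U U' : Val ob E}
    (d : CTyp α (L.toCtx ++ [.var x A, .var y A']) ((N.inst 1 (.fvar x)).inst 0 (.fvar y)) B e)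
    (dU : VTyp α Δ.toCtx U A) (dU' : VTyp α Δ'.toCtx U' A') (hxy : x ≠ y) (hxN : x ∉ N.fv)
    (hyN : y ∉ N.fv) :
    ∃ d' : CTyp α (LabCtx.toCtx (L ++ (Δ ++ Δ'))) ((N.inst 1 U).inst 0 U') B e,
      (d'.interp (LabCtx.pt _)).1 = (d.interp (Ctx.join (Δ := [.var x A, .var y A']) (LabCtx.pt L)
        (dU.interp (LabCtx.pt Δ), dU'.interp (LabCtx.pt Δ'), PUnit.unit))).1 ∧
      arr (d'.interp (LabCtx.pt _)).2.1 = arr (d.interp (Ctx.join (Δ := [.var x A, .var y A'])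
        (LabCtx.pt L) (dU.interp (LabCtx.pt Δ), dU'.interp (LabCtx.pt Δ'), PUnit.unit))).2.1 := by
  obtain ⟨d', hd'⟩ := d.subst₂ dU dU' (LabCtx.pt Δ) (LabCtx.pt Δ') dU.isParam_toCtx
    dU'.isParam_toCtx hxy (L.fresh x) (L.fresh y) hxN hyN
  replace hd' := hd' (LabCtx.pt L)
  revert d'
  generalize Ctx.join (LabCtx.pt (ob := ob) (α := α) L) (Ctx.join (LabCtx.pt Δ) (LabCtx.pt Δ')) = l
  revert l
  rw [show (L.toCtx ++ (Δ.toCtx ++ Δ'.toCtx) : Ctx W E) = LabCtx.toCtx (L ++ (Δ ++ Δ')) by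
    rw [LabCtx.toCtx_append, LabCtx.toCtx_append]]
  intro l d' h
  rw [← LabCtx.eq_pt l]
  exact ⟨d', h⟩

/-! ### Inversion for closed values -/

theorem VTyp.closed_pair {Γ : Ctx W E} {V V' : Val ob E} {A B : Ty W E}
    (d : VTyp α Γ (.pair V V') (.tensor A B)) (g : Γ.flat ob α) {L : LabCtx W}
    (hL : L.toCtx = Γ) :
    ∃ (L₁ L₂ : LabCtx W) (d₁ : VTyp α L₁.toCtx V A) (d₂ : VTyp α L₂.toCtx V' B), L = L₁ ++ L₂ ∧
      d.interp g = (d₁.interp (LabCtx.pt L₁), d₂.interp (LabCtx.pt L₂)) := by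
  cases d with
  | pair hΦ d₁ d₂ =>
    obtain ⟨rfl, L₁, L₂, rfl, rfl, rfl⟩ := hΦ.toCtx_append hL
    exact ⟨L₁, L₂, d₁, d₂, rfl, Prod.ext (congrArg d₁.interp (LabCtx.eq_pt _))
      (congrArg d₂.interp (LabCtx.eq_pt _))⟩

theorem VTyp.lam_ty {Γ : Ctx W E} {N : Tm ob E} {A A' B : Ty W E} {T : Bundle W} {e : Eff E}
    (d : VTyp α Γ (.lam A' N) (.arrow A B T e)) : A = A' := by
  cases d; rfl

theorem VTyp.inv_lam {Γ : Ctx W E} {N : Tm ob E} {A A' B : Ty W E} {T : Bundle W} {e : Eff E}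
    (d : VTyp α Γ (.lam A' N) (.arrow A B T e)) :
    ∃ (x : ℕ) (d' : CTyp α (Γ ++ [.var x A]) (N.inst 0 (.fvar x)) B e), x ∉ N.fv ∧
      ∀ g a, (d.interp g a).1 = (d'.interp (Ctx.join (Δ := [.var x A]) g (a, PUnit.unit))).1 ∧
        arr (d.interp g a).2.1 =
          arr (d'.interp (Ctx.join (Δ := [.var x A]) g (a, PUnit.unit))).2.1 := by
  cases d with
  | abs x hx hxN hA hT d =>
    refine ⟨x, d, hxN, fun g a => ⟨rfl, ?_⟩⟩
    simp only [VTyp.interp, Circs.arr_cast]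

theorem VTyp.inv_lift {Γ : Ctx W E} {N : Tm ob E} {A : Ty W E} {e : Eff E}
    (d : VTyp α Γ (.lift N) (.bang A e)) :
    ∃ d' : CTyp α Γ N A e, ∀ g, (d.interp g PUnit.unit).1 = (d'.interp g).1 ∧
        arr (d.interp g PUnit.unit).2.1 = arr (d'.interp g).2.1 := by
  cases d with
  | lift hΦ d =>
    refine ⟨d, fun g => ⟨rfl, ?_⟩⟩
    simp only [VTyp.interp, Circs.arr_cast]

theorem VTyp.inv_boxed {Γ : Ctx W E} {b c : WBundle} {C : LCirc ob} {T U : Bundle W} {e : Eff E}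
    (d : VTyp α Γ (.boxed b C c) (.circ T U e)) :
    ∃ (Q L : LabCtx W) (p q : Eff M), Γ.IsParam ∧ PermArr (fun a : ℕ × W => ob a.2) Q C.dom p ∧
      PermArr (fun a : ℕ × W => ob a.2) C.cod L q ∧ WBundle.HasType Q b T ∧
      WBundle.HasType L c U ∧ ∀ g, arr (d.interp g).1 = p ⋆ arr C.hom ⋆ q := by
  cases d with
  | circ p q hΦ hp hq hb hc h =>
    refine ⟨_, _, _, _, hΦ, .of_isPerm hp, .of_isPerm hq, hb, hc, fun g => ?_⟩
    refine (Circs.arr_cast _ _ _).trans ?_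
    rw [arr_comp, arr_comp, Eff.comp_assoc rfl]

/-! ### Wire bundles -/

theorem WBundle.HasType.nonempty_vtyp {Q : LabCtx W} {b : WBundle} {T : Bundle W}
    (h : WBundle.HasType Q b T) : Nonempty (VTyp α Q.toCtx (b.toVal : Val ob E) T.toTy) := by
  have hnil : Ctx.IsParam ([] : Ctx W E) := by intro a ha; cases ha
  induction h with
  | unit => exact ⟨.unit hnil⟩
  | lab l a => exact ⟨.lab (Φ := []) l a hnil⟩
  | pair _ _ ih ih' =>
    obtain ⟨d⟩ := ih
    obtain ⟨d'⟩ := ih'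
    rw [LabCtx.toCtx_append]
    exact ⟨.pair (Φ := []) hnil d d'⟩

theorem VTyp.hasType : ∀ {b : WBundle} {T : Bundle W} {Γ : Ctx W E} {L : LabCtx W},
    VTyp α Γ (b.toVal : Val ob E) T.toTy → L.toCtx = Γ → WBundle.HasType L b T
  | .unit, .unit, Γ, L, d, h => by
    simp only [WBundle.toVal, Bundle.toTy] at d
    cases d with
    | unit hΦ =>
      subst h
      rw [LabCtx.eq_nil_of_isParam hΦ]
      exact .unit
  | .lab l, .wire a, Γ, L, d, h => by
    simp only [WBundle.toVal, Bundle.toTy] at d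
    cases d with
    | lab _ _ hΦ =>
      obtain ⟨L₀, L₁, rfl, rfl, h'⟩ := LabCtx.eq_append_of_toCtx h
      rw [LabCtx.eq_nil_of_isParam hΦ, LabCtx.toCtx_injective (L' := [(l, a)]) (E := E) h']
      exact .lab l a
  | .pair b c, .tensor T U, Γ, L, d, h => by
    simp only [WBundle.toVal, Bundle.toTy] at d
    cases d with
    | pair hΦ d₁ d₂ =>
      obtain ⟨rfl, L₁, L₂, rfl, rfl, rfl⟩ := hΦ.toCtx_append h
      exact .pair (VTyp.hasType d₁ rfl) (VTyp.hasType d₂ rfl)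
  | .unit, .wire _, _, _, d, _ | .unit, .tensor _ _, _, _, d, _ | .lab _, .unit, _, _, d, _
  | .lab _, .tensor _ _, _, _, d, _ | .pair _ _, .unit, _, _, d, _
  | .pair _ _, .wire _, _, _, d, _ => by
    simp only [WBundle.toVal, Bundle.toTy] at d
    cases d

theorem WBundle.HasType.relabel {Q : LabCtx W} {b : WBundle} {T : Bundle W}
    (h : WBundle.HasType Q b T) (ρ : ℕ → ℕ) :
    WBundle.HasType (Q.relabel ρ) (b.relabel ρ) T := by
  induction h with
  | unit => exact .unit
  | lab l a => exact .lab _ _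
  | pair _ _ ih ih' =>
    rw [LabCtx.relabel, List.map_append]
    exact .pair ih ih'

theorem WBundle.HasType.unique {Q Q' : LabCtx W} {b : WBundle} {T : Bundle W}
    (h : WBundle.HasType Q b T) (h' : WBundle.HasType Q' b T) : Q = Q' := by
  induction h generalizing Q' with
  | unit => cases h'; rfl
  | lab l a => cases h'; rfl
  | pair _ _ ih ih' =>
    cases h' with
    | pair h₁ h₂ => rw [ih h₁, ih' h₂]

end Labels

/-! ### Inversion for closed computations -/

section Inversion

variable {W : Type w} {E : Type u'} [Category.{v'} E] [CircuitAlgebra E]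
  {M : Type u} [Category.{v} M] [StrictSymPremonoidal M] {ob : W → M} {α : Abstraction M E}

/-- The last rule of the derivation is neither subsumption nor exchange. -/
def CTyp.IsHead {Γ : Ctx W E} {N : Tm ob E} {A : Ty W E} {e : Eff E} : CTyp α Γ N A e → Prop
  | .sub _ _ => False
  | .ex _ _ => False
  | _ => True

theorem CTyp.closed_app {Γ : Ctx W E} {V V' : Val ob E} {B : Ty W E} {e : Eff E}
    (d : CTyp α Γ (.app V V') B e) (hd : d.IsHead) (g : Γ.flat ob α) {L : LabCtx W}
    (hL : L.toCtx = Γ) :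
    ∃ (L₁ L₂ : LabCtx W) (A : Ty W E) (T : Bundle W) (d₁ : VTyp α L₁.toCtx V (.arrow A B T e))
      (d₂ : VTyp α L₂.toCtx V' A), L = L₁ ++ L₂ ∧
      (d.interp g).1 = (d₁.interp (LabCtx.pt L₁) (d₂.interp (LabCtx.pt L₂))).1 ∧
      arr (d.interp g).2.1 = arr (d₁.interp (LabCtx.pt L₁) (d₂.interp (LabCtx.pt L₂))).2.1 := by
  cases d with
  | app hΦ d₁ d₂ =>
    obtain ⟨rfl, L₁, L₂, rfl, rfl, rfl⟩ := hΦ.toCtx_append hL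
    refine ⟨L₁, L₂, _, _, d₁, d₂, rfl, ?_⟩
    have h₁ := LabCtx.eq_pt (Ctx.split (LabCtx.toCtx L₁) (Ctx.split [] g).2).1
    have h₂ := LabCtx.eq_pt (Ctx.split (LabCtx.toCtx L₁) (Ctx.split [] g).2).2
    rw [← h₁, ← h₂]
    exact ⟨rfl, Circs.arr_cast _ _ _⟩
  | sub => exact hd.elim
  | ex => exact hd.elim

theorem CTyp.closed_force {Γ : Ctx W E} {V : Val ob E} {A : Ty W E} {e : Eff E}
    (d : CTyp α Γ (.force V) A e) (hd : d.IsHead) (g : Γ.flat ob α) :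
    ∃ d' : VTyp α Γ V (.bang A e), (d.interp g).1 = (d'.interp g PUnit.unit).1 ∧
      arr (d.interp g).2.1 = arr (d'.interp g PUnit.unit).2.1 := by
  cases d with
  | force hΦ d => exact ⟨d, rfl, Circs.arr_cast _ _ _⟩
  | sub => exact hd.elim
  | ex => exact hd.elim

theorem CTyp.closed_box {Γ : Ctx W E} {T : Bundle W} {V : Val ob E} {A : Ty W E} {e : Eff E}
    (d : CTyp α Γ (.box T V) A e) (hd : d.IsHead) (g : Γ.flat ob α) :
    ∃ (U : Bundle W) (e' : Eff E) (d' : VTyp α Γ V (.arrow T.toTy U.toTy .unit e')),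
      Γ.IsParam ∧ A = .circ T U e' ∧ HEq (d.interp g).1 (boxMap T U e' (d'.interp g)) ∧
      arr (d.interp g).2.1 = arr (𝟙 (unit : M)) := by
  cases d with
  | box hΦ d => exact ⟨_, _, d, hΦ, rfl, HEq.rfl, Circs.arr_cast _ _ _⟩
  | sub => exact hd.elim
  | ex => exact hd.elim

theorem CTyp.closed_apply {Γ : Ctx W E} {V V' : Val ob E} {A : Ty W E} {e : Eff E}
    (d : CTyp α Γ (.apply V V') A e) (hd : d.IsHead) (g : Γ.flat ob α) {L : LabCtx W}
    (hL : L.toCtx = Γ) :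
    ∃ (L₁ L₂ : LabCtx W) (T U : Bundle W) (d₁ : VTyp α L₁.toCtx V (.circ T U e))
      (_ : VTyp α L₂.toCtx V' T.toTy), L = L₁ ++ L₂ ∧ A = U.toTy ∧
      arr (d.interp g).2.1 = arr (d₁.interp (LabCtx.pt L₁)).1 := by
  cases d with
  | apply hΦ d₁ d₂ =>
    obtain ⟨rfl, L₁, L₂, rfl, rfl, rfl⟩ := hΦ.toCtx_append hL
    refine ⟨L₁, L₂, _, _, d₁, d₂, rfl, rfl, ?_⟩
    rw [← LabCtx.eq_pt (Ctx.split (LabCtx.toCtx L₁) (Ctx.split [] g).2).1]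
    exact Circs.arr_cast _ _ _
  | sub => exact hd.elim
  | ex => exact hd.elim

theorem CTyp.closed_dest {Γ : Ctx W E} {V : Val ob E} {N : Tm ob E} {A' : Ty W E} {e : Eff E}
    (d : CTyp α Γ (.dest V N) A' e) (hd : d.IsHead) (g : Γ.flat ob α) {L : LabCtx W}
    (hL : L.toCtx = Γ) :
    ∃ (L₁ L₂ : LabCtx W) (A B : Ty W E) (x y : ℕ) (d₁ : VTyp α L₁.toCtx V (.tensor A B))
      (d₂ : CTyp α (L₂.toCtx ++ [.var x A, .var y B]) ((N.inst 1 (.fvar x)).inst 0 (.fvar y))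
        A' e), L = L₂ ++ L₁ ∧ x ≠ y ∧ x ∉ N.fv ∧ y ∉ N.fv ∧
      (d.interp g).1 = (d₂.interp (Ctx.join (Δ := [.var x A, .var y B]) (LabCtx.pt L₂)
        ((d₁.interp (LabCtx.pt L₁)).1, (d₁.interp (LabCtx.pt L₁)).2, PUnit.unit))).1 ∧
      arr (d.interp g).2.1 = arr (d₂.interp (Ctx.join (Δ := [.var x A, .var y B]) (LabCtx.pt L₂)
        ((d₁.interp (LabCtx.pt L₁)).1, (d₁.interp (LabCtx.pt L₁)).2, PUnit.unit))).2.1 := by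
  cases d with
  | dest x y hΦ hxy hx hy hxN hyN d₁ d₂ =>
    obtain ⟨rfl, L₂, L₁, rfl, rfl, rfl⟩ := hΦ.toCtx_append hL
    refine ⟨L₁, L₂, _, _, x, y, d₁, d₂, rfl, hxy, hxN, hyN, ?_⟩
    rw [← LabCtx.eq_pt (Ctx.split (LabCtx.toCtx L₂) (Ctx.split [] g).2).1,
      ← LabCtx.eq_pt (Ctx.split (LabCtx.toCtx L₂) (Ctx.split [] g).2).2]
    exact ⟨rfl, Circs.arr_cast _ _ _⟩
  | sub => exact hd.elim
  | ex => exact hd.elim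

theorem CTyp.inv_ifz {Γ : Ctx W E} {n : ℕ} {N N' : Tm ob E} {A : Ty W E} {e : Eff E}
    (d : CTyp α Γ (.ifz (.nat n) N N') A e) (hd : d.IsHead) :
    ∃ (d₁ : CTyp α Γ N A e) (d₂ : CTyp α Γ N' A e), ∀ g,
      d.interp g = if n = 0 then d₁.interp g else d₂.interp g := by
  cases d with
  | ifz hΦ d d₁ d₂ =>
    refine ⟨d₁, d₂, fun g => ?_⟩
    cases d
    cases n <;> rfl
  | sub => exact hd.elim
  | ex => exact hd.elim

theorem CTyp.inv_ret {Γ : Ctx W E} {V : Val ob E} {A : Ty W E} {e : Eff E}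
    (d : CTyp α Γ (.ret V) A e) (hd : d.IsHead) :
    ∃ d' : VTyp α Γ V A, ∀ g, (d.interp g).1 = d'.interp g ∧
      arr (d.interp g).2.1 = arr (𝟙 (A.obj ob)) := by
  cases d with
  | ret d => exact ⟨d, fun g => ⟨rfl, Circs.arr_cast _ _ _⟩⟩
  | sub => exact hd.elim
  | ex => exact hd.elim

theorem CTyp.closed_lett {Γ : Ctx W E} {N N' : Tm ob E} {B : Ty W E} {e : Eff E}
    (d : CTyp α Γ (.lett N N') B e) (hd : d.IsHead) (g : Γ.flat ob α) {L : LabCtx W}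
    (hL : L.toCtx = Γ) :
    ∃ (L₁ L₂ : LabCtx W) (A : Ty W E) (e₁ e₂ : Eff E) (x : ℕ) (d₁ : CTyp α L₁.toCtx N A e₁)
      (d₂ : CTyp α (L₂.toCtx ++ [.var x A]) (N'.inst 0 (.fvar x)) B e₂),
      L = L₂ ++ L₁ ∧ x ∉ N'.fv ∧
      (d.interp g).1 = (d₂.interp (Ctx.join (Δ := [.var x A]) (LabCtx.pt L₂)
        ((d₁.interp (LabCtx.pt L₁)).1, PUnit.unit))).1 ∧
      arr (d.interp g).2.1 = (arr (d₁.interp (LabCtx.pt L₁)).2.1).lwhisk (L₂.obj ob) ⋆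
        arr (d₂.interp (Ctx.join (Δ := [.var x A]) (LabCtx.pt L₂)
          ((d₁.interp (LabCtx.pt L₁)).1, PUnit.unit))).2.1 := by
  cases d with
  | lett x hΦ hx hxN d₁ d₂ =>
    obtain ⟨rfl, L₂, L₁, rfl, rfl, rfl⟩ := hΦ.toCtx_append hL
    refine ⟨L₁, L₂, _, _, _, x, d₁, d₂, rfl, hxN, ?_⟩
    rw [← LabCtx.eq_pt (Ctx.split (LabCtx.toCtx L₂) (Ctx.split [] g).2).1,
      ← LabCtx.eq_pt (Ctx.split (LabCtx.toCtx L₂) (Ctx.split [] g).2).2]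
    refine ⟨rfl, (Circs.arr_cast _ _ _).trans ?_⟩
    rw [Circs.arr_comp, Circs.arr_cast, ← LabCtx.toCtx_obj (E := E)]
    rfl
  | sub => exact hd.elim
  | ex => exact hd.elim

theorem CTyp.IsHead.exists_isHead {Γ : Ctx W E} {N : Tm ob E} {A : Ty W E} {e : Eff E}
    {d : CTyp α Γ N A e} (hd : d.IsHead) (g : Γ.flat ob α) (L : LabCtx W) (hL : L.toCtx = Γ) :
    ∃ (L₀ : LabCtx W) (q : Eff M) (e₀ : Eff E) (d₀ : CTyp α L₀.toCtx N A e₀), d₀.IsHead ∧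
      PermArr (fun a : ℕ × W => ob a.2) L L₀ q ∧
      (d.interp g).1 = (d₀.interp (LabCtx.pt L₀)).1 ∧
      arr (d.interp g).2.1 = q ⋆ arr (d₀.interp (LabCtx.pt L₀)).2.1 := by
  subst hL
  rw [LabCtx.eq_pt g]
  exact ⟨L, _, e, d, hd, .refl L, rfl, (Eff.id_comp (LabCtx.toCtx_obj ob L).symm).symm⟩

/-- Applications of subsumption and exchange at the end of a derivation can be removed. -/
theorem CTyp.exists_isHead : {Γ : Ctx W E} → {N : Tm ob E} → {A : Ty W E} → {e : Eff E} →
    (d : CTyp α Γ N A e) → ∀ (g : Γ.flat ob α) (L : LabCtx W), L.toCtx = Γ →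
    ∃ (L₀ : LabCtx W) (q : Eff M) (e₀ : Eff E) (d₀ : CTyp α L₀.toCtx N A e₀), d₀.IsHead ∧
      PermArr (fun a : ℕ × W => ob a.2) L L₀ q ∧
      (d.interp g).1 = (d₀.interp (LabCtx.pt L₀)).1 ∧
      arr (d.interp g).2.1 = q ⋆ arr (d₀.interp (LabCtx.pt L₀)).2.1
  | _, _, _, _, .sub d h, g, L, hL => d.exists_isHead g L hL
  | _, _, _, _, .ex (Γ₁ := Γ₁) (Γ₂ := Γ₂) (a := a) (b := b) d h, g, L, hL => by
    obtain ⟨L₁, L₂, l, m, rfl, h₁, h₂, hb, ha⟩ : ∃ (L₁ L₂ : LabCtx W) (l m : ℕ × W),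
        L = L₁ ++ l :: m :: L₂ ∧ L₁.toCtx = Γ₁ ∧ L₂.toCtx = Γ₂ ∧ b = .lab l.1 l.2 ∧
          a = .lab m.1 m.2 := by
      obtain ⟨L₁, L', rfl, h₁, hL'⟩ := LabCtx.eq_append_of_toCtx hL
      rcases L' with _ | ⟨l, _ | ⟨m, L₂⟩⟩
      · cases hL'
      · cases hL'
      · cases hL'
        exact ⟨L₁, L₂, l, m, rfl, h₁, rfl, rfl, rfl⟩
    obtain ⟨L₀, q, e₀, d₀, hd₀, hq, h₃, h₄⟩ := d.exists_isHead (Ctx.swapFlat Γ₁ g)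
      (L₁ ++ m :: l :: L₂) (by
        rw [LabCtx.toCtx_append, h₁, ha, hb, ← h₂]
        rfl)
    refine ⟨L₀, _, e₀, d₀, hd₀, (PermArr.swap L₁ l m L₂).trans hq, h₃, ?_⟩
    have h₅ : arr ((CTyp.ex d h).interp g).2.1 = arr (swapHom (fun c : Entry W E => c.ty.obj ob)
        Γ₁ b a Γ₂) ⋆ arr (d.interp (Ctx.swapFlat Γ₁ g)).2.1 := arr_comp _ _
    have h₆ : ∀ L : LabCtx W, listObj (fun c : Entry W E => c.ty.obj ob) L.toCtx =
        listObj (fun a : ℕ × W => ob a.2) L := LabCtx.toCtx_obj ob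
    rw [h₅, h₄, arr_swapHom, ha, hb, ← h₁, ← h₂, h₆ L₁, h₆ L₂]
    refine (Eff.comp_assoc ?_).symm
    rw [hq.dom]
    simp [listObj_append, tensor_assoc, Entry.ty, Ty.obj]
  | _, _, _, _, .app .., g, L, hL => CTyp.IsHead.exists_isHead (by trivial) g L hL
  | _, _, _, _, .force .., g, L, hL => CTyp.IsHead.exists_isHead (by trivial) g L hL
  | _, _, _, _, .box .., g, L, hL => CTyp.IsHead.exists_isHead (by trivial) g L hL
  | _, _, _, _, .apply .., g, L, hL => CTyp.IsHead.exists_isHead (by trivial) g L hL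
  | _, _, _, _, .dest .., g, L, hL => CTyp.IsHead.exists_isHead (by trivial) g L hL
  | _, _, _, _, .ifz .., g, L, hL => CTyp.IsHead.exists_isHead (by trivial) g L hL
  | _, _, _, _, .ret .., g, L, hL => CTyp.IsHead.exists_isHead (by trivial) g L hL
  | _, _, _, _, .lett .., g, L, hL => CTyp.IsHead.exists_isHead (by trivial) g L hL

end Inversion

/-! ### Soundness -/

section Soundness

variable {W : Type w} {E : Type u'} [Category.{v'} E] [CircuitAlgebra E]
  {M : Type u} [Category.{v} M] [StrictSymPremonoidal M] {ob : W → M} {α : Abstraction M E}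

theorem Bounded.of_arr {X Y X' Y' : M} {C : X ⟶ Y} {C' : X' ⟶ Y'} {e : Eff E}
    (h : Bounded α C e) (hC : arr C = arr C') : Bounded α C' e := by
  cases hC; exact h

theorem arr_append (C D : LCirc ob) (ρ σ : ℕ → ℕ) (R : LabCtx W)
    (p : C.cod.obj ob ⟶ LabCtx.obj ob (D.dom.relabel ρ ++ R))
    (h : LabCtx.Distinct (D.cod.relabel σ ++ R)) :
    arr (LCirc.append ob C D ρ σ R p h).hom =
      arr C.hom ⋆ (arr p ⋆ (arr D.hom).rwhisk (R.obj ob)) := by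
  exact (arr_comp _ _).trans (congrArg _ ((arr_comp _ _).trans (congrArg _
    ((arr_eqToHom_comp _ _).trans (arr_comp_eqToHom _ _)))))

theorem lett_circuit {c p D₁ D₂ c' p' : Eff M} {X Y Y' Z : M} (hY : D₁.dom = Y)
    (hY' : D₁.cod = Y') (hc : c.cod = p.dom) (hp : p.cod = (X ⊗ₚ Y) ⊗ₚ Z)
    (hD : X ⊗ₚ Y' = D₂.dom) (hc' : c'.cod = p'.dom) (hp' : p'.cod = Y' ⊗ₚ X ⊗ₚ Z)
    (h : c ⋆ (p ⋆ (braidArr X Y).rwhisk Z ⋆ D₁.rwhisk (X ⊗ₚ Z)) = c' ⋆ p') :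
    c ⋆ (p ⋆ (D₁.lwhisk X ⋆ D₂).rwhisk Z) =
      c' ⋆ (p' ⋆ (braidArr Y' X).rwhisk Z ⋆ D₂.rwhisk Z) := by
  subst hY hY'
  have h₁ : D₁.lwhisk X = braidArr X D₁.dom ⋆ (D₁.rwhisk X ⋆ braidArr D₁.cod X) := by
    rw [braidArr_natural, ← Eff.comp_assoc (by simp), braidArr_braidArr, Eff.id_comp (by simp)]
  have h₂ : p'.cod = ((braidArr D₁.cod X).rwhisk Z).dom := by simp [hp', tensor_assoc]
  have h₃ : p.cod = ((braidArr X D₁.dom).rwhisk Z).dom := hp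
  rw [Eff.comp_assoc h₂, ← Eff.comp_assoc hc', ← h, h₁, Eff.comp_assoc (by simp),
    Eff.comp_assoc (by simp), Eff.rwhisk_comp _ (by simp), Eff.rwhisk_comp _ (by simp),
    Eff.rwhisk_comp _ (by simp [hD]), Eff.rwhisk_tensor, Eff.comp_assoc (by simpa using hc),
    Eff.comp_assoc h₃, Eff.comp_assoc (e := p) (by simpa using h₃), Eff.comp_assoc (by simp)]

theorem apply_circuit {c p P q D q' r : Eff M} {X Y Z Z' : M} (hqD : q.cod = D.dom)
    (hDq : D.cod = q'.dom) (hcp : c.cod = p.dom)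
    (hP : P.cod = q.dom ⊗ₚ Z') (hp : p.cod = X ⊗ₚ Z) (hX : D.dom = X) (hr : r.dom = Z)
    (hr' : r.cod = Z') (hY : q'.cod = Y) (h : P ⋆ q.rwhisk Z' = p ⋆ r.lwhisk X)
    (hc : r.lwhisk X ⋆ (D ⋆ q').rwhisk Z' = (D ⋆ q').rwhisk Z ⋆ r.lwhisk Y) :
    c ⋆ (P ⋆ (q ⋆ D ⋆ q').rwhisk Z') =
      c ⋆ (p ⋆ D.rwhisk Z) ⋆ (q'.rwhisk Z ⋆ r.lwhisk Y) := by
  subst hX hr hr' hY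
  have h₁ : P.cod = (q.rwhisk r.cod).dom := hP
  have h₂ : p.cod = (r.lwhisk D.dom).dom := hp
  rw [Eff.comp_assoc hqD, Eff.rwhisk_comp _ (by simpa using hqD), ← Eff.comp_assoc h₁, h,
    Eff.comp_assoc h₂, hc, Eff.rwhisk_comp _ hDq, Eff.comp_assoc (e := c) (by simpa using hcp),
    Eff.comp_assoc (e := p) hp, Eff.comp_assoc (by simp [hDq])]

variable (α) in
/-- The output of a circuit `C`, followed by a closed computation `N`, is the output of `C'`
followed by the closed value `V`, for all derivations for `N`. -/
def Sound (C : LCirc ob) (N : Tm ob E) (C' : LCirc ob) (V : Val ob E) : Prop :=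
  ∀ (L Q' : LabCtx W) (P : Eff M) (A : Ty W E) (e : Eff E),
    PermArr (fun a : ℕ × W => ob a.2) C.cod (L ++ Q') P → ∀ d : CTyp α L.toCtx N A e,
    C.dom = C'.dom ∧ ∃ (L' : LabCtx W) (P' : Eff M) (d' : VTyp α L'.toCtx V A),
      PermArr (fun a : ℕ × W => ob a.2) C'.cod (L' ++ Q') P' ∧
      (d.interp (LabCtx.pt L)).1 = d'.interp (LabCtx.pt L') ∧
      arr C.hom ⋆ (P ⋆ (arr (d.interp (LabCtx.pt L)).2.1).rwhisk (Q'.obj ob)) = arr C'.hom ⋆ P'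

theorem Sound.of_isHead {C C' : LCirc ob} {N : Tm ob E} {V : Val ob E}
    (h : ∀ (L Q' : LabCtx W) (P : Eff M) (A : Ty W E) (e : Eff E),
      PermArr (fun a : ℕ × W => ob a.2) C.cod (L ++ Q') P → ∀ d : CTyp α L.toCtx N A e,
      d.IsHead →
      C.dom = C'.dom ∧ ∃ (L' : LabCtx W) (P' : Eff M) (d' : VTyp α L'.toCtx V A),
        PermArr (fun a : ℕ × W => ob a.2) C'.cod (L' ++ Q') P' ∧
        (d.interp (LabCtx.pt L)).1 = d'.interp (LabCtx.pt L') ∧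
        arr C.hom ⋆ (P ⋆ (arr (d.interp (LabCtx.pt L)).2.1).rwhisk (Q'.obj ob)) =
          arr C'.hom ⋆ P') : Sound α C N C' V := by
  intro L Q' P A e hP d
  obtain ⟨L₀, q, e₀, d₀, hd₀, hq, h₁, h₂⟩ := d.exists_isHead (LabCtx.pt L) L rfl
  obtain ⟨h₃, L', P', d', hP', h₄, h₅⟩ := h L₀ Q' _ A e₀ (hP.trans (hq.append_right Q')) d₀ hd₀
  refine ⟨h₃, L', P', d', hP', h₁.trans h₄, ?_⟩
  have h₆ : q.cod = (arr (d₀.interp (LabCtx.pt L₀)).2.1).dom :=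
    hq.cod.trans (LabCtx.toCtx_obj ob L₀).symm
  rw [h₂, Eff.rwhisk_comp _ h₆, ← h₅, Eff.comp_assoc (e := P)]
  rw [hP.cod, Eff.rwhisk_dom, hq.dom, listObj_append]

theorem Eval.sound {C C' : LCirc ob} {N : Tm ob E} {V : Val ob E} (h : Eval C N C' V) :
    Sound α C N C' V := by
  induction h with
  | app h ih =>
    refine .of_isHead fun L Q' P B e hP d hd => ?_
    obtain ⟨L₁, L₂, A, T, d₁, d₂, rfl, h₁, h₂⟩ := d.closed_app hd (LabCtx.pt L) rfl
    cases d₁.lam_ty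
    obtain ⟨x, d', hx, hd'⟩ := d₁.inv_lam
    obtain ⟨t, ht₁, ht₂⟩ := d'.subst_toCtx d₂ hx
    obtain ⟨hC, L', P', v, hP', h₃, h₄⟩ := ih _ Q' P B e hP t
    obtain ⟨h₅, h₆⟩ := hd' (LabCtx.pt L₁) (d₂.interp (LabCtx.pt L₂))
    refine ⟨hC, L', P', v, hP', ?_, ?_⟩
    · rw [h₁, h₅, ← ht₁, h₃]
    · rw [h₂, h₆, ← ht₂, h₄]
  | force h ih =>
    refine .of_isHead fun L Q' P B e hP d hd => ?_
    obtain ⟨d₁, h₁, h₂⟩ := d.closed_force hd (LabCtx.pt L)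
    obtain ⟨t, ht⟩ := d₁.inv_lift
    obtain ⟨hC, L', P', v, hP', h₃, h₄⟩ := ih _ Q' P B e hP t
    obtain ⟨h₅, h₆⟩ := ht (LabCtx.pt L)
    refine ⟨hC, L', P', v, hP', ?_, ?_⟩
    · rw [h₁, h₅, h₃]
    · rw [h₂, h₆, h₄]
  | dest h ih =>
    refine .of_isHead fun L Q' P B e hP d hd => ?_
    obtain ⟨L₁, L₂, A, A', x, y, d₁, d₂, rfl, hxy, hx, hy, h₁, h₂⟩ :=
      d.closed_dest hd (LabCtx.pt L) rfl
    obtain ⟨L₃, L₄, d₃, d₄, rfl, h₃⟩ := d₁.closed_pair (LabCtx.pt L₁) rfl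
    obtain ⟨t, ht₁, ht₂⟩ := d₂.subst₂_toCtx d₃ d₄ hxy hx hy
    obtain ⟨hC, L', P', v, hP', h₄, h₅⟩ := ih _ Q' P B e hP t
    rw [h₃] at h₁ h₂
    refine ⟨hC, L', P', v, hP', ?_, ?_⟩
    · rw [h₁, ← h₄]; exact ht₁.symm
    · rw [h₂, ← h₅, ht₂]
  | ifz_zero h ih =>
    refine .of_isHead fun L Q' P B e hP d hd => ?_
    obtain ⟨d₁, d₂, hd'⟩ := d.inv_ifz hd
    rw [hd', if_pos rfl]
    exact ih _ Q' P B e hP d₁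
  | ifz_succ h ih =>
    refine .of_isHead fun L Q' P B e hP d hd => ?_
    obtain ⟨d₁, d₂, hd'⟩ := d.inv_ifz hd
    rw [hd', if_neg (Nat.succ_ne_zero _)]
    exact ih _ Q' P B e hP d₂
  | ret =>
    refine .of_isHead fun L Q' P B e hP d hd => ?_
    obtain ⟨d', hd'⟩ := d.inv_ret hd
    refine ⟨rfl, L, P, d', hP, (hd' _).1, ?_⟩
    rw [(hd' _).2, Eff.rwhisk_id, Eff.comp_id]
  | lett h h' ih ih' =>
    refine .of_isHead fun L Q' P B e hP d hd => ?_
    obtain ⟨L₁, L₂, A, e₁, e₂, x, d₁, d₂, rfl, hx, h₁, h₂⟩ := d.closed_lett hd (LabCtx.pt L) rfl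
    have hP₁ := (hP.trans ((PermArr.block L₂ L₁).append_right Q')).congr rfl
      (List.append_assoc L₁ L₂ Q') rfl
    obtain ⟨hC, L₁', P₁', u, hP₁', h₃, h₄⟩ := ih L₁ (L₂ ++ Q') _ A e₁ hP₁ d₁
    obtain ⟨t, ht₁, ht₂⟩ := d₂.subst_toCtx u hx
    have hP₂ := (hP₁'.congr rfl (List.append_assoc L₁' L₂ Q').symm rfl).trans
      ((PermArr.block L₁' L₂).append_right Q')
    obtain ⟨hC', L'', P'', v, hP'', h₅, h₆⟩ := ih' (L₂ ++ L₁') Q' _ B e₂ hP₂ t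
    refine ⟨hC.trans hC', L'', P'', v, hP'', ?_, ?_⟩
    · rw [h₁, ← h₅, ht₁, h₃]
    · rw [h₂, ← h₆, ht₂, ← h₃]
      refine lett_circuit (LabCtx.toCtx_obj ob L₁)
        (u.obj_eq.symm.trans (LabCtx.toCtx_obj ob L₁')) hP.dom.symm ?_ ?_ hP₁'.dom.symm ?_ ?_
      · rw [hP.cod, listObj_append, listObj_append]
      · exact (congrArg₂ tensor (LabCtx.toCtx_obj (E := E) ob L₂).symm
          ((LabCtx.toCtx_obj (E := E) ob L₁').symm.trans (u.obj_eq.trans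
            (Ctx.obj_single ob (.var x A)).symm))).trans (Ctx.obj_append ob _ _).symm
      · rw [hP₁'.cod, listObj_append, listObj_append]
      · rw [← listObj_append]
        exact h₄
  | @box C D T V Q b c hQ hb h ih =>
    refine .of_isHead fun L Q' P B e hP d hd => ?_
    obtain ⟨U, e', d', hΓ, rfl, h₁, h₂⟩ := d.closed_box hd (LabCtx.pt L)
    obtain rfl := LabCtx.eq_nil_of_isParam hΓ
    obtain ⟨b'⟩ := hb.nonempty_vtyp (α := α) (ob := ob) (E := E)
    obtain ⟨t, ht⟩ : ∃ t : CTyp α (LabCtx.toCtx _) (.app _ _) U.toTy e',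
        arr (t.interp (LabCtx.pt _)).2.1 = arr (d'.interp (LabCtx.pt []) (T.pt ob α)).2.1 := by
      refine ⟨.app (Φ := []) (Γ₁ := []) hΓ d' b', (Circs.arr_cast _ _ _).trans ?_⟩
      rw [(T.flat_subsingleton (ob := ob) (α := α) (E := E)).elim (T.pt ob α)]
      rfl
    obtain ⟨hD, L', P', v, hP', h₃, h₄⟩ := ih _ [] _ U.toTy e'
      ((PermArr.refl _).congr rfl (List.append_nil _).symm rfl) t
    have hc := v.hasType rfl
    obtain ⟨q, hq, rfl⟩ := (hP'.congr rfl (List.append_nil _) rfl).exists_isPerm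
    obtain ⟨p, hp, hp'⟩ :=
      ((PermArr.refl (f := fun a : ℕ × W => ob a.2) Q).congr rfl hD rfl).exists_isPerm
    have h₅ : arr (t.interp (LabCtx.pt Q)).2.1 = arr (p ≫ D.hom ≫ q) := by
      have hQ' := Eff.id_comp (e := arr (t.interp (LabCtx.pt Q)).2.1)
        (LabCtx.toCtx_obj (E := E) ob Q).symm
      rw [arr_comp, arr_comp, hp', ← h₄]
      change _ = arr (𝟙 (Q.obj ob)) ⋆ (arr (𝟙 (Q.obj ob)) ⋆ (arr (𝟙 (Q.obj ob)) ⋆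
        (arr (t.interp (LabCtx.pt Q)).2.1).rwhisk unit))
      rw [Eff.rwhisk_unit, hQ', hQ', hQ']
    refine ⟨rfl, [], P, .circ p q hΓ hp hq hb hc ((t.interp (LabCtx.pt _)).2.2.of_arr h₅), hP,
      ?_, ?_⟩
    · refine (eq_of_heq h₁).trans (Circs.ext ?_)
      refine (Circs.arr_cast _ _ _).trans (Eq.trans ?_ (Circs.arr_cast _ _ _).symm)
      exact ht.symm.trans h₅
    · rw [h₂, Eff.rwhisk_id, Eff.comp_id]
  | @apply C D b c ρ σ R p h hp =>
    refine .of_isHead fun L Q' P B e hP d hd => ?_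
    obtain ⟨L₁, L₂, T, U, d₁, d₂, rfl, rfl, h₂⟩ := d.closed_apply hd (LabCtx.pt L) rfl
    obtain ⟨Q, L', q, q', hΓ, hq, hq', hb, hc, hd₁⟩ := d₁.inv_boxed
    obtain rfl := LabCtx.eq_nil_of_isParam hΓ
    obtain rfl := (d₂.hasType rfl).unique (hb.relabel ρ)
    obtain ⟨v⟩ := (hc.relabel σ).nonempty_vtyp (α := α) (ob := ob) (E := E)
    have hqρ := PermArr.map (f' := fun a : ℕ × W => ob a.2) (g := fun a : ℕ × W => (ρ a.1, a.2))
      (fun _ => rfl) hq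
    have hqσ := PermArr.map (f' := fun a : ℕ × W => ob a.2) (g := fun a : ℕ × W => (σ a.1, a.2))
      (fun _ => rfl) hq'
    have hR := (List.perm_append_left_iff _).1 ((PermArr.of_isPerm hp).perm.symm.trans
      (hP.perm.trans (hqρ.perm.append_right Q')))
    obtain ⟨r, hr⟩ := PermArr.exists_of_perm (f := fun a : ℕ × W => ob a.2) hR
    have hu := PermArr.unique (List.Nodup.of_map _ (LCirc.cod_distinct _))
      (hP.trans (hqρ.append_right Q')) ((PermArr.of_isPerm hp).trans (hr.append_left _))
    refine ⟨rfl, L'.relabel σ, _, v, (hqσ.append_right R).trans (hr.append_left _),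
      (Bundle.flat_subsingleton U).elim _ _, ?_⟩
    rw [h₂, hd₁, arr_append]
    have hqD : q.cod = (arr D.hom).dom := hq.cod
    have hDq : (arr D.hom).cod = q'.dom := hq'.dom.symm
    have hX : (arr D.hom).dom = LabCtx.obj ob (D.dom.relabel ρ) := (D.dom.relabel_obj ob ρ).symm
    have hY : q'.cod = LabCtx.obj ob (L'.relabel σ) :=
      hq'.cod.trans (L'.relabel_obj ob σ).symm
    have hrc := hr.central (arr D.hom ⋆ q')
    rw [Eff.comp_dom, Eff.comp_cod hDq, hX, hY] at hrc
    refine apply_circuit hqD hDq (PermArr.of_isPerm hp).dom.symm ?_ ?_ hX hr.dom hr.cod hY hu hrc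
    · rw [hP.cod, listObj_append, hq.dom]
      exact congrArg (· ⊗ₚ _) (Q.relabel_obj ob ρ)
    · exact listObj_append _ _ _

theorem ConfTyp.arr_circuit {Q Q' : LabCtx W} {C : LCirc ob} {N : Tm ob E} {A : Ty W E}
    {e : Eff E} (d : ConfTyp α Q C N A Q' e) : arr d.circuit = arr C.hom ⋆ arr d.perm :=
  (arr_eqToHom_comp _ _).trans ((arr_comp _ _).trans (congrArg _ (arr_comp_eqToHom _ _)))

theorem ConfVTyp.arr_circuit {Q Q' : LabCtx W} {C : LCirc ob} {V : Val ob E} {A : Ty W E}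
    (d : ConfVTyp α Q C V A Q') : arr d.circuit = arr C.hom ⋆ arr d.perm :=
  (arr_eqToHom_comp _ _).trans ((arr_comp _ _).trans (congrArg _ (arr_comp_eqToHom _ _)))

end Soundness

end ProtoQuipperR

theorem mainTheorem3
    {M : Type u} [Category.{v} M] [ProtoQuipperR.StrictSymPremonoidal M]
    {E : Type u'} [Category.{v'} E] [ProtoQuipperR.CircuitAlgebra E]
    (α : ProtoQuipperR.Abstraction M E)
    {W : Type w} (ob : W → M)
    {Q Q' : ProtoQuipperR.LabCtx W} {C C' : ProtoQuipperR.LCirc ob}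
    {N : ProtoQuipperR.Tm ob E} {V : ProtoQuipperR.Val ob E} {A : ProtoQuipperR.Ty W E}
    {t₁ t₂ : E} {e : t₁ ⟶ t₂}
    (d : ProtoQuipperR.ConfTyp α Q C N A Q' ⟨t₁, t₂, e⟩)
    (h : ProtoQuipperR.Eval C N C' V) :
    ∃ (d' : ProtoQuipperR.ConfVTyp α Q C' V A Q') (hle : d'.eff.Le d.eff),
      d.interp = fun x => (d'.interpJ x).incl hle := by
  obtain ⟨hC, L', P', t', hP', h₁, h₂⟩ := h.sound d.ctx Q' _ A _ (.of_isPerm d.isPerm) d.typ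
  obtain ⟨p', hp', rfl⟩ := hP'.exists_isPerm
  let d' : ProtoQuipperR.ConfVTyp α Q C' V A Q' := ⟨L', d.dom_eq.trans hC, p', hp', t'⟩
  have hc : ProtoQuipperR.arr (d.interp PUnit.unit).2.1 = ProtoQuipperR.arr d'.circuit := by
    refine (ProtoQuipperR.Circs.arr_comp _ _ d.eff_dom).trans (.trans ?_ (.trans h₂
      d'.arr_circuit.symm))
    refine (congrArg (ProtoQuipperR.Eff.comp · _) d.arr_circuit).trans ?_
    exact ProtoQuipperR.Eff.comp_assoc rfl
  refine ⟨d', (d.interp PUnit.unit).2.2.of_arr hc, ?_⟩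
  funext x
  exact Prod.ext h₁ (ProtoQuipperR.Circs.ext hc)
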